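/- Let $F$ be a number field with adele ring $\mathbb{A}$, let $n\ge 2$, and let $\mathrm{Sp}_{2n}=\{g\in \mathrm{GL}_{2n}: {}^tg\,J\,g=J\}$ with $J=\begin{pmatrix}0&w\\-w&0\end{pmatrix}$, where $w$ is the $n\times n$ antidiagonal matrix of ones. Let $N\subset \mathrm{Sp}_{2n}$ be the subgroup of upper triangular unipotent matrices, let $U=\{u\in N: u_{1,2}=u_{2n-1,2n}=0\}$, and let $\alpha(t)=\mathrm{diag}(t,1,\dots,1,t^{-1})$. Let $\psi:F\backslash\mathbb{A}\to\mathbb{C}^\times$ be a non-trivial continuous additive character and put $\psi_N(u)=\psi\big(\sum_{i=1}^n u_{i,i+1}\big)$ for $u\in N(\mathbb{A})$. Let $\varphi$ be a cusp form on $\mathrm{Sp}_{2n}(\mathbb{A})$ (for instance, any $\varphi$ in the space of an irreducible cuspidal automorphic generic representation of $\mathrm{Sp}_{2n}(\mathbb{A})$); only the following is required: $\varphi:\mathrm{Sp}_{2n}(\mathbb{A})\to\mathbb{C}$ is left invariant under $\mathrm{Sp}_{2n}(F)$; it is smooth, i.e. near every point it depends only on the archimedean component and is a $C^\infty$ function of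 it; and $\int_{R(F)\backslash R(\mathbb{A})}\varphi(rg)\,dr=0$ for all $g\in\mathrm{Sp}_{2n}(\mathbb{A})$ and the unipotent radical $R$ of every standard maximal parabolic subgroup of $\mathrm{Sp}_{2n}$. For each unipotent subgroup $H$ occurring here, let the measure on $H(F)\backslash H(\mathbb{A})$ be the $H(\mathbb{A})$-invariant measure of total mass $1$, and put $$W_{\varphi,\psi_N}(g)=\int_{N(F)\backslash N(\mathbb{A})}\varphi(ug)\,\psi_N^{-1}(u)\,du .$$ Then for every $g\in \mathrm{Sp}_{2n}(\mathbb{A})$ $$\int_{U(F)\backslash U(\mathbb{A})}\varphi(ug)\,\psi_N^{-1}(u)\,du=\sum_{\xi\in F^\times}W_{\varphi,\psi_N}(\alpha(\xi)g),$$ where the integrals on both sides and the sum over $\xi$ converge absolutely. -/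

import Mathlib

open MeasureTheory Topology Filter
open scoped Matrix ContDiff

noncomputable section

namespace SpUnfolding

/-! ### The symplectic group in upper triangular coordinates -/

/-- The matrix `[0, w; -w, 0]`, where `w` is the `n × n` antidiagonal matrix of ones. -/
def formJ (n : ℕ) (R : Type*) [CommRing R] : Matrix (Fin (2 * n)) (Fin (2 * n)) R :=
  Matrix.of fun i j => if j = i.rev then (if (i : ℕ) < n then 1 else -1) else 0

/-- `Sp_{2n}(R)`, realised as `{g ∈ GL_{2n}(R) : gᵀ J g = J}`.  With this form the upper triangular
matrices in `Sp_{2n}` form a Borel subgroup. -/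
def spSubgroup (n : ℕ) (R : Type*) [CommRing R] : Subgroup (GL (Fin (2 * n)) R) where
  carrier := {g | (g : Matrix (Fin (2 * n)) (Fin (2 * n)) R)ᵀ * formJ n R *
    (g : Matrix (Fin (2 * n)) (Fin (2 * n)) R) = formJ n R}
  one_mem' := by simp
  mul_mem' := by
    intro a b ha hb
    simp only [Set.mem_ofPred_eq] at ha hb ⊢
    rw [Units.val_mul, Matrix.transpose_mul]
    calc _ = (b : Matrix (Fin (2 * n)) (Fin (2 * n)) R)ᵀ *
          ((a : Matrix (Fin (2 * n)) (Fin (2 * n)) R)ᵀ * formJ n R *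
            (a : Matrix (Fin (2 * n)) (Fin (2 * n)) R)) *
          (b : Matrix (Fin (2 * n)) (Fin (2 * n)) R) := by simp only [Matrix.mul_assoc]
      _ = _ := by rw [ha, hb]
  inv_mem' := by
    intro a ha
    simp only [Set.mem_ofPred_eq] at ha ⊢
    have h1 : (a : Matrix (Fin (2 * n)) (Fin (2 * n)) R) *
        ((a⁻¹ : GL (Fin (2 * n)) R) : Matrix (Fin (2 * n)) (Fin (2 * n)) R) = 1 := a.mul_inv
    have h2 : (((a⁻¹ : GL (Fin (2 * n)) R) : Matrix (Fin (2 * n)) (Fin (2 * n)) R))ᵀ *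
        (a : Matrix (Fin (2 * n)) (Fin (2 * n)) R)ᵀ = 1 := by
      rw [← Matrix.transpose_mul, h1, Matrix.transpose_one]
    set B := ((a⁻¹ : GL (Fin (2 * n)) R) : Matrix (Fin (2 * n)) (Fin (2 * n)) R)
    calc Bᵀ * formJ n R * B
        = Bᵀ * ((a : Matrix (Fin (2 * n)) (Fin (2 * n)) R)ᵀ * formJ n R *
            (a : Matrix (Fin (2 * n)) (Fin (2 * n)) R)) * B := by rw [ha]
      _ = (Bᵀ * (a : Matrix (Fin (2 * n)) (Fin (2 * n)) R)ᵀ) * formJ n R *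
            ((a : Matrix (Fin (2 * n)) (Fin (2 * n)) R) * B) := by simp only [Matrix.mul_assoc]
      _ = formJ n R := by rw [h1, h2, Matrix.one_mul, Matrix.mul_one]

/-- The group `Sp_{2n}(R)`; it carries the topology induced from `GL_{2n}(R)`. -/
abbrev Sp (n : ℕ) (R : Type*) [CommRing R] : Type _ := spSubgroup n R

/-- The `(i, j)` entry of a symplectic matrix. -/
def Sp.entry {n : ℕ} {R : Type*} [CommRing R] (g : Sp n R) (i j : Fin (2 * n)) : R :=
  (g : GL (Fin (2 * n)) R).val i j

theorem formJ_map {n : ℕ} {R S : Type*} [CommRing R] [CommRing S] (f : R →+* S) :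
    (formJ n R).map f = formJ n S := by
  ext i j
  simp only [formJ, Matrix.map_apply, Matrix.of_apply]
  split_ifs <;> simp

/-- The homomorphism `Sp_{2n}(R) → Sp_{2n}(S)` obtained by applying a ring homomorphism to all the
entries. -/
def Sp.map {n : ℕ} {R S : Type*} [CommRing R] [CommRing S] (f : R →+* S) : Sp n R →* Sp n S :=
  ((Matrix.GeneralLinearGroup.map f).comp (spSubgroup n R).subtype).codRestrict (spSubgroup n S) <| by
    rintro ⟨g, hg⟩
    have hg' : (g : Matrix (Fin (2 * n)) (Fin (2 * n)) R)ᵀ * formJ n R *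
      (g : Matrix (Fin (2 * n)) (Fin (2 * n)) R) = formJ n R := hg
    change ((g : Matrix (Fin (2 * n)) (Fin (2 * n)) R).map f)ᵀ * formJ n S *
      ((g : Matrix (Fin (2 * n)) (Fin (2 * n)) R).map f) = formJ n S
    rw [← formJ_map f, ← Matrix.transpose_map, ← Matrix.map_mul, ← Matrix.map_mul, hg']

/-- The diagonal entries `(t, 1, …, 1, t⁻¹)`. -/
def alphaDiag (n : ℕ) {R : Type*} [CommRing R] (t : Rˣ) (i : Fin (2 * n)) : R :=
  if (i : ℕ) = 0 then (t : R) else if (i : ℕ) + 1 = 2 * n then ((t⁻¹ : Rˣ) : R) else 1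

/-- The element `α(t) = diag(t, 1, …, 1, t⁻¹)` of `Sp_{2n}(R)`. -/
def alpha (n : ℕ) {R : Type*} [CommRing R] (t : Rˣ) : Sp n R :=
  ⟨⟨Matrix.diagonal (alphaDiag n t), Matrix.diagonal (alphaDiag n t⁻¹), by
      rw [Matrix.diagonal_mul_diagonal, ← Matrix.diagonal_one]
      congr 1; funext i; simp only [alphaDiag]; split_ifs <;> simp, by
      rw [Matrix.diagonal_mul_diagonal, ← Matrix.diagonal_one]
      congr 1; funext i; simp only [alphaDiag]; split_ifs <;> simp⟩, by
    change (Matrix.diagonal (alphaDiag n t))ᵀ * formJ n R * Matrix.diagonal (alphaDiag n t) =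
      formJ n R
    ext i j
    rw [Matrix.diagonal_transpose, Matrix.mul_diagonal, Matrix.diagonal_mul]
    simp only [formJ, Matrix.of_apply]
    by_cases hj : j = i.rev
    · have hij : alphaDiag n t i * alphaDiag n t j = 1 := by
        have h1 : (j : ℕ) + (i : ℕ) + 1 = 2 * n := by
          subst hj; rw [Fin.val_rev]; omega
        simp only [alphaDiag]
        split_ifs <;> first | omega | simp
      rw [mul_right_comm, hij, one_mul]
    · simp [hj]⟩

/-! ### Unipotent subgroups -/

/-- For a labelling `b` of the indices: the matrices in `Sp_{2n}(R)` whose entry `(i, j)` agrees with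
that of the identity matrix whenever `b j ≤ b i`.  If `b` is weakly increasing, these are the block
upper triangular matrices with identity diagonal blocks, the blocks being the fibres of `b`. -/
def blockUnipotent (n : ℕ) (R : Type*) [CommRing R] (b : Fin (2 * n) → ℕ) :
    Subgroup (Sp n R) where
  carrier := {g | ∀ i j, b j ≤ b i → g.entry i j = (1 : Matrix (Fin (2 * n)) (Fin (2 * n)) R) i j}
  one_mem' := by intro i j _; rfl
  mul_mem' := by
    intro g h hg hh i j hij
    change (((g : GL (Fin (2 * n)) R).val * (h : GL (Fin (2 * n)) R).val) i j) = _
    rw [Matrix.mul_apply, Finset.sum_eq_single i]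
    · have h1 := hg i i le_rfl
      have h2 := hh i j hij
      simp only [Sp.entry, Matrix.one_apply_eq] at h1 h2
      rw [h1, one_mul, h2]
    · intro k _ hk
      rcases le_or_gt (b k) (b i) with hki | hki
      · have h1 := hg i k hki
        rw [Matrix.one_apply_ne (Ne.symm hk)] at h1
        simp only [Sp.entry] at h1
        rw [h1, zero_mul]
      · have h2 := hh k j (by omega)
        rw [Matrix.one_apply_ne (by rintro rfl; omega)] at h2
        simp only [Sp.entry] at h2
        rw [h2, mul_zero]
    · simp
  inv_mem' := by
    intro g hg
    have hmul : ∀ i j, ∑ k, g.entry i k * (g⁻¹).entry k j =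
        (1 : Matrix (Fin (2 * n)) (Fin (2 * n)) R) i j := by
      intro i j
      have : (g : GL (Fin (2 * n)) R).val * ((g⁻¹ : Sp n R) : GL (Fin (2 * n)) R).val = 1 :=
        (g : GL (Fin (2 * n)) R).mul_inv
      rw [← this, Matrix.mul_apply]
      rfl
    have key : ∀ m i j, (∑ k, b k) - b i ≤ m → b j ≤ b i →
        (g⁻¹).entry i j = (1 : Matrix (Fin (2 * n)) (Fin (2 * n)) R) i j := by
      intro m
      induction m with
      | zero =>
        intro i j hm hij
        rw [← hmul i j, Finset.sum_eq_single i]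
        · rw [hg i i le_rfl, Matrix.one_apply_eq, one_mul]
        · intro k _ hk
          have hk2 : b k ≤ ∑ k, b k := Finset.single_le_sum (f := b) (by simp) (Finset.mem_univ k)
          rw [hg i k (by omega), Matrix.one_apply_ne (Ne.symm hk), zero_mul]
        · simp
      | succ m ih =>
        intro i j hm hij
        rw [← hmul i j, Finset.sum_eq_single i]
        · rw [hg i i le_rfl, Matrix.one_apply_eq, one_mul]
        · intro k _ hk
          have hk2 : b k ≤ ∑ k, b k := Finset.single_le_sum (f := b) (by simp) (Finset.mem_univ k)
          rcases le_or_gt (b k) (b i) with hki | hki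
          · rw [hg i k hki, Matrix.one_apply_ne (Ne.symm hk), zero_mul]
          · rw [ih k j (by omega) (by omega), Matrix.one_apply_ne (by rintro rfl; omega), mul_zero]
        · simp
    intro i j hij
    exact key _ i j le_rfl hij

/-- The standard maximal unipotent subgroup `N(R)`: upper triangular with ones on the diagonal. -/
def subgroupN (n : ℕ) (R : Type*) [CommRing R] : Subgroup (Sp n R) :=
  blockUnipotent n R fun i => (i : ℕ)

/-- The unipotent radical (for `1 ≤ k ≤ n`) of the standard maximal parabolic subgroup with Levi
subgroup `GL_k × Sp_{2n-2k}`: the diagonal blocks have sizes `k, 2n - 2k, k`. -/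
def parabolicRadical (n : ℕ) (R : Type*) [CommRing R] (k : ℕ) : Subgroup (Sp n R) :=
  blockUnipotent n R fun i => if (i : ℕ) < k then 0 else if (i : ℕ) + k < 2 * n then 1 else 2

theorem entry_mul_of_succ {n : ℕ} {R : Type*} [CommRing R] {g h : Sp n R}
    (hg : g ∈ subgroupN n R) (hh : h ∈ subgroupN n R) {i j : Fin (2 * n)}
    (hij : (j : ℕ) = (i : ℕ) + 1) : (g * h).entry i j = g.entry i j + h.entry i j := by
  have hne : i ≠ j := by rintro rfl; omega
  change (((g : GL (Fin (2 * n)) R).val * (h : GL (Fin (2 * n)) R).val) i j) = _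
  rw [Matrix.mul_apply]
  have h1 : ∑ k, (g : GL (Fin (2 * n)) R).val i k * (h : GL (Fin (2 * n)) R).val k j =
      ∑ k, ((if k = i then h.entry i j else 0) + if k = j then g.entry i j else 0) := by
    refine Finset.sum_congr rfl fun k _ => ?_
    change g.entry i k * h.entry k j = _
    by_cases hki : k = i
    · subst hki
      rw [hg k k le_rfl, Matrix.one_apply_eq]
      simp [hne]
    · by_cases hkj : k = j
      · subst hkj
        rw [hh k k le_rfl, Matrix.one_apply_eq]
        simp [hki]
      · rw [if_neg hki, if_neg hkj, add_zero]
        rcases lt_or_gt_of_ne (fun h => hki (Fin.ext h) : (k : ℕ) ≠ i) with hlt | hgt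
        · rw [hg i k hlt.le, Matrix.one_apply_ne (Ne.symm hki), zero_mul]
        · have : (k : ℕ) ≠ j := fun h => hkj (Fin.ext h)
          rw [hh k j (by omega : (j : ℕ) ≤ k), Matrix.one_apply_ne hkj, mul_zero]
  rw [h1, Finset.sum_add_distrib]
  simp [add_comm]

/-- The subgroup `U(R)` of `N(R)` where the entries `(1, 2)` and `(2n - 1, 2n)` (numbered from `1`)
vanish. -/
def subgroupU (n : ℕ) (R : Type*) [CommRing R] : Subgroup (Sp n R) where
  carrier := {g | g ∈ subgroupN n R ∧ ∀ i j : Fin (2 * n), (j : ℕ) = (i : ℕ) + 1 →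
    ((j : ℕ) = 1 ∨ (j : ℕ) + 1 = 2 * n) → g.entry i j = 0}
  one_mem' := by
    refine ⟨one_mem _, fun i j hij _ => ?_⟩
    exact Matrix.one_apply_ne (by rintro rfl; omega)
  mul_mem' := by
    intro g h hg hh
    refine ⟨mul_mem hg.1 hh.1, fun i j hij hj => ?_⟩
    rw [entry_mul_of_succ hg.1 hh.1 hij, hg.2 i j hij hj, hh.2 i j hij hj, add_zero]
  inv_mem' := by
    intro g hg
    refine ⟨inv_mem hg.1, fun i j hij hj => ?_⟩
    have h1 := entry_mul_of_succ hg.1 (inv_mem hg.1) hij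
    rw [mul_inv_cancel, hg.2 i j hij hj, zero_add] at h1
    rw [← h1]
    exact Matrix.one_apply_ne (by rintro rfl; omega)

/-! ### Adelic quotients -/

/-- The adele ring of the number field `F`. -/
abbrev Adele (F : Type*) [Field F] [NumberField F] : Type _ :=
  NumberField.AdeleRing (NumberField.RingOfIntegers F) F

/-- `Sp_{2n}(F)` as a subgroup of `Sp_{2n}(𝔸)`. -/
def rationalPoints (n : ℕ) (F : Type*) [Field F] [NumberField F] : Subgroup (Sp n (Adele F)) :=
  (Sp.map (n := n) (algebraMap F (Adele F))).range

/-- For a subgroup `H` of `Sp_{2n}(𝔸)`, the quotient `(H ∩ Sp_{2n}(F)) \ H`, with the quotient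
topology and its Borel `σ`-algebra.  For `H = U(𝔸)` this is `U(F) \ U(𝔸)`, and so on. -/
def AdelicQuotient {n : ℕ} {F : Type*} [Field F] [NumberField F]
    (H : Subgroup (Sp n (Adele F))) : Type _ :=
  Quotient (QuotientGroup.rightRel ((rationalPoints n F).subgroupOf H))

instance {n : ℕ} {F : Type*} [Field F] [NumberField F] (H : Subgroup (Sp n (Adele F))) :
    TopologicalSpace (AdelicQuotient H) :=
  inferInstanceAs (TopologicalSpace
    (Quotient (QuotientGroup.rightRel ((rationalPoints n F).subgroupOf H))))

instance {n : ℕ} {F : Type*} [Field F] [NumberField F] (H : Subgroup (Sp n (Adele F))) :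
    MeasurableSpace (AdelicQuotient H) := borel _

instance {n : ℕ} {F : Type*} [Field F] [NumberField F] (H : Subgroup (Sp n (Adele F))) :
    BorelSpace (AdelicQuotient H) := ⟨rfl⟩

/-- A representative in `H` of a coset; used only for functions that are constant on cosets. -/
def AdelicQuotient.rep {n : ℕ} {F : Type*} [Field F] [NumberField F]
    {H : Subgroup (Sp n (Adele F))} (q : AdelicQuotient H) : H :=
  Quotient.out q

/-- Right translation by `h ∈ H` on `(H ∩ Sp_{2n}(F)) \ H`. -/
def AdelicQuotient.rightTranslate {n : ℕ} {F : Type*} [Field F] [NumberField F]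
    {H : Subgroup (Sp n (Adele F))} (h : H) : AdelicQuotient H → AdelicQuotient H :=
  Quotient.map (fun x : H => x * h) <| by
    intro a b hab
    have hab' := QuotientGroup.rightRel_apply.1 hab
    exact QuotientGroup.rightRel_apply.2 (by simpa [mul_assoc] using hab')

/-- `μ` is the `H`-invariant Borel measure of total mass one on `(H ∩ Sp_{2n}(F)) \ H`. -/
structure IsInvariantProbability {n : ℕ} {F : Type*} [Field F] [NumberField F]
    {H : Subgroup (Sp n (Adele F))} (μ : Measure (AdelicQuotient H)) : Prop where
  isProbabilityMeasure : IsProbabilityMeasure μ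
  map_rightTranslate : ∀ h : H, μ.map (AdelicQuotient.rightTranslate h) = μ

/-! ### Cusp forms -/

/-- The archimedean coordinates of `g ∈ Sp_{2n}(𝔸)`: the family, over the archimedean places `v`,
of the matrices of `g` at `v`, with entries in `F_v ⊆ ℂ`.  This is `g ↦ g_∞`, where `Sp_{2n}(F_∞)` is
viewed as a closed real submanifold of a finite dimensional real vector space. -/
def archCoord {n : ℕ} {F : Type*} [Field F] [NumberField F] (g : Sp n (Adele F)) :
    Fin (2 * n) → Fin (2 * n) → NumberField.InfinitePlace F → ℂ :=
  fun i j v => NumberField.InfinitePlace.Completion.extensionEmbedding v ((g.entry i j).1 v)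

/-- Smooth functions on `Sp_{2n}(𝔸)`: near every point, the function depends only on the archimedean
component and is a `C^∞` function of it (a function on the submanifold `Sp_{2n}(F_∞)` is `C^∞` near a
point if and only if it extends to a `C^∞` function near that point of the ambient space). -/
def IsSmooth {n : ℕ} {F : Type*} [Field F] [NumberField F] (φ : Sp n (Adele F) → ℂ) : Prop :=
  ∀ g : Sp n (Adele F),
    ∃ Φ : (Fin (2 * n) → Fin (2 * n) → NumberField.InfinitePlace F → ℂ) → ℂ,
      ContDiffAt ℝ ∞ Φ (archCoord g) ∧ ∀ᶠ h in 𝓝 g, φ h = Φ (archCoord h)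

/-- Smooth cuspidal functions on `Sp_{2n}(F) \ Sp_{2n}(𝔸)`.  Every cusp form is one; conditions of
finiteness under a maximal compact subgroup and under the centre of the enveloping algebra, and of
growth, are not imposed. -/
structure IsSmoothCuspForm {n : ℕ} {F : Type*} [Field F] [NumberField F]
    (φ : Sp n (Adele F) → ℂ) : Prop where
  left_invariant : ∀ γ ∈ rationalPoints n F, ∀ g, φ (γ * g) = φ g
  smooth : IsSmooth φ
  cuspidal : ∀ k, 1 ≤ k → k ≤ n →
    ∀ μ : Measure (AdelicQuotient (parabolicRadical n (Adele F) k)), IsInvariantProbability μ →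
      ∀ g, ∫ q, φ ((q.rep : Sp n (Adele F)) * g) ∂μ = 0

/-! ### Fourier coefficients -/

/-- `ψ_N(u) = ψ(u_{1,2} + u_{2,3} + ⋯ + u_{n,n+1})` (numbered from `1`). -/
def psiN {n : ℕ} {F : Type*} [Field F] [NumberField F] (ψ : AddChar (Adele F) ℂ)
    (u : Sp n (Adele F)) : ℂ :=
  ψ (∑ i : Fin n, u.entry ⟨i, by omega⟩ ⟨i + 1, by omega⟩)

/-- The function `u ↦ φ(u g) ψ_N(u)⁻¹` on `H(F) \ H(𝔸)`, for a subgroup `H` of `N`. -/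
def fourierIntegrand {n : ℕ} {F : Type*} [Field F] [NumberField F]
    (H : Subgroup (Sp n (Adele F))) (ψ : AddChar (Adele F) ℂ) (φ : Sp n (Adele F) → ℂ)
    (g : Sp n (Adele F)) (q : AdelicQuotient H) : ℂ :=
  φ ((q.rep : Sp n (Adele F)) * g) * (psiN ψ (q.rep : Sp n (Adele F)))⁻¹

/-- The Whittaker function `W_{φ, ψ_N}(g) = ∫_{N(F) \ N(𝔸)} φ(u g) ψ_N(u)⁻¹ du`, where `du` is the
measure `μ`. -/
def whittaker {n : ℕ} {F : Type*} [Field F] [NumberField F]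
    (μ : Measure (AdelicQuotient (subgroupN n (Adele F)))) (ψ : AddChar (Adele F) ℂ)
    (φ : Sp n (Adele F) → ℂ) (g : Sp n (Adele F)) : ℂ :=
  ∫ q, fourierIntegrand (subgroupN n (Adele F)) ψ φ g q ∂μ

end SpUnfolding

end

/-!
Average `φ` against `ψ_N⁻¹` over `U` and restrict the result to the root subgroup `x₁₂`. This gives
a function of `t` on the compact group `𝔸 / F`, whose characters are `t ↦ ψ(ξ t)`, `ξ ∈ F`. The
value at `0` of its Fourier series is the identity to be proved: for `ξ ≠ 0`, conjugating by `α(ξ)`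
turns the `ξ`-th coefficient into `W(α(ξ) g)`, while the coefficient at `ξ = 0` contains an inner
integral over the unipotent radical of the first maximal parabolic, which vanishes by cuspidality.
The series converges absolutely because smoothness restricts `ξ` to a fractional ideal, where the
coefficients decay faster than any power of `ξ`; the decay comes from iterated finite differences in
the archimedean variable.

Compactness of `H(F) \ H(𝔸)` and Fubini's theorem are both obtained by building `H` out of
one-parameter subgroups, each central modulo the preceding ones.
-/

noncomputable section

namespace SpUnfolding

/-! ### Compactness of `𝔸 / F` -/

section FiniteAdeles

open IsDedekindDomain HeightOneSpectrum WithZero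

variable {R K : Type*} [CommRing R] [IsDedekindDomain R] [Field K] [Algebra R K]
  [IsFractionRing R K]

theorem exists_exp_neg_natCast_lt {γ : ℤᵐ⁰} (hγ : γ ≠ 0) : ∃ k : ℕ, exp (-(k : ℤ)) < γ := by
  refine ⟨(log γ).natAbs + 1, lt_of_lt_of_eq ?_ (exp_log hγ)⟩
  rw [exp_lt_exp]
  omega

theorem hasBasis_nhds_zero_adicCompletion (v : HeightOneSpectrum R) :
    (𝓝 (0 : v.adicCompletion K)).HasBasis (fun _ : ℕ => True)
      fun k => {x | Valued.v x ≤ exp (-(k : ℤ))} := by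
  refine (Valued.hasBasis_nhds_zero (v.adicCompletion K) ℤᵐ⁰).to_hasBasis (fun γ _ => ?_)
    fun k _ => ?_
  · obtain ⟨k, hk⟩ := exists_exp_neg_natCast_lt
      (γ := MonoidWithZeroHom.ValueGroup₀.embedding γ.1) (by simp)
    exact ⟨k, trivial, fun x hx => (Valuation.restrict_lt_iff_lt_embedding _).2
      (lt_of_le_of_lt hx hk)⟩
  · obtain ⟨d, hd⟩ := valuedAdicCompletion_surjective K v (exp (-(k : ℤ)))
    have hd0 : Valued.v.restrict d ≠ 0 := by
      rw [ne_eq, Valuation.restrict_eq_zero_iff, hd]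
      exact exp_ne_zero
    exact ⟨Units.mk0 _ hd0, trivial,
      fun x hx => ((Valuation.restrict_lt_iff _).1 hx).le.trans hd.le⟩

theorem coe_sub_adicCompletion (v : HeightOneSpectrum R) (x y : K) :
    ((x - y : K) : v.adicCompletion K) = x - y := by
  have h := map_sub (algebraMap K (v.adicCompletion K)) x y
  rwa [algebraMap_adicCompletion] at h

theorem exists_valued_sub_le (v : HeightOneSpectrum R) {y : v.adicCompletion K}
    (hy : y ∈ v.adicCompletionIntegers K) (k : ℕ) :
    ∃ r : R, Valued.v (y - ((algebraMap R K r : K) : v.adicCompletion K)) ≤ exp (-(k : ℤ)) := by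
  have hball : {z | Valued.v (y - z) ≤ exp (-(k : ℤ))} ∈ 𝓝 y := by
    have hcont : Tendsto (fun z => y - z) (𝓝 y) (𝓝 0) := by
      simpa using (continuous_const.sub continuous_id).tendsto (f := fun z => y - z) y
    exact hcont ((hasBasis_nhds_zero_adicCompletion v).mem_of_mem trivial)
  obtain ⟨x, hx⟩ : ∃ x : K, Valued.v (y - (x : v.adicCompletion K)) ≤ exp (-(k : ℤ)) :=
    (denseRange_algebraMap K v).mem_nhds hball
  have hx_integral : v.valuation K x ≤ 1 := by
    have hle : exp (-(k : ℤ)) ≤ (1 : ℤᵐ⁰) := by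
      rw [← exp_zero, exp_le_exp]
      omega
    rw [← valuedAdicCompletion_eq_valuation',
      ← sub_sub_cancel y (x : v.adicCompletion K)]
    exact (Valuation.map_sub _ _ _).trans (max_le hy (hx.trans hle))
  obtain ⟨r, hr⟩ := v.exists_valuation_sub_lt_of_integer hx_integral
    (Units.mk0 (exp (-(k : ℤ))) exp_ne_zero)
  refine ⟨r, ?_⟩
  have hsplit : y - ((algebraMap R K r : K) : v.adicCompletion K) =
      (y - (x : v.adicCompletion K)) - ((algebraMap R K r - x : K) : v.adicCompletion K) := by
    rw [coe_sub_adicCompletion, sub_sub_sub_cancel_right]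
  rw [hsplit]
  refine (Valuation.map_sub _ _ _).trans (max_le hx ?_)
  rw [valuedAdicCompletion_eq_valuation']
  exact hr.le

theorem mem_maximalIdeal_adicCompletionIntegers_iff {v : HeightOneSpectrum R}
    {x : v.adicCompletionIntegers K} :
    x ∈ IsLocalRing.maximalIdeal (v.adicCompletionIntegers K) ↔
      Valued.v (x : v.adicCompletion K) < 1 := by
  rw [← not_iff_not, IsLocalRing.notMem_maximalIdeal,
    adicCompletionIntegers.isUnit_iff_valued_eq_one, not_lt]
  exact ⟨ge_of_eq, fun h => le_antisymm x.2 h⟩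

instance finite_residueField_adicCompletionIntegers [Ring.HasFiniteQuotients R]
    (v : HeightOneSpectrum R) :
    Finite (IsLocalRing.ResidueField (v.adicCompletionIntegers K)) := by
  have : Finite (R ⧸ v.asIdeal) := Ring.HasFiniteQuotients.finiteQuotient v.ne_bot
  let f : R →+* IsLocalRing.ResidueField (v.adicCompletionIntegers K) :=
    (IsLocalRing.residue _).comp (algebraMap R (v.adicCompletionIntegers K))
  have hf : Function.Surjective f := by
    intro z
    obtain ⟨y, rfl⟩ := IsLocalRing.residue_surjective z
    obtain ⟨r, hr⟩ := exists_valued_sub_le v y.2 1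
    refine ⟨r, ?_⟩
    rw [RingHom.comp_apply, eq_comm, ← sub_eq_zero, ← map_sub, IsLocalRing.residue_eq_zero_iff,
      mem_maximalIdeal_adicCompletionIntegers_iff]
    exact hr.trans_lt (by rw [← exp_zero, exp_lt_exp]; norm_num)
  have hker : ∀ a ∈ v.asIdeal, f a = 0 := by
    intro a ha
    rw [RingHom.comp_apply, IsLocalRing.residue_eq_zero_iff,
      mem_maximalIdeal_adicCompletionIntegers_iff, algebraMap_adicCompletionIntegers_apply,
      valuedAdicCompletion_eq_valuation', valuation_lt_one_iff_mem]
    exact ha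
  exact Finite.of_surjective (Ideal.Quotient.lift v.asIdeal f hker)
    (Ideal.Quotient.lift_surjective_of_surjective _ _ hf)

instance compactSpace_adicCompletionIntegers {F : Type*} [Field F] [NumberField F]
    (v : HeightOneSpectrum (NumberField.RingOfIntegers F)) :
    CompactSpace (v.adicCompletionIntegers F) := by
  have hcomplete : CompleteSpace (Valued.integer (v.adicCompletion F)) :=
    (Valued.isClosed_integer (v.adicCompletion F)).completeSpace_coe
  open Valued.integer in
  exact compactSpace_iff_completeSpace_and_isDiscreteValuationRing_and_finite_residueField.2
    ⟨hcomplete, inferInstanceAs (IsDiscreteValuationRing (v.adicCompletionIntegers F)),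
      finite_residueField_adicCompletionIntegers v⟩

variable (R K) in
/-- The ring `Ô` of finite adeles which are integral at every place. -/
def integralFiniteAdeles : Subring (FiniteAdeleRing R K) where
  carrier := {a | ∀ v, a v ∈ v.adicCompletionIntegers K}
  zero_mem' v := zero_mem (v.adicCompletionIntegers K)
  one_mem' v := one_mem (v.adicCompletionIntegers K)
  add_mem' ha hb v := add_mem (ha v) (hb v)
  mul_mem' ha hb v := mul_mem (ha v) (hb v)
  neg_mem' ha v := neg_mem (ha v)

theorem algebraMap_mem_integralFiniteAdeles (r : R) :
    algebraMap K (FiniteAdeleRing R K) (algebraMap R K r) ∈ integralFiniteAdeles R K :=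
  fun v => coe_mem_adicCompletionIntegers v r

theorem range_structureMap_eq_integralFiniteAdeles :
    Set.range (RestrictedProduct.structureMap (fun v : HeightOneSpectrum R => v.adicCompletion K)
      (fun v => (v.adicCompletionIntegers K : Set (v.adicCompletion K))) cofinite) =
      (integralFiniteAdeles R K : Set (FiniteAdeleRing R K)) :=
  RestrictedProduct.range_structureMap ..

theorem isCompact_integralFiniteAdeles
    [∀ v : HeightOneSpectrum R, CompactSpace (v.adicCompletionIntegers K)] :
    IsCompact (integralFiniteAdeles R K : Set (FiniteAdeleRing R K)) := by
  rw [← range_structureMap_eq_integralFiniteAdeles]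
  have (v : HeightOneSpectrum R) :
      CompactSpace (v.adicCompletionIntegers K : Set (v.adicCompletion K)) :=
    inferInstanceAs (CompactSpace (v.adicCompletionIntegers K))
  exact isCompact_range RestrictedProduct.isEmbedding_structureMap.continuous

theorem isOpen_integralFiniteAdeles :
    IsOpen (integralFiniteAdeles R K : Set (FiniteAdeleRing R K)) :=
  RestrictedProduct.isOpen_forall_mem fun _ => Valued.isOpen_valuationSubring _

theorem exists_ne_zero_algebraMap_mul_mem (a : FiniteAdeleRing R K) :
    ∃ r : R, r ≠ 0 ∧ algebraMap K (FiniteAdeleRing R K) (algebraMap R K r) * a ∈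
      integralFiniteAdeles R K := by
  classical
  have hS : {v | ¬ a v ∈ v.adicCompletionIntegers K}.Finite := a.2
  choose b hb hab using fun v : HeightOneSpectrum R =>
    adicCompletion.mul_nonZeroDivisor_mem_adicCompletionIntegers v (a v)
  refine ⟨∏ v ∈ hS.toFinset, b v, Finset.prod_ne_zero_iff.2 fun v _ =>
    nonZeroDivisors.ne_zero (hb v), fun v => ?_⟩
  change ((algebraMap R K (∏ v ∈ hS.toFinset, b v) : K) : v.adicCompletion K) * a v ∈ _
  by_cases hv : a v ∈ v.adicCompletionIntegers K
  · exact mul_mem (coe_mem_adicCompletionIntegers v _) hv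
  · have hv' : v ∈ hS.toFinset := by simpa using hv
    rw [← Finset.mul_prod_erase _ _ hv', map_mul, adicCompletion.coe_mul, mul_right_comm,
      mul_comm _ (a v)]
    exact mul_mem (hab v) (coe_mem_adicCompletionIntegers v _)

theorem exists_forall_valued_sub_le (T : Finset (HeightOneSpectrum R))
    {y : FiniteAdeleRing R K} (hy : y ∈ integralFiniteAdeles R K) (k : HeightOneSpectrum R → ℕ) :
    ∃ r : R, ∀ v ∈ T,
      Valued.v (y v - ((algebraMap R K r : K) : v.adicCompletion K)) ≤ exp (-(k v : ℤ)) := by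
  choose s hs using fun v : HeightOneSpectrum R => exists_valued_sub_le v (hy v) (k v)
  obtain ⟨r, hr⟩ := IsDedekindDomain.exists_forall_sub_mem_ideal (s := T)
    (fun v : HeightOneSpectrum R => v.asIdeal) k (fun v _ => v.prime)
    (fun v _ w _ hvw h => hvw (HeightOneSpectrum.ext h)) (fun v => s v)
  refine ⟨r, fun v hv => ?_⟩
  have hrs : Valued.v ((algebraMap R K (r - s v) : K) : v.adicCompletion K) ≤
      exp (-(k v : ℤ)) := by
    rw [valuedAdicCompletion_eq_valuation', valuation_of_algebraMap]
    exact (intValuation_le_pow_iff_mem v _ _).2 (hr v hv)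
  have hsplit : y v - ((algebraMap R K r : K) : v.adicCompletion K) =
      (y v - ((algebraMap R K (s v) : K))) -
        ((algebraMap R K (r - s v) : K) : v.adicCompletion K) := by
    rw [map_sub, coe_sub_adicCompletion, sub_sub, add_sub_cancel]
  rw [hsplit]
  exact (Valuation.map_sub _ _ _).trans (max_le (hs v) hrs)

theorem exists_sub_algebraMap_mem_integralFiniteAdeles (a : FiniteAdeleRing R K) :
    ∃ x : K, a - algebraMap K (FiniteAdeleRing R K) x ∈ integralFiniteAdeles R K := by
  obtain ⟨d, hd, hda⟩ := exists_ne_zero_algebraMap_mul_mem a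
  set c : K := algebraMap R K d
  have hc : c ≠ 0 := by simpa [c] using hd
  have hval (v : HeightOneSpectrum R) : v.valuation K c ≠ 0 := (Valuation.ne_zero_iff _).2 hc
  choose k hk using fun v : HeightOneSpectrum R => exists_exp_neg_natCast_lt (hval v)
  obtain ⟨y, hy⟩ := exists_forall_valued_sub_le (Support.finite R c⁻¹).toFinset hda k
  have hle (v : HeightOneSpectrum R) :
      Valued.v ((c : v.adicCompletion K) * a v - ((algebraMap R K y : K))) ≤
        v.valuation K c := by
    by_cases hv : 1 < v.valuation K c⁻¹
    · exact (hy v (by simpa [Support] using hv)).trans (hk v).le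
    · rw [map_inv₀, not_lt, inv_le_one₀ (zero_lt_iff.2 (hval v))] at hv
      exact (sub_mem (hda v) (coe_mem_adicCompletionIntegers v y) :
        _ ∈ v.adicCompletionIntegers K).trans hv
  refine ⟨c⁻¹ * algebraMap R K y, fun v => ?_⟩
  have hcv : (c : v.adicCompletion K) ≠ 0 := by
    rw [← (Valued.v : Valuation (v.adicCompletion K) ℤᵐ⁰).ne_zero_iff,
      valuedAdicCompletion_eq_valuation']
    exact hval v
  have hfactor : a v - ((c⁻¹ * algebraMap R K y : K) : v.adicCompletion K) =
      (c : v.adicCompletion K)⁻¹ * ((c : v.adicCompletion K) * a v - (algebraMap R K y : K)) := by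
    have hy_eq : ((algebraMap R K y : K) : v.adicCompletion K) =
        c * ((c⁻¹ * algebraMap R K y : K) : v.adicCompletion K) := by
      rw [← adicCompletion.coe_mul, mul_inv_cancel_left₀ hc]
    rw [hy_eq, ← mul_sub, inv_mul_cancel_left₀ hcv]
  change a v - ((c⁻¹ * algebraMap R K y : K) : v.adicCompletion K) ∈ _
  rw [hfactor, mem_adicCompletionIntegers, map_mul, map_inv₀, valuedAdicCompletion_eq_valuation']
  exact (inv_mul_le_one₀ (zero_lt_iff.2 (hval v))).2 (hle v)

theorem tendsto_factorial_adicCompletionIntegers [Ring.HasFiniteQuotients R]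
    (v : HeightOneSpectrum R) :
    Tendsto (fun m : ℕ => (m.factorial : v.adicCompletionIntegers K)) atTop (𝓝 0) := by
  rw [tendsto_subtype_rng]
  refine (hasBasis_nhds_zero_adicCompletion v).tendsto_right_iff.2 fun k _ => ?_
  have : Finite (R ⧸ v.asIdeal) := Ring.HasFiniteQuotients.finiteQuotient v.ne_bot
  set q := Nat.card (R ⧸ v.asIdeal)
  have hq : (q : R) ∈ v.asIdeal := by
    rw [← Ideal.Quotient.eq_zero_iff_mem, map_natCast]
    have := Fintype.ofFinite (R ⧸ v.asIdeal)
    simp only [q, Nat.card_eq_fintype_card, Nat.cast_card_eq_zero]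
  filter_upwards [eventually_ge_atTop (q * k)] with m hm
  have hdvd : q ^ k ∣ m.factorial :=
    calc q ^ k ∣ q.factorial ^ k :=
          pow_dvd_pow_of_dvd (Nat.dvd_factorial Nat.card_pos le_rfl) _
      _ ∣ (q * k).factorial := by
          simpa [mul_comm] using
            Nat.prod_factorial_dvd_factorial_sum (Finset.range k) (fun _ => q)
      _ ∣ m.factorial := Nat.factorial_dvd_factorial hm
  have hmem : (m.factorial : R) ∈ v.asIdeal ^ k :=
    Ideal.mem_of_dvd _ (by exact_mod_cast Nat.cast_dvd_cast (α := R) hdvd)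
      (Ideal.pow_mem_pow hq k)
  rw [← map_natCast (algebraMap R (v.adicCompletionIntegers K)),
    algebraMap_adicCompletionIntegers_apply, valuedAdicCompletion_eq_valuation',
    valuation_of_algebraMap]
  exact (intValuation_le_pow_iff_mem v _ _).2 hmem

theorem tendsto_factorial_finiteAdeleRing [Ring.HasFiniteQuotients R] :
    Tendsto (fun m : ℕ => (m.factorial : FiniteAdeleRing R K)) atTop (𝓝 0) := by
  have hcomponents : Tendsto (fun (m : ℕ) (v : HeightOneSpectrum R) =>
      (m.factorial : v.adicCompletionIntegers K)) atTop (𝓝 0) :=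
    tendsto_pi_nhds.2 fun v => tendsto_factorial_adicCompletionIntegers v
  exact ((RestrictedProduct.isEmbedding_structureMap
    (R := fun v : HeightOneSpectrum R => v.adicCompletion K)
    (A := fun v => (v.adicCompletionIntegers K : Set (v.adicCompletion K)))
    (𝓕 := cofinite)).continuous.tendsto 0).comp hcomponents

theorem exists_nsmul_mem_of_mem_nhds_zero [Ring.HasFiniteQuotients R]
    [∀ v : HeightOneSpectrum R, CompactSpace (v.adicCompletionIntegers K)]
    {W : Set (FiniteAdeleRing R K)} (hW : W ∈ 𝓝 0) :
    ∃ N : ℕ, N ≠ 0 ∧ ∀ a ∈ integralFiniteAdeles R K, N • a ∈ W := by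
  have hsmall : ∀ᶠ x : FiniteAdeleRing R K in 𝓝 0, ∀ a ∈ integralFiniteAdeles R K, x * a ∈ W := by
    refine isCompact_integralFiniteAdeles.eventually_forall_of_forall_eventually fun a _ => ?_
    have hmul : Tendsto (fun z : FiniteAdeleRing R K × FiniteAdeleRing R K => z.1 * z.2)
        (𝓝 (0, a)) (𝓝 0) := by
      simpa using (continuous_mul (M := FiniteAdeleRing R K)).tendsto (0, a)
    exact hmul hW
  obtain ⟨m, hm⟩ := (tendsto_factorial_finiteAdeleRing.eventually hsmall).exists
  exact ⟨m.factorial, m.factorial_ne_zero, by simpa only [nsmul_eq_mul] using hm⟩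

end FiniteAdeles

section Adeles

open IsDedekindDomain HeightOneSpectrum NumberField InfiniteAdeleRing
open scoped Pointwise

variable {F : Type*} [Field F] [NumberField F]

instance t2Space_infiniteAdeleRing : T2Space (InfiniteAdeleRing F) :=
  inferInstanceAs (T2Space ((v : InfinitePlace F) → v.Completion))

instance t2Space_finiteAdeleRing : T2Space (FiniteAdeleRing (𝓞 F) F) :=
  inferInstanceAs (T2Space (RestrictedProduct
    (fun v : HeightOneSpectrum (𝓞 F) => v.adicCompletion F)
    (fun v => (v.adicCompletionIntegers F : Set (v.adicCompletion F))) cofinite))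

instance t2Space_adele : T2Space (Adele F) :=
  inferInstanceAs (T2Space (InfiniteAdeleRing F × FiniteAdeleRing (𝓞 F) F))

theorem continuous_adele_fst : Continuous fun a : Adele F => a.1 :=
  (continuous_fst : Continuous (Prod.fst : InfiniteAdeleRing F × FiniteAdeleRing (𝓞 F) F → _))

theorem continuous_adele_snd : Continuous fun a : Adele F => a.2 :=
  (continuous_snd : Continuous (Prod.snd : InfiniteAdeleRing F × FiniteAdeleRing (𝓞 F) F → _))

theorem continuous_adele_infinite (v : InfinitePlace F) : Continuous fun a : Adele F => a.1 v :=
  (continuous_apply v : Continuous fun x : (v : InfinitePlace F) → v.Completion => x v).comp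
    continuous_adele_fst

omit [NumberField F] in
theorem continuous_ringEquiv_mixedSpace_symm : Continuous (ringEquiv_mixedSpace F).symm := by
  refine continuous_pi (X := mixedEmbedding.mixedSpace F)
    (A := fun v : InfinitePlace F => v.Completion) fun v => ?_
  by_cases hv : v.IsReal
  · have hcoord : InfinitePlace.Completion.extensionEmbeddingOfIsReal hv ∘
        (fun x => (ringEquiv_mixedSpace F).symm x v) = fun x => x.1 ⟨v, hv⟩ := funext fun x =>
      congrArg (fun y => y.1 ⟨v, hv⟩) ((ringEquiv_mixedSpace F).apply_symm_apply x)
    rw [(InfinitePlace.Completion.isometry_extensionEmbeddingOfIsReal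
      hv).isEmbedding.continuous_iff, hcoord]
    fun_prop
  · rw [InfinitePlace.not_isReal_iff_isComplex] at hv
    have hcoord : InfinitePlace.Completion.extensionEmbedding v ∘
        (fun x => (ringEquiv_mixedSpace F).symm x v) = fun x => x.2 ⟨v, hv⟩ := funext fun x =>
      congrArg (fun y => y.2 ⟨v, hv⟩) ((ringEquiv_mixedSpace F).apply_symm_apply x)
    rw [(InfinitePlace.Completion.isometry_extensionEmbedding v).isEmbedding.continuous_iff, hcoord]
    fun_prop

/-- The inclusion of the finite adeles in the adeles. -/
def finiteAdele : FiniteAdeleRing (𝓞 F) F →+ Adele F :=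
  AddMonoidHom.inr (InfiniteAdeleRing F) (FiniteAdeleRing (𝓞 F) F)

/-- The inclusion of the archimedean space `ℝ ^ r₁ × ℂ ^ r₂` in the adeles. -/
def archAdele : mixedEmbedding.mixedSpace F →+ Adele F :=
  (AddMonoidHom.inl (InfiniteAdeleRing F) (FiniteAdeleRing (𝓞 F) F)).comp
    (ringEquiv_mixedSpace F).symm.toAddMonoidHom

theorem continuous_finiteAdele : Continuous (finiteAdele (F := F)) :=
  (Continuous.prodMk_right 0 :
    Continuous fun a : FiniteAdeleRing (𝓞 F) F => ((0 : InfiniteAdeleRing F), a))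

theorem continuous_archAdele : Continuous (archAdele (F := F)) :=
  (continuous_ringEquiv_mixedSpace_symm.prodMk continuous_const :
    Continuous fun x => ((ringEquiv_mixedSpace F).symm x, (0 : FiniteAdeleRing (𝓞 F) F)))

theorem archAdele_add_finiteAdele (a : Adele F) :
    archAdele (ringEquiv_mixedSpace F a.1) + finiteAdele a.2 = a := by
  refine Prod.ext ?_ (zero_add a.2)
  change (ringEquiv_mixedSpace F).symm (ringEquiv_mixedSpace F a.1) + 0 = a.1
  rw [RingEquiv.symm_apply_apply, add_zero]

theorem archAdele_mul (x y : mixedEmbedding.mixedSpace F) :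
    archAdele (x * y) = archAdele x * archAdele y :=
  Prod.ext (map_mul (ringEquiv_mixedSpace F).symm x y)
    (mul_zero (0 : FiniteAdeleRing (𝓞 F) F)).symm

theorem algebraMap_eq_archAdele_add_finiteAdele (ξ : F) : algebraMap F (Adele F) ξ =
    archAdele (mixedEmbedding F ξ) + finiteAdele (algebraMap F (FiniteAdeleRing (𝓞 F) F) ξ) := by
  rw [mixedEmbedding_eq_algebraMap_comp]
  exact (archAdele_add_finiteAdele (algebraMap F (Adele F) ξ)).symm

theorem archAdele_mixedEmbedding_mul (ξ : F) (x : mixedEmbedding.mixedSpace F) :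
    archAdele (mixedEmbedding F ξ * x) = algebraMap F (Adele F) ξ * archAdele x := by
  rw [archAdele_mul]
  refine Prod.ext ?_ ((mul_zero (0 : FiniteAdeleRing (𝓞 F) F)).trans (mul_zero
    (algebraMap F (FiniteAdeleRing (𝓞 F) F) ξ)).symm)
  change (ringEquiv_mixedSpace F).symm (mixedEmbedding F ξ) * _ = algebraMap F _ ξ * _
  rw [mixedEmbedding_eq_algebraMap_comp, RingEquiv.symm_apply_apply]

theorem exists_isCompact_sub_mixedEmbedding_mem :
    ∃ C : Set (mixedEmbedding.mixedSpace F), IsCompact C ∧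
      ∀ x, ∃ r : 𝓞 F, x - mixedEmbedding F r ∈ C := by
  classical
  refine ⟨closure (ZSpan.fundamentalDomain (mixedEmbedding.latticeBasis F)),
    (ZSpan.fundamentalDomain_isBounded _).isCompact_closure, fun x => ?_⟩
  obtain ⟨r, hr⟩ := (mixedEmbedding.mem_span_latticeBasis F).1
    (ZSpan.floor (mixedEmbedding.latticeBasis F) x).2
  replace hr : mixedEmbedding F r = ZSpan.floor (mixedEmbedding.latticeBasis F) x := hr
  exact ⟨r, subset_closure (hr ▸ ZSpan.fract_mem_fundamentalDomain _ x)⟩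

theorem exists_isCompact_eq_algebraMap_add_archAdele_add_finiteAdele :
    ∃ C : Set (mixedEmbedding.mixedSpace F), IsCompact C ∧
      ∀ a : Adele F, ∃ ξ : F, ∃ x ∈ C, ∃ y ∈ integralFiniteAdeles (𝓞 F) F,
        a = algebraMap F (Adele F) ξ + archAdele x + finiteAdele y := by
  obtain ⟨C, hC, h⟩ := exists_isCompact_sub_mixedEmbedding_mem (F := F)
  refine ⟨C, hC, fun a => ?_⟩
  obtain ⟨η, hη⟩ := exists_sub_algebraMap_mem_integralFiniteAdeles a.2
  obtain ⟨r, hr⟩ := h (ringEquiv_mixedSpace F a.1 - mixedEmbedding F η)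
  refine ⟨η + r, _, hr, _, sub_mem hη (algebraMap_mem_integralFiniteAdeles r), ?_⟩
  conv_lhs => rw [← archAdele_add_finiteAdele a]
  simp only [algebraMap_eq_archAdele_add_finiteAdele, map_add, map_sub]
  abel

theorem exists_isCompact_eq_algebraMap_add_archAdele_add_finiteAdele_nsmul {N : ℕ} (hN : N ≠ 0) :
    ∃ C : Set (mixedEmbedding.mixedSpace F), IsCompact C ∧
      ∀ a : Adele F, ∃ ξ : F, ∃ x ∈ C, ∃ y ∈ integralFiniteAdeles (𝓞 F) F,
        a = algebraMap F (Adele F) ξ + archAdele x + finiteAdele (N • y) := by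
  obtain ⟨C, hC, h⟩ := exists_isCompact_eq_algebraMap_add_archAdele_add_finiteAdele (F := F)
  refine ⟨(N • ·) '' C, hC.image (continuous_const_smul N), fun a => ?_⟩
  obtain ⟨ξ, x, hx, y, hy, hxy⟩ := h (algebraMap F (Adele F) (N : F)⁻¹ * a)
  refine ⟨N • ξ, N • x, ⟨x, hx, rfl⟩, y, hy, ?_⟩
  have hN0 : (N : F) ≠ 0 := Nat.cast_ne_zero.2 hN
  rw [map_nsmul, map_nsmul, map_nsmul, ← nsmul_add, ← nsmul_add, ← hxy, nsmul_eq_mul,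
    ← map_natCast (algebraMap F (Adele F)), ← mul_assoc, ← map_mul, mul_inv_cancel₀ hN0, map_one,
    one_mul]

theorem exists_isCompact_eq_algebraMap_add :
    ∃ D : Set (Adele F), IsCompact D ∧
      ∀ a, ∃ ξ : F, ∃ d ∈ D, a = algebraMap F (Adele F) ξ + d := by
  obtain ⟨C, hC, h⟩ := exists_isCompact_eq_algebraMap_add_archAdele_add_finiteAdele (F := F)
  refine ⟨archAdele '' C + finiteAdele '' integralFiniteAdeles (𝓞 F) F,
    (hC.image continuous_archAdele).add
      (isCompact_integralFiniteAdeles.image continuous_finiteAdele), fun a => ?_⟩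
  obtain ⟨ξ, x, hx, y, hy, rfl⟩ := h a
  exact ⟨ξ, _, Set.add_mem_add ⟨x, hx, rfl⟩ ⟨y, hy, rfl⟩, add_assoc _ _ _⟩

theorem eventually_norm_lt_one_and_mem_integralFiniteAdeles :
    ∀ᶠ a : Adele F in 𝓝 0, (∀ v, ‖a.1 v‖ < 1) ∧ a.2 ∈ integralFiniteAdeles (𝓞 F) F := by
  refine (eventually_all.2 fun v => ?_).and
    ((isOpen_integralFiniteAdeles.preimage continuous_adele_snd).mem_nhds
      (zero_mem (integralFiniteAdeles (𝓞 F) F)))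
  refine (isOpen_lt (continuous_adele_infinite v).norm continuous_const).mem_nhds ?_
  change ‖(0 : v.Completion)‖ < 1
  simp

theorem eq_zero_of_norm_lt_one_of_mem_integralFiniteAdeles {ξ : F}
    (hinf : ∀ v : InfinitePlace F, ‖(ξ : v.Completion)‖ < 1)
    (hfin : algebraMap F (FiniteAdeleRing (𝓞 F) F) ξ ∈ integralFiniteAdeles (𝓞 F) F) : ξ = 0 := by
  have hint (v : HeightOneSpectrum (𝓞 F)) : v.valuation F ξ ≤ 1 := by
    have hv : (ξ : v.adicCompletion F) ∈ v.adicCompletionIntegers F := hfin v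
    rwa [mem_adicCompletionIntegers, valuedAdicCompletion_eq_valuation'] at hv
  obtain ⟨r, rfl⟩ := mem_integers_of_valuation_le_one F ξ hint
  by_contra hr
  have hlt (v : InfinitePlace F) : v r < 1 := by
    simpa only [InfinitePlace.Completion.norm_coe] using! hinf v
  have v : InfinitePlace F := Classical.arbitrary _
  exact (hlt v).not_ge (InfinitePlace.one_le_of_lt_one (by simpa using hr) fun w _ => hlt w)

instance discreteTopology_principalSubgroup :
    DiscreteTopology (AdeleRing.principalSubgroup (𝓞 F) F) := by
  refine discreteTopology_of_isOpen_singleton_zero (isOpen_iff_mem_nhds.2 ?_)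
  rintro _ rfl
  filter_upwards [continuous_subtype_val.tendsto (0 : AdeleRing.principalSubgroup (𝓞 F) F)
    |>.eventually eventually_norm_lt_one_and_mem_integralFiniteAdeles]
  rintro ⟨_, ξ, rfl⟩ ⟨hinf, hfin⟩
  obtain rfl : ξ = 0 := eq_zero_of_norm_lt_one_of_mem_integralFiniteAdeles hinf hfin
  exact Subtype.ext (map_zero (algebraMap F (Adele F)))

instance isClosed_principalSubgroup :
    IsClosed (AdeleRing.principalSubgroup (𝓞 F) F : Set (Adele F)) :=
  AddSubgroup.isClosed_of_discrete

variable (F) in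
/-- The compact group `𝔸 / F`. -/
abbrev AdeleClass : Type _ := Adele F ⧸ AdeleRing.principalSubgroup (𝓞 F) F

theorem adeleClass_mk_algebraMap_add (ξ : F) (a : Adele F) :
    ((algebraMap F (Adele F) ξ + a : Adele F) : AdeleClass F) = a := by
  rw [QuotientAddGroup.mk_add, (QuotientAddGroup.eq_zero_iff _).2 (Set.mem_range_self ξ), zero_add]

instance compactSpace_adeleClass : CompactSpace (AdeleClass F) := by
  obtain ⟨D, hD, h⟩ := exists_isCompact_eq_algebraMap_add (F := F)
  refine ⟨(hD.image (f := ((↑) : Adele F → AdeleClass F))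
    continuous_quotient_mk').of_isClosed_subset isClosed_univ fun q _ => ?_⟩
  obtain ⟨a, rfl⟩ := QuotientAddGroup.mk_surjective q
  obtain ⟨ξ, d, hd, rfl⟩ := h a
  exact ⟨d, hd, (adeleClass_mk_algebraMap_add ξ d).symm⟩

/-- A function on `𝔸` that is invariant under `F`, as a function on `𝔸 / F`. -/
def adeleLift {E : Type*} (f : Adele F → E)
    (hf : ∀ (ξ : F) a, f (algebraMap F (Adele F) ξ + a) = f a) : AdeleClass F → E :=
  Quotient.lift f fun a b hab => by
    obtain ⟨ξ, hξ⟩ := QuotientAddGroup.leftRel_apply.1 hab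
    rw [← hf ξ a, show algebraMap F (Adele F) ξ = -a + b from hξ, neg_add_cancel_comm]

theorem continuous_adeleLift {E : Type*} [TopologicalSpace E] {f : Adele F → E}
    (hf : ∀ (ξ : F) a, f (algebraMap F (Adele F) ξ + a) = f a) (hc : Continuous f) :
    Continuous (adeleLift f hf) := continuous_quot_lift _ hc

end Adeles

/-! ### Fourier series -/

theorem integrable_continuousMap {X : Type*} [TopologicalSpace X] [CompactSpace X]
    [MeasurableSpace X] [BorelSpace X] {μ : Measure X} [IsFiniteMeasure μ] (f : C(X, ℂ)) :
    Integrable f μ :=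
  f.continuous.integrable_of_hasCompactSupport (HasCompactSupport.of_compactSpace _)

section CompactGroup

variable {G : Type*} [AddCommGroup G]

section Coefficients

variable [MeasurableSpace G] {μ : Measure G}

/-- The Fourier coefficient `∫ f χ⁻¹` of a function with respect to a character. -/
def charCoeff (μ : Measure G) (χ : AddChar G ℂ) (f : G → ℂ) : ℂ :=
  ∫ t, f t * (χ t)⁻¹ ∂μ

variable [MeasurableAdd G] [μ.IsAddRightInvariant]

theorem charCoeff_translate (χ : AddChar G ℂ) (f : G → ℂ) (a : G) :
    charCoeff μ χ (fun t => f (t + a)) = χ a * charCoeff μ χ f := by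
  have hχ : χ a ≠ 0 := (χ.val_isUnit a).ne_zero
  rw [charCoeff, charCoeff, ← integral_add_right_eq_self (fun t => f t * (χ t)⁻¹) a,
    ← integral_const_mul]
  congr 1 with t
  rw [AddChar.map_add_eq_mul]
  field_simp

theorem charCoeff_one_eq_zero {χ : AddChar G ℂ} (hχ : χ ≠ 1) :
    charCoeff μ χ 1 = 0 := by
  obtain ⟨a, ha⟩ := DFunLike.ne_iff.1 hχ
  have h := charCoeff_translate (μ := μ) χ 1 a
  by_contra hne
  exact ha (mul_right_cancel₀ hne (by rw [AddChar.one_apply, one_mul]; exact h.symm))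

end Coefficients

variable [TopologicalSpace G] [CompactSpace G]

theorem norm_addChar_apply {χ : AddChar G ℂ} (hχ : Continuous χ) (t : G) : ‖χ t‖ = 1 := by
  obtain ⟨B, hB⟩ := isCompact_univ.exists_bound_of_continuousOn hχ.continuousOn
  have hle (s : G) : ‖χ s‖ ≤ 1 := by
    by_contra! hs
    obtain ⟨k, hk⟩ := pow_unbounded_of_one_lt B hs
    have hks := hB (k • s) trivial
    rw [AddChar.map_nsmul_eq_pow, norm_pow] at hks
    exact hk.not_ge hks
  refine le_antisymm (hle t) ?_
  have hinv := hle (-t)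
  rwa [AddChar.map_neg_eq_inv, norm_inv,
    inv_le_one₀ (norm_pos_iff.2 (χ.val_isUnit t).ne_zero)] at hinv

theorem star_addChar_apply {χ : AddChar G ℂ} (hχ : Continuous χ) (t : G) :
    star (χ t) = (χ t)⁻¹ :=
  (RCLike.inv_eq_conj (norm_addChar_apply hχ t)).symm

theorem charCoeff_fwdDiff [MeasurableSpace G] [BorelSpace G] [ContinuousAdd G] {μ : Measure G}
    [IsFiniteMeasure μ] [μ.IsAddRightInvariant] {χ : AddChar G ℂ} (hχ : Continuous χ) {f : G → ℂ}
    (hf : Continuous f) (a : G) (k : ℕ) :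
    charCoeff μ χ ((fwdDiff a)^[k] f) = (χ a - 1) ^ k * charCoeff μ χ f := by
  have hint {f : G → ℂ} (hf : Continuous f) : Integrable (fun t => f t * (χ t)⁻¹) μ :=
    integrable_continuousMap
      ⟨_, hf.mul (hχ.inv₀ fun t => (χ.val_isUnit t).ne_zero)⟩
  induction k generalizing f with
  | zero => simp
  | succ k ih =>
    rw [Function.iterate_succ_apply, ih (by unfold fwdDiff; fun_prop), pow_succ, mul_assoc]
    congr 1
    rw [sub_mul, one_mul, ← charCoeff_translate, charCoeff, charCoeff, charCoeff,
      ← integral_sub (hint (f := fun t => f (t + a)) (by fun_prop)) (hint hf)]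
    simp only [fwdDiff, sub_mul]

section Family

variable {Λ : Type*} [AddCommGroup Λ] {χ : AddChar Λ (AddChar G ℂ)}

/-- A family of continuous characters, as a homomorphism to the ring of continuous functions. -/
def charHom (hχ : ∀ ξ, Continuous (χ ξ)) : Multiplicative Λ →* C(G, ℂ) where
  toFun ξ := ⟨χ ξ.toAdd, hχ _⟩
  map_one' := by ext t; simp
  map_mul' ξ η := by ext t; simp [AddChar.map_add_eq_mul]

omit [CompactSpace G] in
theorem charCoeff_charHom [MeasurableSpace G] [MeasurableAdd G] {μ : Measure G}
    [IsProbabilityMeasure μ] [μ.IsAddRightInvariant] [DecidableEq Λ]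
    (hχ : ∀ ξ, Continuous (χ ξ)) (hinj : ∀ ξ, χ ξ = 1 → ξ = 0) (ξ η : Λ) :
    charCoeff μ (χ η) (charHom hχ (.ofAdd ξ)) = if ξ = η then 1 else 0 := by
  have hsub : charCoeff μ (χ η) (charHom hχ (.ofAdd ξ)) = charCoeff μ (χ (η - ξ)) 1 := by
    refine integral_congr_ae (ae_of_all _ fun t => ?_)
    change χ ξ t * (χ η t)⁻¹ = 1 * (χ (η - ξ) t)⁻¹
    rw [AddChar.map_sub_eq_div, AddChar.div_apply', inv_div, one_mul, div_eq_mul_inv]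
  rw [hsub]
  split_ifs with h
  · rw [h, sub_self, AddChar.map_zero_eq_one]
    simp [charCoeff]
  · exact charCoeff_one_eq_zero fun hone => h (sub_eq_zero.1 (hinj _ hone)).symm

theorem star_charHom (hχ : ∀ ξ, Continuous (χ ξ)) (ξ : Multiplicative Λ) :
    star (charHom hχ ξ) = charHom hχ ξ⁻¹ := by
  ext t
  change star (χ ξ.toAdd t) = χ (-ξ.toAdd) t
  rw [star_addChar_apply (hχ _), AddChar.map_neg_eq_inv, AddChar.inv_apply, AddChar.map_neg_eq_inv]

theorem topologicalClosure_span_charHom_eq_top (hχ : ∀ ξ, Continuous (χ ξ))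
    (hsep : ∀ t, (∀ ξ, χ ξ t = 1) → t = 0) :
    (Submodule.span ℂ (Set.range (charHom hχ))).topologicalClosure = ⊤ := by
  let A : StarSubalgebra ℂ C(G, ℂ) := StarAlgebra.adjoin ℂ (Set.range (charHom hχ))
  have hstar : star (Set.range (charHom hχ)) ⊆ Set.range (charHom hχ) := by
    rintro f ⟨ξ, hξ⟩
    exact ⟨ξ⁻¹, by rw [← star_charHom, hξ, star_star]⟩
  have hspan : Subalgebra.toSubmodule A.toSubalgebra =
      Submodule.span ℂ (Set.range (charHom hχ)) := by
    rw [StarAlgebra.adjoin_toSubalgebra, Set.union_eq_self_of_subset_right hstar,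
      Algebra.adjoin_eq_span, ← MonoidHom.coe_mrange, Submonoid.closure_eq]
  have hA : A.SeparatesPoints := fun s t hst => by
    by_contra! h
    refine hst (sub_eq_zero.1 (hsep _ fun ξ => ?_))
    have hξ : χ ξ s = χ ξ t :=
      h _ ⟨charHom hχ (.ofAdd ξ), StarAlgebra.subset_adjoin ℂ _ ⟨_, rfl⟩, rfl⟩
    rw [AddChar.map_sub_eq_div, hξ, div_self ((χ ξ).val_isUnit t).ne_zero]
  rw [← hspan]
  exact congrArg (fun B : StarSubalgebra ℂ C(G, ℂ) => Subalgebra.toSubmodule B.toSubalgebra)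
    (ContinuousMap.starSubalgebra_topologicalClosure_eq_top_of_separatesPoints A hA)

variable [MeasurableSpace G] [BorelSpace G] {μ : Measure G} [IsFiniteMeasure μ]

variable (μ) in
/-- The linear functional `g ↦ ∫ f g` on continuous functions. -/
def integralMulCLM (f : C(G, ℂ)) : C(G, ℂ) →L[ℂ] ℂ :=
  LinearMap.mkContinuous
    { toFun := fun g => ∫ t, f t * g t ∂μ
      map_add' := fun g h => by
        simp only [ContinuousMap.add_apply, mul_add]
        exact integral_add (integrable_continuousMap (f * g)) (integrable_continuousMap (f * h))
      map_smul' := fun c g => by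
        simp only [ContinuousMap.smul_apply, mul_smul_comm, integral_smul, RingHom.id_apply] }
    (μ.real Set.univ * ‖f‖) fun g => by
      refine (norm_integral_le_of_norm_le_const (C := ‖f‖ * ‖g‖) (ae_of_all _ fun t => ?_)).trans
        (le_of_eq (by ring))
      rw [norm_mul]
      exact mul_le_mul (f.norm_coe_le_norm t) (g.norm_coe_le_norm t) (norm_nonneg _) (norm_nonneg _)

theorem eq_zero_of_forall_charCoeff_eq_zero [μ.IsOpenPosMeasure] (hχ : ∀ ξ, Continuous (χ ξ))
    (hsep : ∀ t, (∀ ξ, χ ξ t = 1) → t = 0) (f : C(G, ℂ))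
    (hf : ∀ ξ, charCoeff μ (χ ξ) f = 0) : f = 0 := by
  have hle : Submodule.span ℂ (Set.range (charHom hχ)) ≤
      LinearMap.ker (integralMulCLM μ f).toLinearMap := by
    rw [Submodule.span_le]
    rintro _ ⟨ξ, rfl⟩
    have h := hf (-ξ.toAdd)
    simp only [charCoeff, AddChar.map_neg_eq_inv, AddChar.inv_apply, inv_inv] at h
    exact h
  have htop := Submodule.topologicalClosure_minimal _ hle (integralMulCLM μ f).isClosed_ker
  rw [topologicalClosure_span_charHom_eq_top hχ hsep] at htop
  have hstar : ∫ t, f t * star (f t) ∂μ = 0 := htop (Submodule.mem_top (x := star f))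
  simp_rw [RCLike.star_def, Complex.mul_conj, integral_complex_ofReal] at hstar
  have hcont : Continuous fun t => Complex.normSq (f t) :=
    Complex.continuous_normSq.comp f.continuous
  have hae := (integral_eq_zero_iff_of_nonneg (fun t => Complex.normSq_nonneg _)
    (hcont.integrable_of_hasCompactSupport (HasCompactSupport.of_compactSpace _))).1
    (Complex.ofReal_eq_zero.1 hstar)
  ext t
  exact Complex.normSq_eq_zero.1 (congrFun ((hcont.ae_eq_iff_eq μ continuous_zero).1 hae) t)

theorem integralMulCLM_charHom_neg (hχ : ∀ ξ, Continuous (χ ξ)) (f : C(G, ℂ)) (η : Λ) :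
    integralMulCLM μ (charHom hχ (.ofAdd (-η))) f = charCoeff μ (χ η) f := by
  refine integral_congr_ae (ae_of_all _ fun t => ?_)
  change χ (-η) t * f t = f t * (χ η t)⁻¹
  rw [AddChar.map_neg_eq_inv, AddChar.inv_apply', mul_comm]

omit [IsFiniteMeasure μ] in
theorem hasSum_charCoeff [MeasurableAdd G] [IsProbabilityMeasure μ] [μ.IsOpenPosMeasure]
    [μ.IsAddRightInvariant] (hχ : ∀ ξ, Continuous (χ ξ))
    (hsep : ∀ t, (∀ ξ, χ ξ t = 1) → t = 0) (hinj : ∀ ξ, χ ξ = 1 → ξ = 0) (f : C(G, ℂ))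
    (hs : Summable fun ξ => charCoeff μ (χ ξ) f) :
    HasSum (fun ξ => charCoeff μ (χ ξ) f) (f 0) := by
  classical
  set c : Λ → ℂ := fun ξ => charCoeff μ (χ ξ) f
  have hbound (ξ : Λ) : ‖c ξ • charHom hχ (.ofAdd ξ)‖ ≤ ‖c ξ‖ := by
    rw [norm_smul]
    refine mul_le_of_le_one_right (norm_nonneg _) ((ContinuousMap.norm_le _ zero_le_one).2
      fun t => (norm_addChar_apply (hχ ξ) t).le)
  obtain ⟨g, hg⟩ : Summable fun ξ => c ξ • charHom hχ (.ofAdd ξ) :=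
    Summable.of_norm_bounded hs.norm hbound
  have hcoeff (η : Λ) : charCoeff μ (χ η) g = c η := by
    have hsum := hg.mapL (integralMulCLM μ (charHom hχ (.ofAdd (-η))))
    simp only [map_smul, integralMulCLM_charHom_neg, charCoeff_charHom hχ hinj] at hsum
    rw [← hsum.tsum_eq, tsum_eq_single η fun ξ hξ => by rw [if_neg hξ, smul_zero], if_pos rfl,
      smul_eq_mul, mul_one]
  have hfg : f - g = 0 := by
    refine eq_zero_of_forall_charCoeff_eq_zero (μ := μ) hχ hsep _ fun η => ?_
    rw [← integralMulCLM_charHom_neg hχ, map_sub, integralMulCLM_charHom_neg,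
      integralMulCLM_charHom_neg, hcoeff, sub_self]
  have heval := hg.mapL (ContinuousMap.evalCLM ℂ (0 : G))
  rw [sub_eq_zero.1 hfg]
  convert! heval using 2 with ξ
  change c ξ = c ξ • χ ξ 0
  rw [AddChar.map_zero_eq_one, smul_eq_mul, mul_one]

end Family

end CompactGroup

theorem eq_one_of_forall_norm_pow_sub_one_le {z : ℂ} (h : ∀ m : ℕ, ‖z ^ m - 1‖ ≤ 1 / 2) :
    z = 1 := by
  by_contra hz
  have hpos : 0 < ‖z - 1‖ := norm_pos_iff.2 (sub_ne_zero.2 hz)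
  have hgrowth (k : ℕ) : (3 / 2 : ℝ) ^ k * ‖z - 1‖ ≤ ‖z ^ 2 ^ k - 1‖ := by
    induction k with
    | zero => simp
    | succ k ih =>
      have hfactor : z ^ 2 ^ (k + 1) - 1 = (2 - (1 - z ^ 2 ^ k)) * (z ^ 2 ^ k - 1) := by
        rw [pow_succ 2 k, pow_mul]
        ring
      have hlow : (3 / 2 : ℝ) ≤ ‖2 - (1 - z ^ 2 ^ k)‖ := by
        have htri := norm_sub_norm_le (2 : ℂ) (1 - z ^ 2 ^ k)
        rw [norm_sub_rev 1, Complex.norm_ofNat] at htri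
        linarith [h (2 ^ k)]
      rw [hfactor, norm_mul, pow_succ', mul_assoc]
      gcongr
  obtain ⟨k, hk⟩ := pow_unbounded_of_one_lt (1 / ‖z - 1‖) (by norm_num : (1 : ℝ) < 3 / 2)
  rw [div_lt_iff₀ hpos] at hk
  linarith [hgrowth k, h (2 ^ k)]

theorem exists_ne_sub_mem_of_isCompact {A ι : Type*} [AddGroup A] [TopologicalSpace A]
    [IsTopologicalAddGroup A] [Infinite ι] {D : Set A} (hD : IsCompact D) {d : ι → A}
    (hd : ∀ m, d m ∈ D) {U : Set A} (hU : U ∈ 𝓝 0) : ∃ l m, l ≠ m ∧ d l - d m ∈ U := by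
  obtain ⟨V, hV, hVU⟩ := exists_nhds_half_neg hU
  obtain ⟨t, -, ht⟩ := hD.elim_nhds_subcover (fun a => (· - a) ⁻¹' V) fun a _ =>
    (continuous_sub_right a).continuousAt.preimage_mem_nhds (by rwa [sub_self])
  have hex (m : ι) : ∃ a : t, d m - a ∈ V := by
    simpa using ht (hd m)
  choose a ha using hex
  obtain ⟨l, m, hlm, hal⟩ := Finite.exists_ne_map_eq_of_infinite a
  refine ⟨l, m, hlm, ?_⟩
  have hmem := hVU _ (ha l) _ (ha m)
  rwa [hal, sub_sub_sub_cancel_right] at hmem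

section Characters

open IsDedekindDomain HeightOneSpectrum NumberField InfiniteAdeleRing

variable {F : Type*} [Field F] [NumberField F] {ψ : AddChar (Adele F) ℂ}

theorem addChar_algebraMap_mul_algebraMap_add
    (hψ_F : ∀ x : F, ψ (algebraMap F (Adele F) x) = 1) (ξ η : F) (a : Adele F) :
    ψ (algebraMap F (Adele F) ξ * (algebraMap F (Adele F) η + a)) =
      ψ (algebraMap F (Adele F) ξ * a) := by
  rw [mul_add, ← map_mul, AddChar.map_add_eq_mul, hψ_F, one_mul]

/-- The character `a ↦ ψ (ξ a)` of `𝔸 / F`, as a homomorphism in `ξ`. -/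
def classChar (ψ : AddChar (Adele F) ℂ) (hψ_F : ∀ x : F, ψ (algebraMap F (Adele F) x) = 1) :
    AddChar F (AddChar (AdeleClass F) ℂ) where
  toFun ξ :=
    { toFun := adeleLift (fun a => ψ (algebraMap F (Adele F) ξ * a)) 
        (addChar_algebraMap_mul_algebraMap_add hψ_F ξ)
      map_zero_eq_one' := by
        change ψ (_ * 0) = 1
        rw [mul_zero, AddChar.map_zero_eq_one]
      map_add_eq_mul' := by
        rintro ⟨a⟩ ⟨b⟩
        change ψ (_ * (a + b)) = ψ (_ * a) * ψ (_ * b)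
        rw [mul_add, AddChar.map_add_eq_mul] }
  map_zero_eq_one' := by
    ext ⟨a⟩
    change ψ (_ * a) = 1
    rw [map_zero, zero_mul, AddChar.map_zero_eq_one]
  map_add_eq_mul' ξ η := by
    ext ⟨a⟩
    change ψ (_ * a) = ψ (_ * a) * ψ (_ * a)
    rw [map_add, add_mul, AddChar.map_add_eq_mul]

theorem classChar_coe (hψ_F : ∀ x : F, ψ (algebraMap F (Adele F) x) = 1) (ξ : F) (a : Adele F) :
    classChar ψ hψ_F ξ (a : AdeleClass F) = ψ (algebraMap F (Adele F) ξ * a) :=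
  rfl

theorem continuous_classChar (hψ_cont : Continuous ψ)
    (hψ_F : ∀ x : F, ψ (algebraMap F (Adele F) x) = 1) (ξ : F) :
    Continuous (classChar ψ hψ_F ξ) :=
  continuous_adeleLift (addChar_algebraMap_mul_algebraMap_add hψ_F ξ)
    (hψ_cont.comp (continuous_const_mul (algebraMap F (Adele F) ξ)))

theorem norm_addChar_adele (hψ_cont : Continuous ψ)
    (hψ_F : ∀ x : F, ψ (algebraMap F (Adele F) x) = 1) (a : Adele F) : ‖ψ a‖ = 1 := by
  have h := norm_addChar_apply (continuous_classChar hψ_cont hψ_F 1) (a : AdeleClass F)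
  rwa [classChar_coe, map_one, one_mul] at h

theorem addChar_eq_one_of_forall_nsmul {A : Type*} [AddMonoid A] {χ : AddChar A ℂ} {a : A}
    (h : ∀ m : ℕ, ‖χ (m • a) - 1‖ ≤ 1 / 2) : χ a = 1 :=
  eq_one_of_forall_norm_pow_sub_one_le fun m => by
    rw [← AddChar.map_nsmul_eq_pow]
    exact h m

theorem eventually_forall_addChar_mul_eq_one (hψ_cont : Continuous ψ) :
    ∀ᶠ s : Adele F in 𝓝 0, (∀ ξ : F, ψ (algebraMap F (Adele F) ξ * s) = 1) →
      ∀ a, ψ (s * a) = 1 := by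
  obtain ⟨D, hD, h⟩ := exists_isCompact_eq_algebraMap_add (F := F)
  have hsmall : ∀ᶠ s : Adele F in 𝓝 0, ∀ d ∈ D, ‖ψ (s * d) - 1‖ < 1 / 2 := by
    refine hD.eventually_forall_of_forall_eventually fun d _ => ?_
    have hcont : ContinuousAt (fun z : Adele F × Adele F => ‖ψ (z.1 * z.2) - 1‖) (0, d) := by
      fun_prop
    exact hcont.eventually_lt continuousAt_const (by simp)
  filter_upwards [hsmall] with s hs hF a
  refine addChar_eq_one_of_forall_nsmul (χ := ψ) fun m => ?_
  obtain ⟨ξ, d, hd, hξd⟩ := h (m • a)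
  rw [← mul_smul_comm, hξd, mul_add, mul_comm s, AddChar.map_add_eq_mul, hF, one_mul]
  exact (hs d hd).le

theorem exists_sub_mul_eq_algebraMap_add (hψ_cont : Continuous ψ)
    (hψ_F : ∀ x : F, ψ (algebraMap F (Adele F) x) = 1) {t : Adele F}
    (ht : ∀ ξ : F, ψ (algebraMap F (Adele F) ξ * t) = 1) (c : ℕ → F) {U : Set (Adele F)}
    (hU : U ∈ 𝓝 0) :
    ∃ l m, l ≠ m ∧ ∃ ξ : F, ∃ s ∈ U, (∀ a, ψ (s * a) = 1) ∧
      algebraMap F (Adele F) (c l - c m) * t = algebraMap F (Adele F) ξ + s := by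
  obtain ⟨D, hD, h⟩ := exists_isCompact_eq_algebraMap_add (F := F)
  choose ξ d hd hξ using fun m => h (algebraMap F (Adele F) (c m) * t)
  obtain ⟨l, m, hlm, hsU, hs⟩ := exists_ne_sub_mem_of_isCompact hD hd
    (inter_mem hU (eventually_forall_addChar_mul_eq_one hψ_cont))
  have hsub : algebraMap F (Adele F) (c l - c m) * t =
      algebraMap F (Adele F) (ξ l - ξ m) + (d l - d m) := by
    rw [map_sub, sub_mul, hξ, hξ, map_sub]
    abel
  refine ⟨l, m, hlm, ξ l - ξ m, d l - d m, hsU, hs fun η => ?_, hsub⟩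
  rw [← sub_eq_iff_eq_add'.2 hsub, mul_sub, ← mul_assoc, ← map_mul, ← map_mul,
    AddChar.map_sub_eq_div, ht, hψ_F, div_one]

omit [NumberField F] in
theorem exists_separated_sequence_completion (v : InfinitePlace F) :
    ∃ c : ℕ → F, ∃ U ∈ 𝓝 (0 : v.Completion),
      ∀ l m, l ≠ m → ((c l - c m : F) : v.Completion) ∉ U := by
  refine ⟨Nat.cast, Metric.ball 0 1, Metric.ball_mem_nhds _ one_pos, fun l m hlm hmem => ?_⟩
  rw [mem_ball_zero_iff] at hmem
  have hlt : v ((l - m : ℤ) : F) < 1 := by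
    push_cast
    simpa only [InfinitePlace.Completion.norm_coe] using! hmem
  rw [InfinitePlace.map_intCast, Int.norm_eq_abs] at hlt
  have habs : |(l - m : ℤ)| < 1 := by exact_mod_cast hlt
  exact hlm (by exact_mod_cast sub_eq_zero.1 (Int.abs_lt_one_iff.1 habs))

theorem exists_separated_sequence_adicCompletion (v : HeightOneSpectrum (𝓞 F)) :
    ∃ c : ℕ → F, ∃ U ∈ 𝓝 (0 : v.adicCompletion F),
      ∀ l m, l ≠ m → ((c l - c m : F) : v.adicCompletion F) ∉ U := by
  obtain ⟨π, hπ⟩ := v.valuation_exists_uniformizer F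
  have hval (m : ℕ) : v.valuation F (π⁻¹ ^ m) = WithZero.exp (m : ℤ) := by
    rw [map_pow, map_inv₀, hπ, ← WithZero.exp_neg, neg_neg, ← WithZero.exp_nsmul, nsmul_one]
  have hlarge {l m : ℕ} (hlm : m < l) : ¬v.valuation F (π⁻¹ ^ l - π⁻¹ ^ m) ≤ 1 := by
    rw [Valuation.map_sub_eq_of_lt_left _ (by
      rw [hval, hval, WithZero.exp_lt_exp]; exact_mod_cast hlm), hval, ← WithZero.exp_zero,
      WithZero.exp_le_exp]
    omega
  refine ⟨fun m => π⁻¹ ^ m, v.adicCompletionIntegers F,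
    (Valued.isOpen_valuationSubring _).mem_nhds (zero_mem _), fun l m hlm hmem => ?_⟩
  rw [SetLike.mem_coe, mem_adicCompletionIntegers, valuedAdicCompletion_eq_valuation'] at hmem
  rcases lt_or_gt_of_ne hlm with h | h
  · exact hlarge h (by rwa [Valuation.map_sub_swap])
  · exact hlarge h hmem

theorem exists_separated_multiples {t : Adele F} (ht : t ≠ 0) :
    ∃ c : ℕ → F, ∃ U ∈ 𝓝 (0 : Adele F),
      ∀ l m, l ≠ m → algebraMap F (Adele F) (c l - c m) * t ∉ U := by
  have hplace : (∃ v, t.1 v ≠ 0) ∨ ∃ v, t.2 v ≠ 0 := by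
    by_contra! h
    exact ht (Prod.ext (funext h.1) (FiniteAdeleRing.ext F h.2))
  rcases hplace with ⟨v, hv⟩ | ⟨v, hv⟩
  · obtain ⟨c, U, hU, hc⟩ := exists_separated_sequence_completion v
    refine ⟨c, (fun a => a.1 v * (t.1 v)⁻¹) ⁻¹' U, ?_, fun l m hlm hmem => hc l m hlm ?_⟩
    · refine ((continuous_adele_infinite v).mul continuous_const).continuousAt.preimage_mem_nhds ?_
      change U ∈ 𝓝 (0 * (t.1 v)⁻¹)
      rwa [zero_mul]
    · change _ * t.1 v * (t.1 v)⁻¹ ∈ U at hmem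
      rwa [mul_inv_cancel_right₀ hv] at hmem
  · obtain ⟨c, U, hU, hc⟩ := exists_separated_sequence_adicCompletion v
    refine ⟨c, (fun a => a.2 v * (t.2 v)⁻¹) ⁻¹' U, ?_, fun l m hlm hmem => hc l m hlm ?_⟩
    · refine (((RestrictedProduct.continuous_eval v).comp continuous_adele_snd).mul
        continuous_const).continuousAt.preimage_mem_nhds ?_
      change U ∈ 𝓝 (0 * (t.2 v)⁻¹)
      rwa [zero_mul]
    · change _ * t.2 v * (t.2 v)⁻¹ ∈ U at hmem
      rwa [mul_inv_cancel_right₀ hv] at hmem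

theorem eq_zero_of_forall_addChar_mul_eq_one (hψ_cont : Continuous ψ) (hψ_ne : ψ ≠ 1)
    (hψ_F : ∀ x : F, ψ (algebraMap F (Adele F) x) = 1) {t : Adele F}
    (ht : ∀ a, ψ (t * a) = 1) : t = 0 := by
  by_contra ht0
  obtain ⟨c, U, hU, hc⟩ := exists_separated_multiples ht0
  obtain ⟨l, m, hlm, ξ, s, hsU, hs, hξ⟩ := exists_sub_mul_eq_algebraMap_add hψ_cont hψ_F
    (fun ξ => by rw [mul_comm]; exact ht _) c hU
  refine hc l m hlm ?_
  suffices hξ0 : ξ = 0 by rwa [hξ, hξ0, map_zero, zero_add]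
  by_contra hξ0
  refine hψ_ne (DFunLike.ext _ _ fun a => ?_)
  have hdiv := ht (algebraMap F (Adele F) (c l - c m) * (algebraMap F (Adele F) ξ⁻¹ * a))
  rwa [← mul_assoc, mul_comm t, hξ, add_mul, AddChar.map_add_eq_mul, hs, mul_one, ← mul_assoc,
    ← map_mul, mul_inv_cancel₀ hξ0, map_one, one_mul] at hdiv

/-- `F` is its own annihilator under the pairing `(a, b) ↦ ψ (a b)`. -/
theorem mem_principalSubgroup_of_forall_addChar_eq_one (hψ_cont : Continuous ψ) (hψ_ne : ψ ≠ 1)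
    (hψ_F : ∀ x : F, ψ (algebraMap F (Adele F) x) = 1) {t : Adele F}
    (ht : ∀ ξ : F, ψ (algebraMap F (Adele F) ξ * t) = 1) :
    t ∈ AdeleRing.principalSubgroup (𝓞 F) F := by
  obtain ⟨l, m, hlm, ξ, s, -, hs, hξ⟩ :=
    exists_sub_mul_eq_algebraMap_add hψ_cont hψ_F ht Nat.cast univ_mem
  have hne : (l : F) - m ≠ 0 := sub_ne_zero.2 (by exact_mod_cast hlm)
  obtain rfl := eq_zero_of_forall_addChar_mul_eq_one hψ_cont hψ_ne hψ_F hs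
  refine ⟨((l : F) - m)⁻¹ * ξ, ?_⟩
  rw [map_mul, ← add_zero (algebraMap F (Adele F) ξ), ← hξ, ← mul_assoc, ← map_mul,
    inv_mul_cancel₀ hne, map_one, one_mul]

theorem eq_zero_of_classChar_eq_one (hψ_ne : ψ ≠ 1)
    (hψ_F : ∀ x : F, ψ (algebraMap F (Adele F) x) = 1) {ξ : F} (hξ : classChar ψ hψ_F ξ = 1) :
    ξ = 0 := by
  by_contra hξ0
  refine hψ_ne (DFunLike.ext _ _ fun a => ?_)
  have h := DFunLike.congr_fun hξ ((algebraMap F (Adele F) ξ⁻¹ * a : Adele F) : AdeleClass F)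
  rwa [classChar_coe, ← mul_assoc, ← map_mul, mul_inv_cancel₀ hξ0, map_one, one_mul] at h

theorem eq_zero_of_forall_classChar_apply_eq_one (hψ_cont : Continuous ψ) (hψ_ne : ψ ≠ 1)
    (hψ_F : ∀ x : F, ψ (algebraMap F (Adele F) x) = 1) {t : AdeleClass F}
    (ht : ∀ ξ, classChar ψ hψ_F ξ t = 1) : t = 0 := by
  obtain ⟨a, rfl⟩ := QuotientAddGroup.mk_surjective t
  exact (QuotientAddGroup.eq_zero_iff a).2
    (mem_principalSubgroup_of_forall_addChar_eq_one hψ_cont hψ_ne hψ_F ht)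

theorem archAdele_mul_eq (x : mixedEmbedding.mixedSpace F) (a : Adele F) :
    archAdele x * a = archAdele (x * ringEquiv_mixedSpace F a.1) := by
  refine Prod.ext ?_ (zero_mul a.2)
  change (ringEquiv_mixedSpace F).symm x * a.1 = (ringEquiv_mixedSpace F).symm _
  rw [map_mul, RingEquiv.symm_apply_apply]

theorem exists_addChar_archAdele_mul (hψ_cont : Continuous ψ) (hψ_ne : ψ ≠ 1)
    (hψ_F : ∀ x : F, ψ (algebraMap F (Adele F) x) = 1) {y : mixedEmbedding.mixedSpace F}
    (hy : y ≠ 0) : ∃ h, 1 / 2 < ‖ψ (archAdele (y * h)) - 1‖ := by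
  by_contra! hle
  have hzero : archAdele y = 0 := by
    refine eq_zero_of_forall_addChar_mul_eq_one hψ_cont hψ_ne hψ_F fun a => ?_
    refine addChar_eq_one_of_forall_nsmul (χ := ψ) fun m => ?_
    rw [← mul_smul_comm, archAdele_mul_eq]
    exact hle _
  exact hy ((ringEquiv_mixedSpace F).symm.injective
    ((congrArg Prod.fst hzero).trans (map_zero _).symm))

open scoped Classical in
theorem exists_norm_le_addChar_archAdele (hψ_cont : Continuous ψ) (hψ_ne : ψ ≠ 1)
    (hψ_F : ∀ x : F, ψ (algebraMap F (Adele F) x) = 1) :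
    ∃ C : ℝ, 0 ≤ C ∧ ∀ y : mixedEmbedding.mixedSpace F, y ≠ 0 →
      ∃ h, ‖h‖ ≤ C * ‖y‖⁻¹ ∧ 1 / 2 < ‖ψ (archAdele (y * h)) - 1‖ := by
  obtain ⟨C, hC⟩ : ∃ C : ℝ, ∀ u ∈ Metric.sphere (0 : mixedEmbedding.mixedSpace F) 1,
      ∃ h, ‖h‖ ≤ C ∧ 1 / 2 < ‖ψ (archAdele (u * h)) - 1‖ := by
    refine (isCompact_sphere _ _).induction_on ⟨0, by simp⟩ (fun s t hst ⟨C, hC⟩ =>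
      ⟨C, fun u hu => hC u (hst hu)⟩) ?_ fun u hu => ?_
    · rintro s t ⟨C, hC⟩ ⟨C', hC'⟩
      refine ⟨max C C', fun u hu => hu.elim (fun hus => ?_) fun hut => ?_⟩
      · obtain ⟨h, hh, hψ⟩ := hC u hus
        exact ⟨h, hh.trans (le_max_left _ _), hψ⟩
      · obtain ⟨h, hh, hψ⟩ := hC' u hut
        exact ⟨h, hh.trans (le_max_right _ _), hψ⟩
    · obtain ⟨h, hh⟩ := exists_addChar_archAdele_mul hψ_cont hψ_ne hψ_F
        (ne_zero_of_mem_unit_sphere ⟨u, hu⟩)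
      have hcont : Continuous fun z => ‖ψ (archAdele (z * h)) - 1‖ :=
        ((hψ_cont.comp (continuous_archAdele.comp (continuous_mul_const h))).sub
          continuous_const).norm
      exact ⟨_, mem_nhdsWithin_of_mem_nhds (hcont.continuousAt.eventually_const_lt hh),
        ‖h‖, fun z hz => ⟨h, le_rfl, hz⟩⟩
  refine ⟨max C 0, le_max_right _ _, fun y hy => ?_⟩
  obtain ⟨h, hh, hψ⟩ := hC (‖y‖⁻¹ • y) (by simp [norm_smul, hy])
  refine ⟨‖y‖⁻¹ • h, ?_, by rwa [mul_smul_comm, ← smul_mul_assoc]⟩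
  rw [norm_smul, norm_inv, norm_norm, mul_comm]
  gcongr
  exact hh.trans (le_max_left _ _)

end Characters

section FourierSeries

open IsDedekindDomain NumberField mixedEmbedding

variable {F : Type*} [Field F] [NumberField F]

instance : MeasurableSpace (AdeleClass F) :=
  borel _

instance : BorelSpace (AdeleClass F) :=
  ⟨rfl⟩

variable (F) in
/-- The Haar probability measure on `𝔸 / F`. -/
def adeleClassMeasure : Measure (AdeleClass F) :=
  Measure.addHaarMeasure ⊤

instance : (adeleClassMeasure F).IsAddHaarMeasure :=
  inferInstanceAs (Measure.addHaarMeasure ⊤).IsAddHaarMeasure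

instance : IsProbabilityMeasure (adeleClassMeasure F) :=
  ⟨Measure.addHaarMeasure_self (K₀ := ⊤)⟩

variable {ψ : AddChar (Adele F) ℂ}

/-- The elements `ξ` of `F` such that `y ↦ ψ (ξ y)` is trivial on `N · Ô`. -/
def conductorSubgroup (ψ : AddChar (Adele F) ℂ) (N : ℕ) : AddSubgroup F where
  carrier := {ξ | ∀ y ∈ integralFiniteAdeles (𝓞 F) F,
    ψ (algebraMap F (Adele F) ξ * finiteAdele (N • y)) = 1}
  zero_mem' y _ := by rw [map_zero, zero_mul, AddChar.map_zero_eq_one]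
  add_mem' hξ hη y hy := by
    rw [map_add, add_mul, AddChar.map_add_eq_mul, hξ y hy, hη y hy, one_mul]
  neg_mem' hξ y hy := by rw [map_neg, neg_mul, AddChar.map_neg_eq_inv, hξ y hy, inv_one]

/-- The lattice in `ℝ ^ r₁ × ℂ ^ r₂` attached to `conductorSubgroup`. -/
def conductorLattice (ψ : AddChar (Adele F) ℂ) (N : ℕ) : Submodule ℤ (mixedSpace F) :=
  AddSubgroup.toIntSubmodule ((conductorSubgroup ψ N).map (mixedEmbedding F).toAddMonoidHom)

theorem discreteTopology_conductorLattice (hψ_cont : Continuous ψ) (hψ_ne : ψ ≠ 1)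
    (hψ_F : ∀ x : F, ψ (algebraMap F (Adele F) x) = 1) {N : ℕ} (hN : N ≠ 0) :
    DiscreteTopology (conductorLattice ψ N) := by
  obtain ⟨C, hC, h⟩ :=
    exists_isCompact_eq_algebraMap_add_archAdele_add_finiteAdele_nsmul (F := F) hN
  have hsmall : ∀ᶠ x : mixedSpace F in 𝓝 0, ∀ c ∈ C, ‖ψ (archAdele (x * c)) - 1‖ < 1 / 2 := by
    refine hC.eventually_forall_of_forall_eventually fun c _ => ?_
    have hcont : ContinuousAt (fun z : mixedSpace F × mixedSpace F =>
        ‖ψ (archAdele (z.1 * z.2)) - 1‖) (0, c) :=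
      ((hψ_cont.comp (continuous_archAdele.comp (continuous_fst.mul continuous_snd))).sub
        continuous_const).norm.continuousAt
    exact hcont.eventually_lt continuousAt_const (by simp)
  refine discreteTopology_of_isOpen_singleton_zero (isOpen_iff_mem_nhds.2 ?_)
  rintro _ rfl
  filter_upwards [continuous_subtype_val.tendsto (0 : conductorLattice ψ N) |>.eventually hsmall]
  rintro ⟨_, ξ, hξ, rfl⟩ hξC
  have htriv (a : Adele F) : ψ (algebraMap F (Adele F) ξ * a) = 1 := by
    refine addChar_eq_one_of_forall_nsmul (χ := ψ) fun m => ?_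
    obtain ⟨η, x, hx, y, hy, hxy⟩ := h (m • a)
    rw [← mul_smul_comm, hxy, add_assoc, addChar_algebraMap_mul_algebraMap_add hψ_F, mul_add,
      AddChar.map_add_eq_mul, hξ y hy, mul_one, ← archAdele_mixedEmbedding_mul]
    exact (hξC x hx).le
  have hzero := eq_zero_of_forall_addChar_mul_eq_one hψ_cont hψ_ne hψ_F htriv
  obtain rfl : ξ = 0 := AdeleRing.algebraMap_injective (𝓞 F) F (hzero.trans (map_zero _).symm)
  exact Subtype.ext (map_zero (mixedEmbedding F))

open scoped Classical in
theorem summable_of_rapid_decay (hψ_cont : Continuous ψ) (hψ_ne : ψ ≠ 1)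
    (hψ_F : ∀ x : F, ψ (algebraMap F (Adele F) x) = 1) {N : ℕ} (hN : N ≠ 0) {c : F → ℂ}
    (hsupp : ∀ ξ, c ξ ≠ 0 → ξ ∈ conductorSubgroup ψ N)
    (hdecay : ∀ k : ℕ, ∃ B : ℝ, ∀ ξ ≠ 0, ‖c ξ‖ ≤ B * ‖mixedEmbedding F ξ‖⁻¹ ^ k) :
    Summable c := by
  have hdisc := discreteTopology_conductorLattice hψ_cont hψ_ne hψ_F hN
  obtain ⟨B, hB⟩ := hdecay (Module.finrank ℤ (conductorLattice ψ N) + 1)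
  let ι : conductorSubgroup ψ N → conductorLattice ψ N := fun ξ =>
    ⟨mixedEmbedding F ξ, ξ, ξ.2, rfl⟩
  have hι : Function.Injective ι := fun ξ η h =>
    Subtype.ext (mixedEmbedding_injective F (congrArg Subtype.val h))
  have hlattice := ((ZLattice.summable_norm_pow_inv (conductorLattice ψ N) _
    (Nat.lt_succ_self _)).comp_injective hι).mul_left B
  have hsub : Summable fun ξ : conductorSubgroup ψ N => c ξ := by
    refine Summable.of_norm_bounded_eventually hlattice ?_
    filter_upwards [(Set.finite_singleton (0 : conductorSubgroup ψ N)).compl_mem_cofinite] with ξ hξ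
    exact hB ξ fun h => hξ (Subtype.ext h)
  refine (Subtype.val_injective.summable_iff fun ξ hξ => ?_).1 hsub
  by_contra h
  exact hξ ⟨⟨ξ, hsupp ξ h⟩, rfl⟩

theorem mem_conductorSubgroup_of_charCoeff_ne_zero
    (hψ_F : ∀ x : F, ψ (algebraMap F (Adele F) x) = 1) {N : ℕ} {f : AdeleClass F → ℂ}
    (hinv : ∀ s, ∀ y ∈ integralFiniteAdeles (𝓞 F) F,
      f (s + (finiteAdele (N • y) : Adele F)) = f s) {ξ : F}
    (hξ : charCoeff (adeleClassMeasure F) (classChar ψ hψ_F ξ) f ≠ 0) :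
    ξ ∈ conductorSubgroup ψ N := fun y hy => by
  have h := charCoeff_translate (μ := adeleClassMeasure F) (classChar ψ hψ_F ξ) f
    ((finiteAdele (N • y) : Adele F) : AdeleClass F)
  simp only [hinv _ y hy] at h
  exact mul_right_cancel₀ hξ (h.symm.trans (one_mul _).symm)

open scoped Classical in
theorem exists_norm_charCoeff_le (hψ_cont : Continuous ψ) (hψ_ne : ψ ≠ 1)
    (hψ_F : ∀ x : F, ψ (algebraMap F (Adele F) x) = 1) {f : AdeleClass F → ℂ}
    (hf : Continuous f) {k : ℕ} {B : ℝ}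
    (hB : ∀ (h : mixedSpace F) s,
      ‖(fwdDiff ((archAdele h : Adele F) : AdeleClass F))^[k] f s‖ ≤ B * ‖h‖ ^ k) :
    ∃ B' : ℝ, ∀ ξ ≠ 0, ‖charCoeff (adeleClassMeasure F) (classChar ψ hψ_F ξ) f‖ ≤
      B' * ‖mixedEmbedding F ξ‖⁻¹ ^ k := by
  obtain ⟨C, _, hC⟩ := exists_norm_le_addChar_archAdele hψ_cont hψ_ne hψ_F
  refine ⟨2 ^ k * (|B| * C ^ k), fun ξ hξ => ?_⟩
  obtain ⟨h, hh, hψ⟩ := hC (mixedEmbedding F ξ) ((map_ne_zero _).2 hξ)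
  rw [archAdele_mixedEmbedding_mul] at hψ
  set c := charCoeff (adeleClassMeasure F) (classChar ψ hψ_F ξ) f
  have hχ := continuous_classChar hψ_cont hψ_F ξ
  have hdiff : ‖ψ (algebraMap F (Adele F) ξ * archAdele h) - 1‖ ^ k * ‖c‖ ≤ |B| * ‖h‖ ^ k := by
    rw [← norm_pow, ← norm_mul, ← classChar_coe hψ_F, ← charCoeff_fwdDiff hχ hf]
    refine (norm_integral_le_of_norm_le_const (C := |B| * ‖h‖ ^ k) (ae_of_all _ fun s => ?_)).trans
      (by simp)
    rw [norm_mul, norm_inv, norm_addChar_apply hχ, inv_one, mul_one]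
    exact (hB h s).trans (by gcongr; exact le_abs_self B)
  calc ‖c‖ = 2 ^ k * ((1 / 2) ^ k * ‖c‖) := by rw [← mul_assoc, ← mul_pow]; norm_num
    _ ≤ 2 ^ k * (‖ψ (algebraMap F (Adele F) ξ * archAdele h) - 1‖ ^ k * ‖c‖) := by gcongr
    _ ≤ 2 ^ k * (|B| * ‖h‖ ^ k) := by gcongr
    _ ≤ 2 ^ k * (|B| * (C * ‖mixedEmbedding F ξ‖⁻¹) ^ k) := by gcongr
    _ = 2 ^ k * (|B| * C ^ k) * ‖mixedEmbedding F ξ‖⁻¹ ^ k := by rw [mul_pow]; ring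

open scoped Classical in
theorem hasSum_charCoeff_classChar (hψ_cont : Continuous ψ) (hψ_ne : ψ ≠ 1)
    (hψ_F : ∀ x : F, ψ (algebraMap F (Adele F) x) = 1) {f : AdeleClass F → ℂ}
    (hf : Continuous f) {N : ℕ} (hN : N ≠ 0)
    (hinv : ∀ s, ∀ y ∈ integralFiniteAdeles (𝓞 F) F,
      f (s + (finiteAdele (N • y) : Adele F)) = f s)
    (hdiff : ∀ k : ℕ, ∃ B : ℝ, ∀ (h : mixedSpace F) s,
      ‖(fwdDiff ((archAdele h : Adele F) : AdeleClass F))^[k] f s‖ ≤ B * ‖h‖ ^ k) :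
    HasSum (fun ξ => charCoeff (adeleClassMeasure F) (classChar ψ hψ_F ξ) f) (f 0) :=
  hasSum_charCoeff (continuous_classChar hψ_cont hψ_F)
    (fun _ => eq_zero_of_forall_classChar_apply_eq_one hψ_cont hψ_ne hψ_F)
    (fun _ => eq_zero_of_classChar_eq_one hψ_ne hψ_F) ⟨f, hf⟩
    (summable_of_rapid_decay hψ_cont hψ_ne hψ_F hN
      (fun _ => mem_conductorSubgroup_of_charCoeff_ne_zero hψ_F hinv)
      fun k => (hdiff k).elim fun _ => exists_norm_charCoeff_le hψ_cont hψ_ne hψ_F hf)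

end FourierSeries

/-! ### Root subgroups and central filtrations of the unipotent radical -/

section RootSubgroups

variable {n : ℕ} {R : Type*} [CommRing R]

theorem Sp.ext_entry {g h : Sp n R} (H : ∀ i j, g.entry i j = h.entry i j) : g = h :=
  Subtype.ext (Units.ext (Matrix.ext H))

theorem Sp.entry_one (i j : Fin (2 * n)) :
    (1 : Sp n R).entry i j = (1 : Matrix (Fin (2 * n)) (Fin (2 * n)) R) i j := rfl

theorem Sp.entry_mul (g h : Sp n R) (i j : Fin (2 * n)) :
    (g * h).entry i j = ∑ k, g.entry i k * h.entry k j := rfl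

theorem Sp.entry_map {S : Type*} [CommRing S] (f : R →+* S) (g : Sp n R) (i j : Fin (2 * n)) :
    (Sp.map f g).entry i j = f (g.entry i j) := rfl

variable (n R) in
/-- The sign of the nonzero entry of `J` in row `i`. -/
def halfSign (i : Fin (2 * n)) : R := if (i : ℕ) < n then 1 else -1

theorem halfSign_mul_self (i : Fin (2 * n)) : halfSign n R i * halfSign n R i = 1 := by
  unfold halfSign; split_ifs <;> simp

theorem halfSign_rev (i : Fin (2 * n)) : halfSign n R i.rev = -halfSign n R i := by
  have hrev : (i.rev : ℕ) = 2 * n - (i + 1) := Fin.val_rev i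
  have hi := i.2
  unfold halfSign
  split_ifs <;> first | omega | simp

theorem map_halfSign {S : Type*} [CommRing S] (f : R →+* S) (i : Fin (2 * n)) :
    f (halfSign n R i) = halfSign n S i := by
  unfold halfSign; split_ifs <;> simp

theorem rev_ne_self (i : Fin (2 * n)) : i.rev ≠ i := by
  intro h
  have hrev : (i.rev : ℕ) = 2 * n - (i + 1) := Fin.val_rev i
  rw [h] at hrev
  omega

theorem formJ_mul_apply (M : Matrix (Fin (2 * n)) (Fin (2 * n)) R) (a b : Fin (2 * n)) :
    (formJ n R * M) a b = halfSign n R a * M a.rev b := by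
  rw [Matrix.mul_apply, Finset.sum_eq_single a.rev]
  · simp [formJ, halfSign]
  · intro c _ hc
    simp [formJ, hc]
  · simp

theorem mul_formJ_apply (M : Matrix (Fin (2 * n)) (Fin (2 * n)) R) (a b : Fin (2 * n)) :
    (M * formJ n R) a b = M a b.rev * halfSign n R b.rev := by
  rw [Matrix.mul_apply, Finset.sum_eq_single b.rev]
  · simp [formJ, halfSign]
  · intro c _ hc
    have hb : b ≠ c.rev := fun h => hc (by rw [h, Fin.rev_rev])
    simp [formJ, hb]
  · simp

theorem Sp.sum_entry_mul_entry (g : Sp n R) (a b : Fin (2 * n)) :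
    ∑ c, g.entry c a * (halfSign n R c * g.entry c.rev b) = formJ n R a b := by
  have h : (g.1.val)ᵀ * formJ n R * g.1.val = formJ n R := g.2
  rw [← h, Matrix.mul_assoc, Matrix.mul_apply]
  exact Finset.sum_congr rfl fun c _ => by rw [formJ_mul_apply]; rfl

/-- The nilpotent matrix spanning the root space of `(i, j)`: the entries `(i, j)` and
`(j.rev, i.rev)` of an element of the Lie algebra of `Sp_{2n}` determine each other. -/
def rootMatrix (R : Type*) [CommRing R] (i j : Fin (2 * n)) :
    Matrix (Fin (2 * n)) (Fin (2 * n)) R :=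
  Matrix.of fun a b => if a = i ∧ b = j then 1 else
    if a = j.rev ∧ b = i.rev then -(halfSign n R i * halfSign n R j) else 0

theorem rootMatrix_self (i j : Fin (2 * n)) : rootMatrix R i j i j = 1 := by
  simp [rootMatrix]

theorem rootMatrix_rev (i j : Fin (2 * n)) :
    rootMatrix R i j j.rev i.rev = -(halfSign n R i * halfSign n R j) := by
  by_cases h : j.rev = i ∧ i.rev = j
  · have hj := halfSign_rev (R := R) i
    rw [h.2] at hj
    rw [h.1, h.2, rootMatrix_self, hj, mul_neg, neg_neg, halfSign_mul_self]
  · simp only [rootMatrix, Matrix.of_apply, h, and_self, if_true, if_false]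

theorem rootMatrix_eq_zero {i j a b : Fin (2 * n)} (h₁ : ¬ (a = i ∧ b = j))
    (h₂ : ¬ (a = j.rev ∧ b = i.rev)) : rootMatrix R i j a b = 0 := by
  simp only [rootMatrix, Matrix.of_apply, if_neg h₁, if_neg h₂]

theorem map_rootMatrix {S : Type*} [CommRing S] (f : R →+* S) (i j a b : Fin (2 * n)) :
    f (rootMatrix R i j a b) = rootMatrix S i j a b := by
  simp only [rootMatrix, Matrix.of_apply]
  split_ifs <;> simp [map_halfSign]

theorem rootMatrix_rev_rev (i j a b : Fin (2 * n)) :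
    rootMatrix R i j b.rev a.rev = -(halfSign n R a * halfSign n R b) * rootMatrix R i j a b := by
  by_cases hij : a = i ∧ b = j
  · rw [hij.1, hij.2, rootMatrix_rev, rootMatrix_self, mul_one]
  by_cases hji : a = j.rev ∧ b = i.rev
  · rw [hji.1, hji.2, Fin.rev_rev, Fin.rev_rev, rootMatrix_rev, rootMatrix_self, halfSign_rev,
      halfSign_rev]
    linear_combination (-(halfSign n R i * halfSign n R i)) * halfSign_mul_self (R := R) j -
      halfSign_mul_self (R := R) i
  · rw [rootMatrix_eq_zero hij hji, rootMatrix_eq_zero, mul_zero]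
    · rintro ⟨hb, ha⟩
      exact hji ⟨by rw [← ha, Fin.rev_rev], by rw [← hb, Fin.rev_rev]⟩
    · rintro ⟨hb, ha⟩
      exact hij ⟨Fin.rev_injective ha, Fin.rev_injective hb⟩

theorem rootMatrix_mul_self {i j : Fin (2 * n)} (hij : i ≠ j) :
    rootMatrix R i j * rootMatrix R i j = 0 := by
  ext a b
  rw [Matrix.mul_apply, Matrix.zero_apply]
  refine Finset.sum_eq_zero fun c _ => ?_
  have hi := rev_ne_self i
  have hj := rev_ne_self j
  have hrev : i.rev ≠ j.rev := fun h => hij (Fin.rev_injective h)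
  by_cases hcj : c = j
  · subst hcj
    rw [rootMatrix_eq_zero (a := c) (by simp [hij.symm]) (by simp [hj.symm]), mul_zero]
  · by_cases hci : c = i.rev
    · subst hci
      rw [rootMatrix_eq_zero (a := i.rev) (by simp [hi]) (by simp [hrev]), mul_zero]
    · rw [rootMatrix_eq_zero (b := c) (by simp [hcj]) (by simp [hci]), zero_mul]

theorem transpose_rootMatrix_mul (i j : Fin (2 * n)) :
    (rootMatrix R i j)ᵀ * formJ n R = -(formJ n R * rootMatrix R i j) := by
  ext a b
  have hrev := rootMatrix_rev_rev (R := R) i j a.rev b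
  rw [Fin.rev_rev, halfSign_rev] at hrev
  rw [Matrix.neg_apply, mul_formJ_apply, formJ_mul_apply, Matrix.transpose_apply, hrev,
    halfSign_rev]
  linear_combination (-(halfSign n R a * rootMatrix R i j a.rev b)) * halfSign_mul_self (R := R) b

theorem one_add_rootMatrix_mul {i j : Fin (2 * n)} (hij : i ≠ j) (s t : R) :
    (1 + s • rootMatrix R i j) * (1 + t • rootMatrix R i j) = 1 + (s + t) • rootMatrix R i j := by
  simp only [mul_add, add_mul, Matrix.smul_mul, Matrix.mul_smul, rootMatrix_mul_self hij,
    one_mul, mul_one, smul_zero, add_zero, add_smul, add_assoc]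

theorem transpose_one_add_rootMatrix_mul (i j : Fin (2 * n)) (t : R) :
    (1 + t • rootMatrix R i j)ᵀ * formJ n R = formJ n R * (1 + (-t) • rootMatrix R i j) := by
  rw [Matrix.transpose_add, Matrix.transpose_one, Matrix.transpose_smul, add_mul, one_mul,
    Matrix.smul_mul, transpose_rootMatrix_mul, mul_add, mul_one, Matrix.mul_smul, smul_neg,
    neg_smul]

/-- The root subgroup `t ↦ 1 + t X` attached to `(i, j)`, as a homomorphism from the additive group
to `Sp_{2n}`. -/
def rootHom {i j : Fin (2 * n)} (hij : i ≠ j) : AddChar R (Sp n R) where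
  toFun t := ⟨⟨1 + t • rootMatrix R i j, 1 + (-t) • rootMatrix R i j,
      by rw [one_add_rootMatrix_mul hij]; simp, by rw [one_add_rootMatrix_mul hij]; simp⟩, by
    change (1 + t • rootMatrix R i j)ᵀ * formJ n R * (1 + t • rootMatrix R i j) = formJ n R
    rw [transpose_one_add_rootMatrix_mul, mul_assoc, one_add_rootMatrix_mul hij]
    simp⟩
  map_zero_eq_one' := Subtype.ext (Units.ext (by simp))
  map_add_eq_mul' s t := Subtype.ext (Units.ext (one_add_rootMatrix_mul hij s t).symm)

theorem entry_rootHom {i j : Fin (2 * n)} (hij : i ≠ j) (t : R) (a b : Fin (2 * n)) :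
    (rootHom hij t).entry a b = (1 : Matrix (Fin (2 * n)) (Fin (2 * n)) R) a b +
      t * rootMatrix R i j a b := rfl

theorem map_rootHom {S : Type*} [CommRing S] (f : R →+* S) {i j : Fin (2 * n)} (hij : i ≠ j)
    (t : R) : Sp.map f (rootHom hij t) = rootHom hij (f t) := by
  refine Sp.ext_entry fun a b => ?_
  rw [Sp.entry_map, entry_rootHom, entry_rootHom, map_add, map_mul, map_rootMatrix,
    Matrix.one_apply, Matrix.one_apply]
  split_ifs <;> simp

theorem continuous_rootHom [TopologicalSpace R] [IsTopologicalRing R] {i j : Fin (2 * n)}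
    (hij : i ≠ j) : Continuous (rootHom (R := R) hij) := by
  refine Continuous.subtype_mk (Units.continuous_iff.2 ⟨?_, ?_⟩) _
  · change Continuous fun t : R => 1 + t • rootMatrix R i j
    fun_prop
  · change Continuous fun t : R => 1 + (-t) • rootMatrix R i j
    fun_prop

end RootSubgroups

section Filtration

variable {n : ℕ} {R : Type*} [CommRing R]

theorem entry_self_of_mem {g : Sp n R} (hg : g ∈ subgroupN n R) (i : Fin (2 * n)) :
    g.entry i i = 1 := by rw [hg i i le_rfl, Matrix.one_apply_eq]

theorem entry_eq_zero_of_lt {g : Sp n R} (hg : g ∈ subgroupN n R) {i j : Fin (2 * n)} (h : j < i) :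
    g.entry i j = 0 := by
  rw [hg i j (Fin.le_def.1 h.le), Matrix.one_apply_ne h.ne']

theorem entry_mul_of_forall {g h : Sp n R} (hg : g ∈ subgroupN n R) (hh : h ∈ subgroupN n R)
    {i j : Fin (2 * n)} (hij : i < j)
    (H : ∀ k, i < k → k < j → g.entry i k * h.entry k j = 0) :
    (g * h).entry i j = g.entry i j + h.entry i j := by
  rw [Sp.entry_mul, ← Finset.sum_subset (Finset.subset_univ {i, j}), Finset.sum_pair hij.ne,
    entry_self_of_mem hg, entry_self_of_mem hh, one_mul, mul_one, add_comm]
  intro k _ hk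
  simp only [Finset.mem_insert, Finset.mem_singleton, not_or] at hk
  rcases lt_or_gt_of_ne hk.1 with hki | hki
  · rw [entry_eq_zero_of_lt hg hki, zero_mul]
  · rcases lt_or_gt_of_ne hk.2 with hkj | hkj
    · exact H k hki hkj
    · rw [entry_eq_zero_of_lt hh hkj, mul_zero]

/-- Numberings of the positive roots, given as positions above the diagonal, along which the
unipotent group `N` has a central filtration by root subgroups. -/
structure IsRootOrder (n : ℕ) (ρ : Fin (2 * n) → Fin (2 * n) → ℕ) : Prop where
  lt_left : ∀ {i j k}, i < j → j < k → ρ i j < ρ i k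
  lt_right : ∀ {i j k}, i < j → j < k → ρ j k < ρ i k
  symm : ∀ i j, ρ j.rev i.rev = ρ i j
  inj : ∀ {i j a b}, i < j → a < b → ρ a b = ρ i j → (a = i ∧ b = j) ∨ (a = j.rev ∧ b = i.rev)

variable {ρ : Fin (2 * n) → Fin (2 * n) → ℕ}

theorem entry_mul_inv_eq_zero (hρ : IsRootOrder n ρ) {g h : Sp n R} (hg : g ∈ subgroupN n R)
    (hh : h ∈ subgroupN n R) {r : ℕ} (H : ∀ a b, a < b → ρ a b < r → g.entry a b = h.entry a b)
    (a b : Fin (2 * n)) (hab : a < b) (hr : ρ a b < r) : (g * h⁻¹).entry a b = 0 := by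
  induction hm : ρ a b using Nat.strong_induction_on generalizing a b with
  | _ m ih =>
    have hmul := entry_mul_of_forall (mul_mem hg (inv_mem hh)) hh hab fun c hac hcb => by
      have hlt := hρ.lt_left hac hcb
      rw [ih _ (hm ▸ hlt) a c hac (hlt.trans hr) rfl, zero_mul]
    rw [inv_mul_cancel_right, H a b hab hr] at hmul
    exact right_eq_add.1 hmul

variable (R) in
/-- The filtration of `N` attached to a numbering of the positive roots. -/
def rootFiltration (hρ : IsRootOrder n ρ) (r : ℕ) : Subgroup (Sp n R) where
  carrier := {g | g ∈ subgroupN n R ∧ ∀ a b, a < b → ρ a b < r → g.entry a b = 0}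
  one_mem' := ⟨one_mem _, fun a b hab _ => Matrix.one_apply_ne hab.ne⟩
  mul_mem' := by
    intro g h hg hh
    refine ⟨mul_mem hg.1 hh.1, fun a b hab hr => ?_⟩
    rw [entry_mul_of_forall hg.1 hh.1 hab, hg.2 a b hab hr, hh.2 a b hab hr, add_zero]
    intro c hac hcb
    rw [hg.2 a c hac ((hρ.lt_left hac hcb).trans hr), zero_mul]
  inv_mem' := by
    intro g hg
    refine ⟨inv_mem hg.1, fun a b hab hr => ?_⟩
    have hinv := entry_mul_inv_eq_zero hρ (one_mem _) hg.1 (r := r) (fun a b hab hr => by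
      rw [hg.2 a b hab hr]; exact Matrix.one_apply_ne hab.ne) a b hab hr
    rwa [one_mul] at hinv

variable (hρ : IsRootOrder n ρ)

theorem rootFiltration_le (r : ℕ) : rootFiltration R hρ r ≤ subgroupN n R := fun _ hg => hg.1

theorem rootFiltration_anti : Antitone (rootFiltration R hρ) :=
  fun _ _ hrs _ hg => ⟨hg.1, fun a b hab h => hg.2 a b hab (h.trans_le hrs)⟩

theorem mul_inv_mem_rootFiltration {g h : Sp n R} (hg : g ∈ subgroupN n R)
    (hh : h ∈ subgroupN n R) {r : ℕ} (H : ∀ a b, a < b → ρ a b < r → g.entry a b = h.entry a b) :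
    g * h⁻¹ ∈ rootFiltration R hρ r :=
  ⟨mul_mem hg (inv_mem hh), entry_mul_inv_eq_zero hρ hg hh H⟩

theorem comm_mem_rootFiltration {g u : Sp n R} {r : ℕ} (hg : g ∈ subgroupN n R)
    (hu : u ∈ rootFiltration R hρ r) : (g * u) * (u * g)⁻¹ ∈ rootFiltration R hρ (r + 1) := by
  refine mul_inv_mem_rootFiltration hρ (mul_mem hg hu.1) (mul_mem hu.1 hg) fun a b hab hr => ?_
  rw [entry_mul_of_forall hg hu.1 hab, entry_mul_of_forall hu.1 hg hab, add_comm]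
  · intro c hac hcb
    rw [hu.2 a c hac ((hρ.lt_left hac hcb).trans_le (Nat.lt_succ_iff.1 hr)), zero_mul]
  · intro c hac hcb
    rw [hu.2 c b hcb ((hρ.lt_right hac hcb).trans_le (Nat.lt_succ_iff.1 hr)), mul_zero]

theorem conj_mem_rootFiltration {g u : Sp n R} {r : ℕ} (hg : g ∈ subgroupN n R)
    (hu : u ∈ rootFiltration R hρ r) : g * u * g⁻¹ ∈ rootFiltration R hρ r := by
  have hcomm := rootFiltration_anti hρ (Nat.le_succ r) (comm_mem_rootFiltration hρ hg hu)
  have hmul : g * u * g⁻¹ = ((g * u) * (u * g)⁻¹) * u := by group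
  rw [hmul]
  exact mul_mem hcomm hu

include hρ in
theorem entry_rev_rev {u : Sp n R} {i j : Fin (2 * n)} (hij : i < j)
    (hu : u ∈ rootFiltration R hρ (ρ i j)) :
    u.entry j.rev i.rev = -(halfSign n R i * halfSign n R j) * u.entry i j := by
  have hsum := Sp.sum_entry_mul_entry u i.rev j
  have hform : formJ n R i.rev j = 0 := by
    simp [formJ, Fin.rev_rev, hij.ne']
  have hne : i.rev ≠ j.rev := fun h => hij.ne (Fin.rev_injective h)
  rw [hform, ← Finset.sum_subset (Finset.subset_univ {i.rev, j.rev}), Finset.sum_pair hne,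
    Fin.rev_rev, Fin.rev_rev, entry_self_of_mem hu.1, entry_self_of_mem hu.1, halfSign_rev,
    halfSign_rev] at hsum
  · linear_combination (-(halfSign n R j)) * hsum -
      (u.entry j.rev i.rev) * halfSign_mul_self (R := R) j
  · intro c _ hc
    simp only [Finset.mem_insert, Finset.mem_singleton, not_or] at hc
    rcases lt_or_gt_of_ne hc.1 with hci | hci
    · rcases lt_or_gt_of_ne hc.2 with hcj | hcj
      · have hjc : j < c.rev := by rw [← Fin.rev_rev j]; exact Fin.rev_lt_rev.2 hcj
        rw [entry_eq_zero_of_lt hu.1 hjc, mul_zero, mul_zero]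
      · have hjc : c.rev < j := by rw [← Fin.rev_rev j]; exact Fin.rev_lt_rev.2 hcj
        have hic : i < c.rev := by rw [← Fin.rev_rev i]; exact Fin.rev_lt_rev.2 hci
        have hsymm := hρ.symm i c.rev
        rw [Fin.rev_rev] at hsymm
        rw [hu.2 c i.rev hci (hsymm ▸ hρ.lt_left hic hjc), zero_mul]
    · rw [entry_eq_zero_of_lt hu.1 hci, zero_mul]

theorem rootHom_mem {i j : Fin (2 * n)} (hij : i < j) (t : R) :
    rootHom hij.ne t ∈ rootFiltration R hρ (ρ i j) := by
  have hrev : j.rev < i.rev := Fin.rev_lt_rev.2 hij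
  refine ⟨fun a b (hba : b ≤ a) => ?_, fun a b hab hr => ?_⟩
  · rw [entry_rootHom, rootMatrix_eq_zero, mul_zero, add_zero]
    · rintro ⟨rfl, rfl⟩; exact absurd hij hba.not_gt
    · rintro ⟨rfl, rfl⟩; exact absurd hrev hba.not_gt
  · rw [entry_rootHom, rootMatrix_eq_zero, mul_zero, add_zero, Matrix.one_apply_ne hab.ne]
    · rintro ⟨rfl, rfl⟩; exact lt_irrefl _ hr
    · rintro ⟨rfl, rfl⟩; rw [hρ.symm] at hr; exact lt_irrefl _ hr

theorem mul_rootHom_inv_mem {i j : Fin (2 * n)} (hij : i < j) {u : Sp n R}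
    (hu : u ∈ rootFiltration R hρ (ρ i j)) :
    u * (rootHom hij.ne (u.entry i j))⁻¹ ∈ rootFiltration R hρ (ρ i j + 1) := by
  have hx := rootHom_mem hρ hij (u.entry i j)
  refine mul_inv_mem_rootFiltration hρ hu.1 hx.1 fun a b hab hr => ?_
  rcases (Nat.lt_succ_iff.1 hr).lt_or_eq with hlt | heq
  · rw [hu.2 a b hab hlt, hx.2 a b hab hlt]
  · rw [entry_rootHom, Matrix.one_apply_ne hab.ne, zero_add]
    rcases hρ.inj hij hab heq with ⟨rfl, rfl⟩ | ⟨rfl, rfl⟩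
    · rw [rootMatrix_self, mul_one]
    · rw [entry_rev_rev hρ hij hu, rootMatrix_rev, mul_comm]

theorem rootFiltration_succ_of_forall_ne {r : ℕ} (h : ∀ i j, i < j → ρ i j ≠ r) :
    rootFiltration R hρ (r + 1) = rootFiltration R hρ r :=
  (rootFiltration_anti hρ (Nat.le_succ r)).antisymm fun _ hg => ⟨hg.1, fun a b hab hr =>
    hg.2 a b hab (lt_of_le_of_ne (Nat.lt_succ_iff.1 hr) (h a b hab))⟩

theorem rootFiltration_eq_bot {r : ℕ} (h : ∀ i j, i < j → ρ i j < r) :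
    rootFiltration R hρ r = ⊥ := by
  refine (Subgroup.eq_bot_iff_forall _).2 fun g hg => Sp.ext_entry fun a b => ?_
  rw [Sp.entry_one]
  rcases lt_trichotomy a b with hab | rfl | hab
  · rw [hg.2 a b hab (h a b hab), Matrix.one_apply_ne hab.ne]
  · rw [entry_self_of_mem hg.1, Matrix.one_apply_eq]
  · rw [entry_eq_zero_of_lt hg.1 hab, Matrix.one_apply_ne hab.ne']

theorem rootFiltration_zero : rootFiltration R hρ 0 = subgroupN n R :=
  le_antisymm (rootFiltration_le hρ 0) fun _ hg => ⟨hg, fun _ _ _ h => absurd h (Nat.not_lt_zero _)⟩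

end Filtration

section RootOrders

variable (n : ℕ) (R : Type*) [CommRing R]

/-- The numbering of the positive roots by their height, where roots of equal height are ordered by
a quantity invariant under `(i, j) ↦ (j.rev, i.rev)`, since both positions carry the same root. -/
def heightOrder (i j : Fin (2 * n)) : ℕ := ((j : ℕ) - i) * (2 * n) + min (i : ℕ) (2 * n - 1 - j)

variable {n}

theorem heightOrder_lt {i j : Fin (2 * n)} (hij : i < j) :
    heightOrder n i j < ((j : ℕ) - i + 1) * (2 * n) := by
  have := i.isLt
  have := Nat.min_le_left (i : ℕ) (2 * n - 1 - j)
  rw [heightOrder, add_mul, one_mul]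
  omega

theorem heightOrder_lt_of_lt {i j a b : Fin (2 * n)} (hij : i < j)
    (h : (j : ℕ) - i < (b : ℕ) - a) : heightOrder n i j < heightOrder n a b := by
  refine (heightOrder_lt hij).trans_le ?_
  rw [heightOrder]
  exact (Nat.mul_le_mul_right _ h).trans (Nat.le_add_right _ _)

theorem heightOrder_lt_sq {i j : Fin (2 * n)} (hij : i < j) :
    heightOrder n i j < 4 * n ^ 2 := by
  refine (heightOrder_lt hij).trans_le ?_
  have h : (j : ℕ) - i + 1 ≤ 2 * n := by
    have := j.isLt
    have : (i : ℕ) < j := hij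
    omega
  calc _ ≤ (2 * n) * (2 * n) := Nat.mul_le_mul_right _ h
    _ = _ := by ring

theorem heightOrder_symm (i j : Fin (2 * n)) : heightOrder n j.rev i.rev = heightOrder n i j := by
  have := i.isLt
  have := j.isLt
  have hheight : ((i.rev : ℕ) - j.rev) = (j : ℕ) - i := by rw [Fin.val_rev, Fin.val_rev]; omega
  have hmin : min (j.rev : ℕ) (2 * n - 1 - i.rev) = min (i : ℕ) (2 * n - 1 - j) := by
    rw [Fin.val_rev, Fin.val_rev]; omega
  rw [heightOrder, hheight, hmin, heightOrder]

theorem heightOrder_inj {i j a b : Fin (2 * n)} (hij : i < j) (hab : a < b)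
    (h : heightOrder n a b = heightOrder n i j) :
    (a = i ∧ b = j) ∨ (a = j.rev ∧ b = i.rev) := by
  have hheight : (b : ℕ) - a = (j : ℕ) - i := by
    rcases lt_trichotomy ((b : ℕ) - a) ((j : ℕ) - i) with hlt | heq | hgt
    · exact absurd h (heightOrder_lt_of_lt hab hlt).ne
    · exact heq
    · exact absurd h (heightOrder_lt_of_lt hij hgt).ne'
  rw [heightOrder, heightOrder, hheight, Nat.add_left_cancel_iff] at h
  have : (i : ℕ) < j := hij
  have : (a : ℕ) < b := hab
  have := j.isLt
  have := b.isLt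
  simp only [Fin.ext_iff, Fin.val_rev]
  omega

variable (n) in
theorem isRootOrder_heightOrder : IsRootOrder n (heightOrder n) where
  lt_left := fun {i j k} hij hjk => heightOrder_lt_of_lt hij (by
    have : (i : ℕ) < j := hij
    have : (j : ℕ) < k := hjk
    omega)
  lt_right := fun {i j k} hij hjk => heightOrder_lt_of_lt hjk (by
    have : (i : ℕ) < j := hij
    have : (j : ℕ) < k := hjk
    omega)
  symm := heightOrder_symm
  inj := heightOrder_inj

theorem subgroupU_eq_rootFiltration :
    subgroupU n R = rootFiltration R (isRootOrder_heightOrder n) (2 * n + 1) := by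
  ext g
  refine and_congr_right fun _ => ⟨fun h a b hab hr => ?_, fun h a b hab hb => ?_⟩
  · have hab' : (a : ℕ) < b := hab
    have hheight : (b : ℕ) - a = 1 := by
      by_contra hne
      have := Nat.mul_le_mul_right (2 * n) (show 2 ≤ (b : ℕ) - a by omega)
      have := a.isLt
      rw [heightOrder] at hr
      omega
    rw [heightOrder, hheight] at hr
    exact h a b (by omega) (by omega)
  · have hab' : (a : ℕ) < b := by omega
    refine h a b hab' ?_
    have hheight : (b : ℕ) - a = 1 := by omega
    rw [heightOrder, hheight]
    omega

variable (n) in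
/-- A numbering of the positive roots for which those in the unipotent radical of the first maximal
parabolic subgroup come last. -/
def radicalOrder (i j : Fin (2 * n)) : ℕ :=
  heightOrder n i j + if (i : ℕ) = 0 ∨ (j : ℕ) + 1 = 2 * n then 4 * n ^ 2 else 0

theorem radicalOrder_lt_iff {i j : Fin (2 * n)} (hij : i < j) :
    radicalOrder n i j < 4 * n ^ 2 ↔ ¬ ((i : ℕ) = 0 ∨ (j : ℕ) + 1 = 2 * n) := by
  have := heightOrder_lt_sq hij
  unfold radicalOrder
  split_ifs with h
  · simp [h]
  · simpa [h] using this

variable (n) in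
theorem isRootOrder_radicalOrder : IsRootOrder n (radicalOrder n) where
  lt_left := fun {i j k} hij hjk => by
    have := (isRootOrder_heightOrder n).lt_left hij hjk
    have : (i : ℕ) < j := hij
    have : (j : ℕ) < k := hjk
    have := k.isLt
    unfold radicalOrder
    split_ifs <;> omega
  lt_right := fun {i j k} hij hjk => by
    have := (isRootOrder_heightOrder n).lt_right hij hjk
    have : (i : ℕ) < j := hij
    have : (j : ℕ) < k := hjk
    have := k.isLt
    unfold radicalOrder
    split_ifs <;> omega
  symm := fun i j => by
    have hi := i.isLt
    have hj := j.isLt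
    have : ((j.rev : ℕ) = 0 ∨ (i.rev : ℕ) + 1 = 2 * n) ↔ ((i : ℕ) = 0 ∨ (j : ℕ) + 1 = 2 * n) := by
      rw [Fin.val_rev, Fin.val_rev]; omega
    simp only [radicalOrder, heightOrder_symm, this]
  inj := fun {i j a b} hij hab h => by
    have := heightOrder_lt_sq hij
    have := heightOrder_lt_sq hab
    refine heightOrder_inj hij hab ?_
    unfold radicalOrder at h
    split_ifs at h <;> omega

theorem parabolicRadical_one_eq_rootFiltration :
    parabolicRadical n R 1 = rootFiltration R (isRootOrder_radicalOrder n) (4 * n ^ 2) := by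
  ext g
  constructor
  · refine fun hg => ⟨fun a b hab => hg a b ?_, fun a b hab hr => ?_⟩
    · have hab : (b : ℕ) ≤ a := hab
      have := a.isLt
      dsimp only
      split_ifs <;> omega
    · rw [radicalOrder_lt_iff hab, not_or] at hr
      have := hg a b (by
        have := b.isLt
        dsimp only
        split_ifs <;> omega)
      rwa [Matrix.one_apply_ne hab.ne] at this
  · refine fun hg a b hab => ?_
    rcases le_or_gt b a with hba | hba
    · exact hg.1 a b hba
    · rw [Matrix.one_apply_ne hba.ne]
      refine hg.2 a b hba ((radicalOrder_lt_iff hba).2 ?_)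
      have : (a : ℕ) < b := hba
      have := a.isLt
      have := b.isLt
      dsimp only at hab
      split_ifs at hab <;> omega

end RootOrders

section Towers

variable {n : ℕ} {F : Type*} [Field F] [NumberField F]

/-- `H'` is an extension of `H` by the one-parameter group `x`, which is defined over `F` and is
centralised by `S` modulo the subgroup `H` normalised by `S`. -/
structure IsCentralStep (S H H' : Subgroup (Sp n (Adele F)))
    (x : AddChar (Adele F) (Sp n (Adele F))) : Prop where
  continuous : Continuous x
  algebraMap_mem : ∀ ξ : F, x (algebraMap F (Adele F) ξ) ∈ rationalPoints n F
  le : H ≤ H'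
  apply_mem : ∀ a, x a ∈ H'
  exists_eq_mul : ∀ u ∈ H', ∃ c ∈ H, ∃ a, u = c * x a
  comm_mem : ∀ s ∈ S, ∀ a, (s * x a) * (x a * s)⁻¹ ∈ H
  conj_mem : ∀ s ∈ S, ∀ c ∈ H, s * c * s⁻¹ ∈ H

/-- Subgroups of `Sp_{2n}(𝔸)` which are obtained from the trivial group by successive central
extensions, relative to `S`, by one-parameter groups defined over `F`. -/
inductive CentralTower (S : Subgroup (Sp n (Adele F))) : Subgroup (Sp n (Adele F)) → Prop
  | bot : CentralTower S ⊥
  | step {H H' : Subgroup (Sp n (Adele F))} {x : AddChar (Adele F) (Sp n (Adele F))}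
      (hx : IsCentralStep S H H' x) (hH : CentralTower S H) : CentralTower S H'

variable {S : Subgroup (Sp n (Adele F))} {ρ : Fin (2 * n) → Fin (2 * n) → ℕ}

theorem isCentralStep_rootHom (hS : S ≤ subgroupN n (Adele F)) (hρ : IsRootOrder n ρ)
    {i j : Fin (2 * n)} (hij : i < j) :
    IsCentralStep S (rootFiltration (Adele F) hρ (ρ i j + 1)) (rootFiltration (Adele F) hρ (ρ i j))
      (rootHom hij.ne) where
  continuous := continuous_rootHom hij.ne
  algebraMap_mem ξ := ⟨rootHom hij.ne ξ, map_rootHom _ hij.ne ξ⟩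
  le := rootFiltration_anti hρ (Nat.le_succ _)
  apply_mem := rootHom_mem hρ hij
  exists_eq_mul u hu := ⟨_, mul_rootHom_inv_mem hρ hij hu, u.entry i j, by group⟩
  comm_mem s hs a := comm_mem_rootFiltration hρ (hS hs) (rootHom_mem hρ hij a)
  conj_mem s hs _ hc := conj_mem_rootFiltration hρ (hS hs) hc

theorem centralTower_rootFiltration (hS : S ≤ subgroupN n (Adele F)) (hρ : IsRootOrder n ρ)
    (r : ℕ) : CentralTower S (rootFiltration (Adele F) hρ r) := by
  obtain ⟨M, hM⟩ : ∃ M, ∀ i j, ρ i j < M := by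
    obtain ⟨M, hM⟩ := (Set.finite_range fun p : Fin (2 * n) × Fin (2 * n) => ρ p.1 p.2).bddAbove
    exact ⟨M + 1, fun i j => Nat.lt_succ_of_le (hM ⟨(i, j), rfl⟩)⟩
  have hbot : ∀ s, M ≤ s → CentralTower S (rootFiltration (Adele F) hρ s) := fun s hs => by
    rw [rootFiltration_eq_bot hρ fun i j _ => (hM i j).trans_le hs]
    exact .bot
  rcases le_or_gt M r with hr | hr
  · exact hbot r hr
  · refine Nat.decreasingInduction (motive := fun r _ => CentralTower S
      (rootFiltration (Adele F) hρ r)) (fun r _ ih => ?_) (hbot M le_rfl) hr.le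
    by_cases h : ∃ i j, i < j ∧ ρ i j = r
    · obtain ⟨i, j, hij, rfl⟩ := h
      exact .step (isCentralStep_rootHom hS hρ hij) ih
    · push Not at h
      rwa [← rootFiltration_succ_of_forall_ne hρ h]

theorem centralTower_subgroupN (hS : S ≤ subgroupN n (Adele F)) :
    CentralTower S (subgroupN n (Adele F)) := by
  rw [← rootFiltration_zero (isRootOrder_heightOrder n)]
  exact centralTower_rootFiltration hS _ _

theorem centralTower_subgroupU (hS : S ≤ subgroupN n (Adele F)) :
    CentralTower S (subgroupU n (Adele F)) := by
  rw [subgroupU_eq_rootFiltration]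
  exact centralTower_rootFiltration hS _ _

theorem centralTower_parabolicRadical_one (hS : S ≤ subgroupN n (Adele F)) :
    CentralTower S (parabolicRadical n (Adele F) 1) := by
  rw [parabolicRadical_one_eq_rootFiltration]
  exact centralTower_rootFiltration hS _ _

variable (n F)

theorem subgroupU_le_subgroupN : subgroupU n (Adele F) ≤ subgroupN n (Adele F) := fun _ h => h.1

theorem parabolicRadical_one_le_subgroupN :
    parabolicRadical n (Adele F) 1 ≤ subgroupN n (Adele F) := by
  rw [parabolicRadical_one_eq_rootFiltration]
  exact rootFiltration_le _ _

end Towers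

section Quotients

open NumberField

variable {n : ℕ} {F : Type*} [Field F] [NumberField F]

theorem continuous_entry {R : Type*} [CommRing R] [TopologicalSpace R] (i j : Fin (2 * n)) :
    Continuous fun g : Sp n R => g.entry i j :=
  (Units.continuous_val.comp continuous_subtype_val).matrix_elem i j

theorem mem_rationalPoints_iff (g : Sp n (Adele F)) : g ∈ rationalPoints n F ↔
    ∀ i j, g.entry i j ∈ AdeleRing.principalSubgroup (𝓞 F) F ∧
      (g⁻¹).entry i j ∈ AdeleRing.principalSubgroup (𝓞 F) F := by
  constructor
  · rintro ⟨γ, rfl⟩ i j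
    rw [← map_inv, Sp.entry_map, Sp.entry_map]
    exact ⟨Set.mem_range_self _, Set.mem_range_self _⟩
  · intro h
    choose M hM using fun i j => (h i j).1
    choose M' hM' using fun i j => (h i j).2
    have hinj : Function.Injective
        (fun A : Matrix (Fin (2 * n)) (Fin (2 * n)) F => A.map (algebraMap F (Adele F))) :=
      Matrix.map_injective (AdeleRing.algebraMap_injective (𝓞 F) F)
    have hval : (Matrix.of M).map (algebraMap F (Adele F)) = (g : GL (Fin (2 * n)) (Adele F)).val :=
      Matrix.ext hM
    have hinv : (Matrix.of M').map (algebraMap F (Adele F)) =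
        ((g⁻¹ : Sp n (Adele F)) : GL (Fin (2 * n)) (Adele F)).val := Matrix.ext hM'
    refine ⟨⟨⟨Matrix.of M, Matrix.of M', hinj ?_, hinj ?_⟩, hinj ?_⟩, Sp.ext_entry hM⟩
    · change (_ * _ : Matrix _ _ _).map _ = (1 : Matrix _ _ _).map _
      rw [Matrix.map_mul, hval, hinv, Matrix.map_one _ (map_zero _) (map_one _)]
      exact (g : GL (Fin (2 * n)) (Adele F)).mul_inv
    · change (_ * _ : Matrix _ _ _).map _ = (1 : Matrix _ _ _).map _
      rw [Matrix.map_mul, hval, hinv, Matrix.map_one _ (map_zero _) (map_one _)]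
      exact (g : GL (Fin (2 * n)) (Adele F)).inv_mul
    · change ((Matrix.of M)ᵀ * formJ n F * (Matrix.of M)).map _ = (formJ n F).map _
      rw [Matrix.map_mul, Matrix.map_mul, Matrix.transpose_map, hval, formJ_map]
      exact g.2

theorem isClosed_rationalPoints : IsClosed (rationalPoints n F : Set (Sp n (Adele F))) := by
  have h : (rationalPoints n F : Set (Sp n (Adele F))) = ⋂ i, ⋂ j,
      {g | g.entry i j ∈ AdeleRing.principalSubgroup (𝓞 F) F} ∩
      {g | (g⁻¹).entry i j ∈ AdeleRing.principalSubgroup (𝓞 F) F} := by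
    ext g
    simp only [SetLike.mem_coe, mem_rationalPoints_iff, Set.mem_iInter, Set.mem_inter_iff,
      Set.mem_ofPred_eq]
  rw [h]
  refine isClosed_iInter fun i => isClosed_iInter fun j => IsClosed.inter ?_ ?_
  · exact isClosed_principalSubgroup.preimage (continuous_entry i j)
  · exact isClosed_principalSubgroup.preimage ((continuous_entry i j).comp continuous_inv)

variable {H : Subgroup (Sp n (Adele F))}

/-- The class of an element of `H` in `(H ∩ Sp_{2n}(F)) \ H`. -/
def AdelicQuotient.mk (u : H) : AdelicQuotient H := Quotient.mk _ u

theorem AdelicQuotient.mk_eq_mk {u v : H} :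
    AdelicQuotient.mk u = AdelicQuotient.mk v ↔
      ((v * u⁻¹ : H) : Sp n (Adele F)) ∈ rationalPoints n F :=
  Quotient.eq.trans QuotientGroup.rightRel_apply

theorem AdelicQuotient.mk_rep (q : AdelicQuotient H) : AdelicQuotient.mk q.rep = q :=
  Quotient.out_eq q

theorem AdelicQuotient.isOpenQuotientMap_mk : IsOpenQuotientMap (AdelicQuotient.mk (H := H)) where
  surjective := Quotient.mk_surjective
  continuous := continuous_quotient_mk'
  isOpenMap :=
    have : ContinuousConstSMul ((rationalPoints n F).subgroupOf H) H :=
      ⟨fun γ => continuous_const_mul (γ : H)⟩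
    isOpenMap_quotient_mk'_mul

theorem AdelicQuotient.rightTranslate_mk (h u : H) :
    AdelicQuotient.rightTranslate h (AdelicQuotient.mk u) = AdelicQuotient.mk (u * h) := rfl

theorem AdelicQuotient.continuous_rightTranslate (h : H) :
    Continuous (AdelicQuotient.rightTranslate h) :=
  AdelicQuotient.isOpenQuotientMap_mk.isQuotientMap.continuous_iff.2
    (AdelicQuotient.isOpenQuotientMap_mk.continuous.comp (continuous_mul_const h))

instance : T2Space (AdelicQuotient H) := by
  rw [t2Space_iff_of_isOpenQuotientMap AdelicQuotient.isOpenQuotientMap_mk]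
  simp only [AdelicQuotient.mk_eq_mk]
  exact isClosed_rationalPoints.preimage (by fun_prop :
    Continuous fun q : H × H => ((q.2 * q.1⁻¹ : H) : Sp n (Adele F)))

theorem CentralTower.exists_isCompact {S : Subgroup (Sp n (Adele F))} (hT : CentralTower S H)
    (hS : H ≤ S) : ∃ C : Set (Sp n (Adele F)), IsCompact C ∧ C ⊆ H ∧
      ∀ u ∈ H, ∃ γ ∈ rationalPoints n F, γ ∈ H ∧ ∃ c ∈ C, u = γ * c := by
  induction hT with
  | bot =>
    refine ⟨{1}, isCompact_singleton, by simp,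
      fun u hu => ⟨1, one_mem _, one_mem _, 1, rfl, ?_⟩⟩
    rw [Subgroup.mem_bot.1 hu, mul_one]
  | @step H H' x hx _ ih =>
    obtain ⟨C, hC, hCH, h⟩ := ih (hx.le.trans hS)
    obtain ⟨D, hD, hD'⟩ := exists_isCompact_eq_algebraMap_add (F := F)
    have hxc := hx.continuous
    refine ⟨(fun z : Sp n (Adele F) × Adele F => z.1 * x z.2) '' (C ×ˢ D),
      (hC.prod hD).image (by fun_prop), ?_, fun u hu => ?_⟩
    · rintro _ ⟨z, ⟨hz, -⟩, rfl⟩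
      exact mul_mem (hx.le (hCH hz)) (hx.apply_mem _)
    · obtain ⟨c, hc, a, rfl⟩ := hx.exists_eq_mul u hu
      obtain ⟨ξ, d, hd, rfl⟩ := hD' a
      set y := x (algebraMap F (Adele F) ξ) with hy
      have hyH : y ∈ H' := hx.apply_mem _
      obtain ⟨γ, hγ, hγH, c', hc', hγc⟩ := h (y⁻¹ * c * y)
        (by simpa using hx.conj_mem y⁻¹ (inv_mem (hS hyH)) c hc)
      refine ⟨y * γ, mul_mem (hx.algebraMap_mem ξ) hγ, mul_mem hyH (hx.le hγH), c' * x d,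
        ⟨(c', d), ⟨hc', hd⟩, rfl⟩, ?_⟩
      rw [show y * γ * (c' * x d) = y * (γ * c') * x d by group, ← hγc, x.map_add_eq_mul, ← hy]
      group

theorem CentralTower.compactSpace {S : Subgroup (Sp n (Adele F))} (hT : CentralTower S H)
    (hS : H ≤ S) : CompactSpace (AdelicQuotient H) := by
  obtain ⟨C, hC, hCH, h⟩ := hT.exists_isCompact hS
  have hC' : IsCompact ((↑) ⁻¹' C : Set H) :=
    Topology.IsInducing.subtypeVal.isCompact_preimage' hC (by simpa using hCH)
  refine ⟨(hC'.image AdelicQuotient.isOpenQuotientMap_mk.continuous).of_isClosed_subset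
    isClosed_univ fun q _ => ?_⟩
  obtain ⟨γ, hγ, -, c, hc, hγc⟩ := h q.rep q.rep.2
  refine ⟨⟨c, hCH hc⟩, hc, ?_⟩
  rw [← q.mk_rep, AdelicQuotient.mk_eq_mk]
  change (q.rep : Sp n (Adele F)) * c⁻¹ ∈ _
  rwa [hγc, mul_inv_cancel_right]

instance : CompactSpace (AdelicQuotient (subgroupU n (Adele F))) :=
  (centralTower_subgroupU (subgroupU_le_subgroupN n F)).compactSpace le_rfl

instance : CompactSpace (AdelicQuotient (subgroupN n (Adele F))) :=
  (centralTower_subgroupN le_rfl).compactSpace le_rfl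

instance : CompactSpace (AdelicQuotient (parabolicRadical n (Adele F) 1)) :=
  (centralTower_parabolicRadical_one (parabolicRadical_one_le_subgroupN n F)).compactSpace le_rfl

end Quotients

/-! ### Averages over unipotent groups -/

section Averages

variable {n : ℕ} {F : Type*} [Field F] [NumberField F]
  {S H H' K : Subgroup (Sp n (Adele F))} {V : Type*}

/-- Invariance of a function on `S` under left translation by `S ∩ H`. -/
def IsLeftInvariant (H : Subgroup (Sp n (Adele F))) (h : S → V) : Prop :=
  ∀ u : S, (u : Sp n (Adele F)) ∈ H → ∀ s, h (u * s) = h s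

theorem IsLeftInvariant.apply_mul_comm {h : S → V} (hinv : IsLeftInvariant H h) {x y : S}
    (hcomm : (((x * y) * (y * x)⁻¹ : S) : Sp n (Adele F)) ∈ H) (m : S) :
    h (x * (y * m)) = h (y * (x * m)) := by
  rw [← hinv _ hcomm (y * (x * m))]
  congr 1
  group

/-- Continuous functions on a subgroup `S` of `Sp_{2n}(𝔸)` which are left invariant under the
rational points of `S`. -/
structure IsAutomorphic [TopologicalSpace V] (h : S → V) : Prop where
  continuous : Continuous h
  left_inv : IsLeftInvariant (rationalPoints n F) h

theorem isAutomorphic_comp_mk [TopologicalSpace V] {f : AdelicQuotient S → V} (hf : Continuous f) :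
    IsAutomorphic fun s : S => f (AdelicQuotient.mk s) where
  continuous := hf.comp AdelicQuotient.isOpenQuotientMap_mk.continuous
  left_inv γ hγ s := by
    have hmk : AdelicQuotient.mk (γ * s) = AdelicQuotient.mk s := by
      rw [AdelicQuotient.mk_eq_mk, mul_inv_rev, mul_inv_cancel_left]
      exact inv_mem hγ
    dsimp only
    rw [hmk]

theorem continuous_inclusion (hK : K ≤ S) : Continuous (Subgroup.inclusion hK) :=
  continuous_subtype_val.subtype_mk _

theorem IsLeftInvariant.apply_rep {h : S → V} (hh : IsLeftInvariant (rationalPoints n F) h)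
    (hK : K ≤ S) (k : K) (s : S) :
    h (Subgroup.inclusion hK (AdelicQuotient.mk k).rep * s) = h (Subgroup.inclusion hK k * s) := by
  have hmk := (AdelicQuotient.mk k).mk_rep.symm
  rw [AdelicQuotient.mk_eq_mk] at hmk
  rw [← hh (Subgroup.inclusion hK ((AdelicQuotient.mk k).rep * k⁻¹)) hmk
    (Subgroup.inclusion hK k * s), ← mul_assoc, ← map_mul, inv_mul_cancel_right]

theorem IsAutomorphic.continuous_rep [TopologicalSpace V] {h : S → V} (hh : IsAutomorphic h)
    (hK : K ≤ S) (s : S) :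
    Continuous fun q : AdelicQuotient K => h (Subgroup.inclusion hK q.rep * s) := by
  refine AdelicQuotient.isOpenQuotientMap_mk.isQuotientMap.continuous_iff.2 ?_
  simp only [Function.comp_def, hh.left_inv.apply_rep hK]
  exact hh.continuous.comp ((continuous_inclusion hK).mul continuous_const)

theorem adeleClass_out (a : Adele F) :
    ∃ ξ : F, (a : AdeleClass F).out = algebraMap F (Adele F) ξ + a := by
  obtain ⟨ξ, hξ⟩ := QuotientAddGroup.eq.1 (QuotientAddGroup.out_eq' (a : AdeleClass F)).symm
  exact ⟨ξ, by rw [hξ]; abel⟩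

/-- The one-parameter group of a central step inside `S`, as a homomorphism to `S`. -/
def IsCentralStep.lift {x : AddChar (Adele F) (Sp n (Adele F))} (hx : IsCentralStep S H H' x)
    (hS : H' ≤ S) : AddChar (Adele F) S where
  toFun a := ⟨x a, hS (hx.apply_mem a)⟩
  map_zero_eq_one' := Subtype.ext x.map_zero_eq_one
  map_add_eq_mul' a b := Subtype.ext (x.map_add_eq_mul a b)

variable {x : AddChar (Adele F) (Sp n (Adele F))} (hx : IsCentralStep S H H' x) (hS : H' ≤ S)
  {h : S → V}

theorem IsCentralStep.continuous_lift : Continuous (hx.lift hS) :=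
  hx.continuous.subtype_mk _

theorem IsCentralStep.apply_out (hh : IsLeftInvariant (rationalPoints n F) h) (a : Adele F)
    (s : S) : h (hx.lift hS (a : AdeleClass F).out * s) = h (hx.lift hS a * s) := by
  obtain ⟨ξ, hξ⟩ := adeleClass_out a
  rw [hξ, AddChar.map_add_eq_mul, mul_assoc, hh _ (hx.algebraMap_mem ξ)]

theorem IsCentralStep.apply_lift_mul (hinv : IsLeftInvariant H h) (s : S) (a : Adele F) (m : S) :
    h (hx.lift hS a * (s * m)) = h (s * (hx.lift hS a * m)) :=
  (hinv.apply_mul_comm (x := s) (y := hx.lift hS a) (hx.comm_mem s s.2 a) m).symm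

theorem IsCentralStep.continuous_out [TopologicalSpace V] (hh : IsAutomorphic h) :
    Continuous fun z : S × AdeleClass F => h (hx.lift hS z.2.out * z.1) := by
  refine (IsOpenQuotientMap.id.prodMap
    QuotientAddGroup.isOpenQuotientMap_mk).isQuotientMap.continuous_iff.2 ?_
  simp only [Function.comp_def, Prod.map_snd, Prod.map_fst, hx.apply_out hS hh.left_inv, id]
  exact hh.continuous.comp
    (((hx.continuous_lift hS).comp continuous_snd).mul continuous_fst)

theorem IsCentralStep.continuous_out_mul [TopologicalSpace V] (hh : IsAutomorphic h) (s : S) :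
    Continuous fun t : AdeleClass F => h (hx.lift hS t.out * s) :=
  Continuous.comp (f := Prod.mk s) (hx.continuous_out hS hh) (.prodMk_right s)

theorem IsCentralStep.continuous_out_rep [TopologicalSpace V] (hh : IsAutomorphic h)
    (hinv : IsLeftInvariant H h) (hK : K ≤ S) (s : S) :
    Continuous (Function.uncurry fun (q : AdelicQuotient K) (t : AdeleClass F) =>
      h (hx.lift hS t.out * (Subgroup.inclusion hK q.rep * s))) := by
  refine (AdelicQuotient.isOpenQuotientMap_mk.prodMap
    QuotientAddGroup.isOpenQuotientMap_mk).isQuotientMap.continuous_iff.2 ?_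
  have heq (z : K × Adele F) : h (hx.lift hS (z.2 : AdeleClass F).out *
      (Subgroup.inclusion hK (AdelicQuotient.mk z.1).rep * s)) =
        h (hx.lift hS z.2 * (Subgroup.inclusion hK z.1 * s)) := by
    rw [hx.apply_lift_mul hS hinv, hh.left_inv.apply_rep hK, ← hx.apply_lift_mul hS hinv,
      hx.apply_out hS hh.left_inv]
  simp only [Function.comp_def, Function.uncurry_def, Prod.map_snd, Prod.map_fst, heq]
  exact hh.continuous.comp (((hx.continuous_lift hS).comp continuous_snd).mul
    (((continuous_inclusion hK).comp continuous_fst).mul continuous_const))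

variable [NormedAddCommGroup V]

theorem IsAutomorphic.integrable_rep (hh : IsAutomorphic h) (hK : K ≤ S)
    [CompactSpace (AdelicQuotient K)] (μ : Measure (AdelicQuotient K)) [IsFiniteMeasure μ] (s : S) :
    Integrable (fun q : AdelicQuotient K => h (Subgroup.inclusion hK q.rep * s)) μ :=
  (hh.continuous_rep hK s).integrable_of_hasCompactSupport
    (HasCompactSupport.of_compactSpace _)

theorem IsCentralStep.integrable_out (hh : IsAutomorphic h) (s : S) :
    Integrable (fun t : AdeleClass F => h (hx.lift hS t.out * s)) (adeleClassMeasure F) :=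
  (hx.continuous_out_mul hS hh s).integrable_of_hasCompactSupport
    (HasCompactSupport.of_compactSpace _)

variable [NormedSpace ℝ V]

/-- The average of a function on `S` over the left translates by `K ≤ S`. It is only meaningful for
functions invariant under the rational points of `K`, as it refers to representatives. -/
def average (hK : K ≤ S) (μ : Measure (AdelicQuotient K)) (h : S → V) (s : S) : V :=
  ∫ q : AdelicQuotient K, h (Subgroup.inclusion hK q.rep * s) ∂μ

theorem IsAutomorphic.average_inclusion_mul [SecondCountableTopology V] (hh : IsAutomorphic h)
    (hK : K ≤ S) {μ : Measure (AdelicQuotient K)} (hμ : IsInvariantProbability μ) (y : K) (s : S) :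
    average hK μ h (Subgroup.inclusion hK y * s) = average hK μ h s := by
  have hmap := integral_map (μ := μ) (AdelicQuotient.continuous_rightTranslate y).aemeasurable
    (hh.continuous_rep hK s).aestronglyMeasurable
  rw [hμ.map_rightTranslate] at hmap
  rw [average, average, hmap]
  congr 1 with q
  have htrans : AdelicQuotient.rightTranslate y q = AdelicQuotient.mk (q.rep * y) := by
    conv_lhs => rw [← q.mk_rep]
    rfl
  rw [htrans, hh.left_inv.apply_rep, map_mul, mul_assoc]

/-- The average of a function on `S` over left translates by a one-parameter group, subject to the
same caveat as `average`. -/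
def oneParamAverage (y : AddChar (Adele F) S) (h : S → V) (s : S) : V :=
  ∫ t : AdeleClass F, h (y t.out * s) ∂adeleClassMeasure F

theorem IsCentralStep.continuous_oneParamAverage (hh : IsAutomorphic h) :
    Continuous (oneParamAverage (hx.lift hS) h) := by
  rw [← continuousOn_univ]
  refine continuousOn_integral_of_compact_support (k := Set.univ) isCompact_univ ?_
    (fun _ _ _ h => absurd (Set.mem_univ _) h)
  exact (hx.continuous_out hS hh).continuousOn

theorem IsCentralStep.oneParamAverage_lift_mul (hh : IsLeftInvariant (rationalPoints n F) h)
    (a : Adele F) (s : S) :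
    oneParamAverage (hx.lift hS) h (hx.lift hS a * s) = oneParamAverage (hx.lift hS) h s := by
  rw [oneParamAverage, oneParamAverage, ← integral_add_right_eq_self (μ := adeleClassMeasure F)
    (fun t : AdeleClass F => h (hx.lift hS t.out * s)) (a : AdeleClass F)]
  congr 1 with t
  obtain ⟨b, rfl⟩ := QuotientAddGroup.mk_surjective t
  rw [← QuotientAddGroup.mk_add, hx.apply_out hS hh, hx.apply_out hS hh, AddChar.map_add_eq_mul,
    mul_assoc]

theorem IsCentralStep.isLeftInvariant_oneParamAverage
    (hh : IsLeftInvariant (rationalPoints n F) h) (hinv : IsLeftInvariant H h) :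
    IsLeftInvariant H' (oneParamAverage (hx.lift hS) h) := by
  intro u hu s
  obtain ⟨c, hc, a, hca⟩ := hx.exists_eq_mul u hu
  have hu' : u = ⟨c, hS (hx.le hc)⟩ * hx.lift hS a := Subtype.ext hca
  rw [hu', mul_assoc, ← hx.oneParamAverage_lift_mul hS hh a s]
  refine integral_congr_ae (ae_of_all _ fun t => ?_)
  dsimp only
  rw [hx.apply_lift_mul hS hinv, hinv _ hc]

theorem IsCentralStep.isAutomorphic_oneParamAverage (hh : IsAutomorphic h)
    (hinv : IsLeftInvariant H h) : IsAutomorphic (oneParamAverage (hx.lift hS) h) where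
  continuous := hx.continuous_oneParamAverage hS hh
  left_inv γ hγ s := by
    refine integral_congr_ae (ae_of_all _ fun t => ?_)
    dsimp only
    rw [hx.apply_lift_mul hS hinv, hh.left_inv γ hγ]

theorem IsCentralStep.average_oneParamAverage [SecondCountableTopology V] [CompleteSpace V]
    (hh : IsAutomorphic h) (hinv : IsLeftInvariant H h) (hK : K ≤ S) (hK' : H' ≤ K)
    [CompactSpace (AdelicQuotient K)] {μ : Measure (AdelicQuotient K)}
    (hμ : IsInvariantProbability μ) (s : S) :
    average hK μ (oneParamAverage (hx.lift hS) h) s = average hK μ h s := by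
  have := hμ.isProbabilityMeasure
  have hinner (t : AdeleClass F) :
      ∫ q, h (hx.lift hS t.out * (Subgroup.inclusion hK q.rep * s)) ∂μ = average hK μ h s := by
    rw [← hh.average_inclusion_mul hK hμ ⟨x t.out, hK' (hx.apply_mem _)⟩ s]
    refine integral_congr_ae (ae_of_all _ fun q => ?_)
    dsimp only
    rw [hx.apply_lift_mul hS hinv]
    rfl
  simp only [average, oneParamAverage]
  rw [integral_integral_swap_of_hasCompactSupport (hx.continuous_out_rep hS hh hinv hK s)
    (HasCompactSupport.of_compactSpace _)]
  simp_rw [hinner]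
  rw [integral_const, probReal_univ, one_smul, average]

end Averages

section AverageOperators

variable {n : ℕ} {F : Type*} [Field F] [NumberField F] {S H H' K : Subgroup (Sp n (Adele F))}

/-- Operators on functions on `S` which behave like averaging over the subgroup `H` of `S`; they
serve to construct the invariant measure, and to compare averages over different subgroups. -/
structure IsAverage (S H : Subgroup (Sp n (Adele F))) {V : Type*} [NormedAddCommGroup V]
    [NormedSpace ℝ V] (E : (S → V) → (S → V)) : Prop where
  isAutomorphic : ∀ {h}, IsAutomorphic h → IsAutomorphic (E h)
  isLeftInvariant : ∀ {h}, IsAutomorphic h → IsLeftInvariant H (E h)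
  average_eq : ∀ {h}, IsAutomorphic h → ∀ {K : Subgroup (Sp n (Adele F))}, H ≤ K →
    ∀ (hK : K ≤ S) [CompactSpace (AdelicQuotient K)] {μ : Measure (AdelicQuotient K)},
      IsInvariantProbability μ → ∀ s, average hK μ (E h) s = average hK μ h s
  add : ∀ {h k}, IsAutomorphic h → IsAutomorphic k → E (h + k) = E h + E k
  smul : ∀ (c : ℝ) h, E (c • h) = c • E h
  mem_of_convex : ∀ {h}, IsAutomorphic h → ∀ {C : Set V}, Convex ℝ C → IsClosed C →
    (∀ s, h s ∈ C) → ∀ s, E h s ∈ C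
  translate : ∀ h m, E (fun s => h (s * m)) = fun s => E h (s * m)

variable {V : Type*} [NormedAddCommGroup V] [NormedSpace ℝ V]

theorem isAverage_id : IsAverage S ⊥ (id : (S → V) → (S → V)) where
  isAutomorphic hh := hh
  isLeftInvariant _ u hu s := by
    rw [show u = 1 from Subtype.ext (Subgroup.mem_bot.1 hu), one_mul]
  average_eq _ _ _ _ _ _ _ _ := rfl
  add _ _ := rfl
  smul _ _ := rfl
  mem_of_convex _ _ _ _ hC := hC
  translate _ _ := rfl

variable [CompleteSpace V] [SecondCountableTopology V] {E : (S → V) → (S → V)}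

theorem IsAverage.oneParam (hE : IsAverage S H E) {x : AddChar (Adele F) (Sp n (Adele F))}
    (hx : IsCentralStep S H H' x) (hS : H' ≤ S) :
    IsAverage S H' fun h => oneParamAverage (hx.lift hS) (E h) where
  isAutomorphic hh :=
    hx.isAutomorphic_oneParamAverage hS (hE.isAutomorphic hh) (hE.isLeftInvariant hh)
  isLeftInvariant hh :=
    hx.isLeftInvariant_oneParamAverage hS (hE.isAutomorphic hh).left_inv (hE.isLeftInvariant hh)
  average_eq hh K hK hKS _ μ hμ s := by
    rw [hx.average_oneParamAverage hS (hE.isAutomorphic hh) (hE.isLeftInvariant hh) hKS hK hμ,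
      hE.average_eq hh (hx.le.trans hK) hKS hμ]
  add {h k} hh hk := by
    funext s
    rw [hE.add hh hk]
    exact integral_add (hx.integrable_out hS (hE.isAutomorphic hh) s)
      (hx.integrable_out hS (hE.isAutomorphic hk) s)
  smul c h := by
    funext s
    rw [hE.smul]
    exact integral_smul c _
  mem_of_convex hh _ hC hC' hmem s :=
    hC.integral_mem hC' (ae_of_all _ fun _ => hE.mem_of_convex hh hC hC' hmem _)
      (hx.integrable_out hS (hE.isAutomorphic hh) s)
  translate h m := by
    funext s
    rw [hE.translate]
    simp only [oneParamAverage, mul_assoc]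

theorem CentralTower.exists_isAverage (hT : CentralTower S H) (hS : H ≤ S) (V : Type*)
    [NormedAddCommGroup V] [NormedSpace ℝ V] [CompleteSpace V] [SecondCountableTopology V] :
    ∃ E : (S → V) → (S → V), IsAverage S H E := by
  induction hT with
  | bot => exact ⟨id, isAverage_id⟩
  | step hx _ ih =>
    obtain ⟨E, hE⟩ := ih (hx.le.trans hS)
    exact ⟨_, hE.oneParam hx hS⟩

omit [SecondCountableTopology V] in
theorem IsAverage.eq_average (hE : IsAverage S H E) (hS : H ≤ S) [CompactSpace (AdelicQuotient H)]
    {μ : Measure (AdelicQuotient H)} (hμ : IsInvariantProbability μ) {h : S → V}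
    (hh : IsAutomorphic h) : E h = average hS μ h := by
  have := hμ.isProbabilityMeasure
  funext s
  have hconst (q : AdelicQuotient H) : E h (Subgroup.inclusion hS q.rep * s) = E h s :=
    hE.isLeftInvariant hh _ q.rep.2 s
  rw [← hE.average_eq hh le_rfl hS hμ, average]
  simp_rw [hconst]
  rw [integral_const, probReal_univ, one_smul]

/-- Right translation on `(H ∩ Sp_{2n}(F)) \ H` as a homeomorphism. -/
def AdelicQuotient.rightTranslateHomeomorph (m : H) : AdelicQuotient H ≃ₜ AdelicQuotient H where
  toFun := AdelicQuotient.rightTranslate m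
  invFun := AdelicQuotient.rightTranslate m⁻¹
  left_inv q := by
    rw [← q.mk_rep, AdelicQuotient.rightTranslate_mk, AdelicQuotient.rightTranslate_mk,
      mul_inv_cancel_right]
  right_inv q := by
    rw [← q.mk_rep, AdelicQuotient.rightTranslate_mk, AdelicQuotient.rightTranslate_mk,
      inv_mul_cancel_right]
  continuous_toFun := AdelicQuotient.continuous_rightTranslate m
  continuous_invFun := AdelicQuotient.continuous_rightTranslate m⁻¹

/-- The positive functional on functions on `(H ∩ Sp_{2n}(F)) \ H` given by an averaging
operator. -/
def IsAverage.functional {E : (H → ℝ) → (H → ℝ)} (hE : IsAverage H H E) :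
    CompactlySupportedContinuousMap (AdelicQuotient H) ℝ →ₚ[ℝ] ℝ := PositiveLinearMap.mk₀
  { toFun := fun f => E (fun s => f (AdelicQuotient.mk s)) 1
    map_add' := fun f g => congrFun
      (hE.add (isAutomorphic_comp_mk f.continuous) (isAutomorphic_comp_mk g.continuous)) 1
    map_smul' := fun c _ => congrFun (hE.smul c _) 1 }
  (fun f hf => hE.mem_of_convex (isAutomorphic_comp_mk f.continuous) (convex_Ici 0) isClosed_Ici
    (fun _ => hf _) 1)

theorem IsAverage.integral_rieszMeasure [CompactSpace (AdelicQuotient H)] {E : (H → ℝ) → (H → ℝ)}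
    (hE : IsAverage H H E) {f : AdelicQuotient H → ℝ} (hf : Continuous f) :
    ∫ q, f q ∂(RealRMK.rieszMeasure hE.functional) = E (fun s => f (AdelicQuotient.mk s)) 1 :=
  RealRMK.integral_rieszMeasure hE.functional ⟨⟨f, hf⟩, HasCompactSupport.of_compactSpace _⟩

theorem IsAverage.isInvariantProbability [CompactSpace (AdelicQuotient H)] {E : (H → ℝ) → (H → ℝ)}
    (hE : IsAverage H H E) : IsInvariantProbability (RealRMK.rieszMeasure hE.functional) := by
  refine ⟨⟨?_⟩, fun m => ?_⟩
  · have hconst : E (fun _ => 1) 1 = 1 := hE.mem_of_convex (C := {(1 : ℝ)})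
      (isAutomorphic_comp_mk (f := fun _ => 1) continuous_const) (convex_singleton 1)
      isClosed_singleton (fun _ => rfl) 1
    have hone := hE.integral_rieszMeasure (f := fun _ => 1) continuous_const
    rwa [hconst, integral_const, smul_eq_mul, mul_one, Measure.real,
      ENNReal.toReal_eq_one_iff] at hone
  · have : ((RealRMK.rieszMeasure hE.functional).map (AdelicQuotient.rightTranslate m)).Regular :=
      Measure.Regular.map (AdelicQuotient.rightTranslateHomeomorph m)
    refine Measure.ext_of_integral_eq_on_compactlySupported fun f => ?_
    have hm := AdelicQuotient.continuous_rightTranslate m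
    have hf : Continuous (f : AdelicQuotient H → ℝ) := f.continuous
    rw [integral_map hm.aemeasurable hf.aestronglyMeasurable, hE.integral_rieszMeasure hf,
      hE.integral_rieszMeasure (f := fun q => f (AdelicQuotient.rightTranslate m q)) (hf.comp hm)]
    simp only [AdelicQuotient.rightTranslate_mk]
    rw [hE.translate fun s => f (AdelicQuotient.mk s)]
    dsimp only
    rw [one_mul, ← mul_one m, hE.isLeftInvariant (isAutomorphic_comp_mk hf) m m.2]

theorem CentralTower.exists_isInvariantProbability (hT : CentralTower H H) :
    ∃ μ : Measure (AdelicQuotient H), IsInvariantProbability μ := by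
  have := hT.compactSpace le_rfl
  obtain ⟨E, hE⟩ := hT.exists_isAverage le_rfl ℝ
  exact ⟨_, hE.isInvariantProbability⟩

section Comparison

variable [CompactSpace (AdelicQuotient H)] [CompactSpace (AdelicQuotient K)]
  {μ : Measure (AdelicQuotient H)} {h : S → V}

theorem CentralTower.isAutomorphic_average (hT : CentralTower S H) (hS : H ≤ S)
    (hμ : IsInvariantProbability μ) (hh : IsAutomorphic h) : IsAutomorphic (average hS μ h) := by
  obtain ⟨E, hE⟩ := hT.exists_isAverage hS V
  exact hE.eq_average hS hμ hh ▸ hE.isAutomorphic hh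

theorem CentralTower.average_average (hT : CentralTower S H) (hS : H ≤ S)
    (hμ : IsInvariantProbability μ) (hh : IsAutomorphic h) (hHK : H ≤ K) (hK : K ≤ S)
    {ν : Measure (AdelicQuotient K)} (hν : IsInvariantProbability ν) :
    average hK ν (average hS μ h) = average hK ν h := by
  obtain ⟨E, hE⟩ := hT.exists_isAverage hS V
  rw [← hE.eq_average hS hμ hh]
  exact funext (hE.average_eq hh hHK hK hν)

theorem CentralTower.average_eq_oneParamAverage (hT : CentralTower S H)
    {x : AddChar (Adele F) (Sp n (Adele F))} (hx : IsCentralStep S H K x)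
    (hμ : IsInvariantProbability μ) (hh : IsAutomorphic h) (hK : K ≤ S)
    {ν : Measure (AdelicQuotient K)} (hν : IsInvariantProbability ν) :
    average hK ν h = oneParamAverage (hx.lift hK) (average (hx.le.trans hK) μ h) := by
  obtain ⟨E, hE⟩ := hT.exists_isAverage (hx.le.trans hK) V
  rw [← hE.eq_average _ hμ hh]
  exact ((hE.oneParam hx hK).eq_average hK hν hh).symm

end Comparison

end AverageOperators

/-! ### Smoothness along root subgroups -/

section Differences

theorem fwdDiff_iter_congr {M M' G : Type*} [AddCommMonoid M] [AddCommMonoid M']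
    [AddCommGroup G] {f : M → G} {f' : M' → G} {a x : M} {a' x' : M'} {k : ℕ}
    (h : ∀ j ≤ k, f (x + j • a) = f' (x' + j • a')) :
    (fwdDiff a)^[k] f x = (fwdDiff a')^[k] f' x' := by
  rw [fwdDiff_iter_eq_sum_shift, fwdDiff_iter_eq_sum_shift]
  exact Finset.sum_congr rfl fun j hj => by rw [h j (Finset.mem_range_succ_iff.1 hj)]

theorem norm_fwdDiff_iter_le {M G : Type*} [AddCommMonoid M] [SeminormedAddCommGroup G]
    {f : M → G} {B : ℝ} (hB : ∀ x, ‖f x‖ ≤ B) (a : M) (k : ℕ) (x : M) :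
    ‖(fwdDiff a)^[k] f x‖ ≤ 2 ^ k * B := by
  induction k generalizing x with
  | zero => simpa using hB x
  | succ k ih =>
    rw [Function.iterate_succ_apply', fwdDiff, pow_succ]
    linarith [norm_sub_le ((fwdDiff a)^[k] f (x + a)) ((fwdDiff a)^[k] f x), ih x, ih (x + a)]

theorem fwdDiff_iter_integral {X M G : Type*} [MeasurableSpace X] {μ : Measure X}
    [AddCommMonoid M] [NormedAddCommGroup G] [NormedSpace ℝ G] {f : X → M → G}
    (hf : ∀ t, Integrable (fun q => f q t) μ) (a : M) (k : ℕ) (x : M) :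
    (fwdDiff a)^[k] (fun t => ∫ q, f q t ∂μ) x = ∫ q, (fwdDiff a)^[k] (f q) x ∂μ := by
  simp only [fwdDiff_iter_eq_sum_shift, ← Int.cast_smul_eq_zsmul ℝ]
  rw [integral_finsetSum]
  · simp only [integral_smul]
  · exact fun j _ => (hf _).smul _

variable {E G : Type*} [NormedAddCommGroup E] [NormedSpace ℝ E] [NormedAddCommGroup G]
  [NormedSpace ℝ G]

theorem norm_iteratedFDeriv_fwdDiff_le {f : E → G} {k : ℕ} {C : ℝ} (hf : ContDiff ℝ (k + 1) f)
    (hC : ∀ x, ‖iteratedFDeriv ℝ (k + 1) f x‖ ≤ C) (a x : E) :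
    ‖iteratedFDeriv ℝ k (fwdDiff a f) x‖ ≤ C * ‖a‖ := by
  have hk : ContDiff ℝ k f := hf.of_le (by exact_mod_cast k.le_succ)
  have hshift : ContDiff ℝ k fun z => f (z + a) := hk.comp (contDiff_id.add contDiff_const)
  have hdiff : Differentiable ℝ (iteratedFDeriv ℝ k f) :=
    hf.differentiable_iteratedFDeriv (by exact_mod_cast k.lt_succ_self)
  have : iteratedFDeriv ℝ k (fwdDiff a f) x =
      iteratedFDeriv ℝ k f (x + a) - iteratedFDeriv ℝ k f x := by
    rw [← iteratedFDeriv_comp_add_right]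
    exact iteratedFDeriv_sub_apply hshift.contDiffAt hk.contDiffAt
  rw [this]
  simpa using convex_univ.norm_image_sub_le_of_norm_fderiv_le (fun z _ => hdiff z)
    (fun z _ => norm_fderiv_iteratedFDeriv.trans_le (hC z)) (Set.mem_univ x)
    (Set.mem_univ (x + a))

theorem norm_fwdDiff_iter_le_of_norm_iteratedFDeriv_le {f : E → G} {k : ℕ} {C : ℝ}
    (hf : ContDiff ℝ k f) (hC : ∀ x, ‖iteratedFDeriv ℝ k f x‖ ≤ C) (a x : E) :
    ‖(fwdDiff a)^[k] f x‖ ≤ C * ‖a‖ ^ k := by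
  induction k generalizing f C with
  | zero => simpa using hC x
  | succ k ih =>
    rw [Function.iterate_succ_apply, pow_succ', ← mul_assoc]
    have hk : ContDiff ℝ k f := hf.of_le (by exact_mod_cast k.le_succ)
    exact ih ((hk.comp (contDiff_id.add contDiff_const)).sub hk)
      (norm_iteratedFDeriv_fwdDiff_le (by exact_mod_cast hf) hC a)

theorem exists_contDiff_eventuallyEq [FiniteDimensional ℝ E] {f : E → G} {x : E} {k : ℕ}
    (hf : ContDiffAt ℝ k f x) :
    ∃ f' : E → G, ContDiff ℝ k f' ∧ HasCompactSupport f' ∧ f' =ᶠ[𝓝 x] f := by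
  obtain ⟨r, hr, hball⟩ := Metric.eventually_nhds_iff_ball.1 (hf.eventually (by simp))
  let b : ContDiffBump x := ⟨r / 3, r / 2, by positivity, by linarith⟩
  refine ⟨fun z => b z • f z, contDiff_iff_contDiffAt.2 fun z => ?_,
    b.hasCompactSupport.smul_right, ?_⟩
  · by_cases hz : z ∈ tsupport b
    · rw [b.tsupport_eq] at hz
      exact b.contDiffAt.smul (hball z (Metric.closedBall_subset_ball (half_lt_self hr) hz))
    · refine contDiffAt_const (c := 0) |>.congr_of_eventuallyEq ?_
      filter_upwards [notMem_tsupport_iff_eventuallyEq.1 hz] with w hw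
      rw [hw, Pi.zero_apply, zero_smul]
  · filter_upwards [b.eventuallyEq_one] with z hz
    rw [hz, Pi.one_apply, one_smul]

/-- Smooth cutoff reduces the local bound to the global one. -/
theorem exists_eventuallyEq_norm_fwdDiff_iter_le [FiniteDimensional ℝ E] {f : E → G} {x : E}
    {k : ℕ} (hf : ContDiffAt ℝ k f x) :
    ∃ f' : E → G, f' =ᶠ[𝓝 x] f ∧ ∃ C, ∀ a z, ‖(fwdDiff a)^[k] f' z‖ ≤ C * ‖a‖ ^ k := by
  obtain ⟨f', hf', hsupp, heq⟩ := exists_contDiff_eventuallyEq hf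
  obtain ⟨C, hC⟩ := (hf'.continuous_iteratedFDeriv le_rfl).bounded_above_of_compact_support
    (hsupp.iteratedFDeriv k)
  exact ⟨f', heq, C, norm_fwdDiff_iter_le_of_norm_iteratedFDeriv_le hf' hC⟩

end Differences

section Smoothness

open IsDedekindDomain HeightOneSpectrum NumberField mixedEmbedding

variable {n : ℕ} {F : Type*} [Field F] [NumberField F]

/-- The component of an adele at an archimedean place, as a complex number. -/
def archEval (v : InfinitePlace F) : Adele F →+* ℂ :=
  (InfinitePlace.Completion.extensionEmbedding v).comp
    ((Pi.evalRingHom (fun v : InfinitePlace F => v.Completion) v).comp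
      (RingHom.fst (InfiniteAdeleRing F) (FiniteAdeleRing (𝓞 F) F)))

theorem continuous_archEval (v : InfinitePlace F) : Continuous (archEval (F := F) v) :=
  (InfinitePlace.Completion.isometry_extensionEmbedding v).continuous.comp
    (continuous_adele_infinite v)

theorem archCoord_apply (g : Sp n (Adele F)) (i j : Fin (2 * n)) (v : InfinitePlace F) :
    archCoord g i j v = archEval v (g.entry i j) := rfl

theorem continuous_archCoord : Continuous (archCoord (n := n) (F := F)) :=
  continuous_pi fun i => continuous_pi fun j => continuous_pi fun v =>
    (continuous_archEval v).comp (continuous_entry i j)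

theorem continuous_of_isSmooth {φ : Sp n (Adele F) → ℂ} (hφ : IsSmooth φ) : Continuous φ := by
  refine continuous_iff_continuousAt.2 fun g => ?_
  obtain ⟨Φ, hΦ, h⟩ := hφ g
  exact (hΦ.continuousAt.comp continuous_archCoord.continuousAt).congr_of_eventuallyEq h

theorem archEval_finiteAdele (v : InfinitePlace F) (y : FiniteAdeleRing (𝓞 F) F) :
    archEval v (finiteAdele y) = 0 := map_zero (InfinitePlace.Completion.extensionEmbedding v)

open scoped Classical in
theorem exists_norm_archEval_archAdele_le :
    ∃ C, ∀ h : mixedSpace F, ‖fun v => archEval v (archAdele h)‖ ≤ C * ‖h‖ :=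
  ⟨_, (ContinuousLinearMap.pi fun v : InfinitePlace F =>
    ((archEval v).toAddMonoidHom.comp archAdele).toRealLinearMap
      ((continuous_archEval v).comp continuous_archAdele)).le_opNorm⟩

variable {i₀ j₀ : Fin (2 * n)} (hij : i₀ ≠ j₀)

/-- The derivative in `t` of the matrix `s x(t) g`, where `x` is the root subgroup attached to
`(i₀, j₀)`. -/
def rootVelocity (i₀ j₀ : Fin (2 * n)) (g s : Sp n (Adele F)) :
    Matrix (Fin (2 * n)) (Fin (2 * n)) (Adele F) :=
  (s : GL (Fin (2 * n)) (Adele F)).val * rootMatrix (Adele F) i₀ j₀ *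
    (g : GL (Fin (2 * n)) (Adele F)).val

theorem entry_mul_rootHom_mul (s : Sp n (Adele F)) (t : Adele F) (g : Sp n (Adele F))
    (i j : Fin (2 * n)) :
    (s * rootHom hij t * g).entry i j = (s * g).entry i j + t * rootVelocity i₀ j₀ g s i j := by
  change ((s : GL (Fin (2 * n)) (Adele F)).val * (1 + t • rootMatrix (Adele F) i₀ j₀) *
    (g : GL (Fin (2 * n)) (Adele F)).val) i j = _
  rw [mul_add, mul_one, add_mul, Matrix.mul_smul, Matrix.smul_mul]
  rfl

theorem continuous_rootVelocity (g : Sp n (Adele F)) (i j : Fin (2 * n)) :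
    Continuous fun s => rootVelocity i₀ j₀ g s i j :=
  (((Units.continuous_val.comp continuous_subtype_val).matrix_mul
    continuous_const).matrix_mul continuous_const).matrix_elem i j

theorem archCoord_mul_finiteAdele (s g : Sp n (Adele F)) (y : FiniteAdeleRing (𝓞 F) F) :
    archCoord (s * rootHom hij (finiteAdele y) * g) = archCoord (s * g) := by
  funext i j v
  rw [archCoord_apply, entry_mul_rootHom_mul, map_add, map_mul, archEval_finiteAdele, zero_mul,
    add_zero, archCoord_apply]

/-- The displacement of the archimedean coordinates of `s g` when it is replaced by `s x(h) g`,
where `x` is the root subgroup attached to `(i₀, j₀)` and `h` is an archimedean adele. -/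
def archShift (i₀ j₀ : Fin (2 * n)) (g s : Sp n (Adele F)) (h : mixedSpace F) :
    Fin (2 * n) → Fin (2 * n) → InfinitePlace F → ℂ :=
  fun i j v => archEval v (archAdele h) * archEval v (rootVelocity i₀ j₀ g s i j)

theorem archCoord_mul_archAdele (s g : Sp n (Adele F)) (h : mixedSpace F) (k : ℕ) :
    archCoord (s * rootHom hij (archAdele (k • h)) * g) =
      archCoord (s * g) + k • archShift i₀ j₀ g s h := by
  funext a b v
  rw [archCoord_apply, entry_mul_rootHom_mul, map_add, map_mul, map_nsmul, map_nsmul]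
  simp only [Pi.add_apply, Pi.smul_apply, archShift, archCoord_apply, smul_mul_assoc]

open scoped Classical in
theorem exists_eventually_norm_archShift_le (i₀ j₀ : Fin (2 * n)) (g s₀ : Sp n (Adele F)) :
    ∃ C, ∀ᶠ s in 𝓝 s₀, ∀ h, ‖archShift i₀ j₀ g s h‖ ≤ C * ‖h‖ := by
  obtain ⟨c, hc⟩ := exists_norm_archEval_archAdele_le (F := F)
  let m (s : Sp n (Adele F)) (i j : Fin (2 * n)) (v : InfinitePlace F) : ℂ :=
    archEval v (rootVelocity i₀ j₀ g s i j)
  have hm : Continuous m := continuous_pi fun i => continuous_pi fun j => continuous_pi fun v =>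
    (continuous_archEval v).comp (continuous_rootVelocity g i j)
  refine ⟨|c| * (‖m s₀‖ + 1), ?_⟩
  filter_upwards [hm.norm.continuousAt.eventually_lt continuousAt_const (lt_add_one ‖m s₀‖)]
    with s hs h
  rw [mul_right_comm]
  refine (pi_norm_le_iff_of_nonneg (by positivity)).2 fun i =>
    (pi_norm_le_iff_of_nonneg (by positivity)).2 fun j => ?_
  refine (norm_mul_le (fun v => archEval v (archAdele h)) (m s i j)).trans ?_
  gcongr
  · exact (hc h).trans (by gcongr; exact le_abs_self c)
  · exact ((norm_le_pi_norm _ j).trans (norm_le_pi_norm _ i)).trans hs.le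

theorem tendsto_mul_rootHom_mul {X : Type*} [TopologicalSpace X] {f : X → Adele F} {x₀ : X}
    (hf : Tendsto f (𝓝 x₀) (𝓝 0)) (s₀ g : Sp n (Adele F)) :
    Tendsto (fun p : Sp n (Adele F) × X => p.1 * rootHom hij (f p.2) * g) (𝓝 (s₀, x₀))
      (𝓝 (s₀ * g)) := by
  have hx : Tendsto (fun p : Sp n (Adele F) × X => rootHom hij (f p.2)) (𝓝 (s₀, x₀)) (𝓝 1) := by
    rw [← (rootHom hij).map_zero_eq_one]
    exact ((continuous_rootHom hij).tendsto 0).comp (hf.comp (continuous_snd.tendsto (s₀, x₀)))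
  simpa only [mul_one] using ((continuous_fst.tendsto (s₀, x₀)).mul hx).mul_const g

theorem eventually_apply_mul_finiteAdele_mul {φ : Sp n (Adele F) → ℂ} (hφ : IsSmooth φ)
    (s₀ g : Sp n (Adele F)) :
    ∀ᶠ p : Sp n (Adele F) × FiniteAdeleRing (𝓞 F) F in 𝓝 (s₀, 0),
      φ (p.1 * rootHom hij (finiteAdele p.2) * g) = φ (p.1 * g) := by
  obtain ⟨Φ, -, h⟩ := hφ (s₀ * g)
  have hmoved := tendsto_mul_rootHom_mul hij (continuous_finiteAdele.tendsto' 0 0 (map_zero _)) s₀ g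
  have hfixed : Tendsto (fun p : Sp n (Adele F) × FiniteAdeleRing (𝓞 F) F => p.1 * g)
      (𝓝 (s₀, 0)) (𝓝 (s₀ * g)) := (continuous_fst.mul_const g).tendsto (s₀, 0)
  filter_upwards [hmoved.eventually h, hfixed.eventually h] with p hp_moved hp_fixed
  rw [hp_moved, hp_fixed, archCoord_mul_finiteAdele]

open scoped Classical in
theorem exists_eventually_norm_fwdDiff_iter_le {φ : Sp n (Adele F) → ℂ} (hφ : IsSmooth φ)
    (k : ℕ) (s₀ g : Sp n (Adele F)) :
    ∃ C, ∀ᶠ p : Sp n (Adele F) × mixedSpace F in 𝓝 (s₀, 0),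
      ‖(fwdDiff (archAdele p.2))^[k] (fun t => φ (p.1 * rootHom hij t * g)) 0‖ ≤
        C * ‖p.2‖ ^ k := by
  obtain ⟨Φ, hΦ, h⟩ := hφ (s₀ * g)
  obtain ⟨Φ', hΦ', C, hC⟩ :=
    exists_eventuallyEq_norm_fwdDiff_iter_le (hΦ.of_le (by exact_mod_cast le_top : (k : ℕ∞ω) ≤ ∞))
  obtain ⟨c, hc⟩ := exists_eventually_norm_archShift_le i₀ j₀ g s₀
  have hφΦ' : ∀ᶠ x in 𝓝 (s₀ * g), φ x = Φ' (archCoord x) := by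
    filter_upwards [h, (continuous_archCoord.tendsto (s₀ * g)).eventually hΦ'] with x hx hx'
    rw [hx, hx']
  have hshift : ∀ᶠ p : Sp n (Adele F) × mixedSpace F in 𝓝 (s₀, 0), ∀ j ∈ Finset.range (k + 1),
      φ (p.1 * rootHom hij (archAdele (j • p.2)) * g) =
        Φ' (archCoord (p.1 * rootHom hij (archAdele (j • p.2)) * g)) :=
    (Finset.eventually_all _).2 fun j _ => (tendsto_mul_rootHom_mul hij
      ((continuous_archAdele.comp (continuous_const_smul j)).tendsto' 0 0 (by simp))
      s₀ g).eventually hφΦ'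
  refine ⟨|C| * |c| ^ k, ?_⟩
  filter_upwards [hshift, (continuous_fst.tendsto (s₀, (0 : mixedSpace F))).eventually hc]
    with ⟨s, h⟩ hs hcs
  have hdiff : (fwdDiff (archAdele h))^[k] (fun t => φ (s * rootHom hij t * g)) 0 =
      (fwdDiff (archShift i₀ j₀ g s h))^[k] Φ' (archCoord (s * g)) :=
    fwdDiff_iter_congr fun j hj => by
      rw [zero_add, ← map_nsmul, hs j (Finset.mem_range_succ_iff.2 hj), archCoord_mul_archAdele]
  rw [hdiff, mul_assoc, ← mul_pow]
  refine (hC _ _).trans ?_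
  gcongr
  · exact le_abs_self C
  · exact (hcs h).trans (by gcongr; exact le_abs_self c)

end Smoothness

section UniformSmoothness

open IsDedekindDomain HeightOneSpectrum NumberField mixedEmbedding

theorem exists_eventually_forall_le_mul {X Y : Type*} [TopologicalSpace X] [TopologicalSpace Y]
    {f : X → Y → ℝ} {w : Y → ℝ} {C : Set X} {y₀ : Y} (hC : IsCompact C) (hw : ∀ y, 0 ≤ w y)
    (h : ∀ x ∈ C, ∃ B, ∀ᶠ p : X × Y in 𝓝 (x, y₀), f p.1 p.2 ≤ B * w p.2) :
    ∃ B, ∀ᶠ y in 𝓝 y₀, ∀ x ∈ C, f x y ≤ B * w y := by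
  refine hC.induction_on (p := fun A => ∃ B, ∀ᶠ y in 𝓝 y₀, ∀ x ∈ A, f x y ≤ B * w y)
    ⟨0, by simp⟩ ?_ ?_ ?_
  · rintro A A' hA ⟨B, hB⟩
    exact ⟨B, hB.mono fun y hy x hx => hy x (hA hx)⟩
  · rintro A A' ⟨B, hB⟩ ⟨B', hB'⟩
    refine ⟨max B B', (hB.and hB').mono fun y hy x hx => ?_⟩
    rw [max_mul_of_nonneg _ _ (hw y)]
    exact hx.elim (fun hx => le_max_of_le_left (hy.1 x hx)) fun hx =>
      le_max_of_le_right (hy.2 x hx)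
  · intro x hx
    obtain ⟨B, hB⟩ := h x hx
    rw [nhds_prod_eq] at hB
    obtain ⟨px, hpx, py, hpy, hxy⟩ := eventually_prod_iff.1 hB
    exact ⟨{x | px x}, mem_nhdsWithin_of_mem_nhds hpx, B,
      hpy.mono fun y hy x hx => hxy hx hy⟩

variable {n : ℕ} {F : Type*} [Field F] [NumberField F] {φ : Sp n (Adele F) → ℂ}
  {i₀ j₀ : Fin (2 * n)} (hij : i₀ ≠ j₀)

theorem exists_isCompact_forall_apply_mul_eq (hinv : ∀ γ ∈ rationalPoints n F, ∀ g,
    φ (γ * g) = φ g) :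
    ∃ C, IsCompact C ∧ ∀ s ∈ subgroupN n (Adele F), ∃ c ∈ C, ∀ g, φ (s * g) = φ (c * g) := by
  obtain ⟨C, hC, -, h⟩ := (centralTower_subgroupN (n := n) (F := F) le_rfl).exists_isCompact le_rfl
  refine ⟨C, hC, fun s hs => ?_⟩
  obtain ⟨γ, hγ, -, c, hc, rfl⟩ := h s hs
  exact ⟨c, hc, fun g => by rw [mul_assoc, hinv γ hγ]⟩

theorem exists_forall_apply_mul_finiteAdele_mul (hinv : ∀ γ ∈ rationalPoints n F, ∀ g,
    φ (γ * g) = φ g) (hφ : IsSmooth φ) (g : Sp n (Adele F)) :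
    ∃ N : ℕ, N ≠ 0 ∧ ∀ s ∈ subgroupN n (Adele F), ∀ y ∈ integralFiniteAdeles (𝓞 F) F,
      φ (s * rootHom hij (finiteAdele (N • y)) * g) = φ (s * g) := by
  obtain ⟨C, hC, hCN⟩ := exists_isCompact_forall_apply_mul_eq hinv
  obtain ⟨N, hN, hinvN⟩ := exists_nsmul_mem_of_mem_nhds_zero
    (hC.eventually_forall_of_forall_eventually (x₀ := (0 : FiniteAdeleRing (𝓞 F) F))
      (P := fun y s => φ (s * rootHom hij (finiteAdele y) * g) = φ (s * g)) fun s₀ _ =>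
        (continuous_swap.tendsto (0, s₀)).eventually
          (eventually_apply_mul_finiteAdele_mul hij hφ s₀ g))
  refine ⟨N, hN, fun s hs y hy => ?_⟩
  obtain ⟨c, hc, hsc⟩ := hCN s hs
  rw [mul_assoc, hsc, hsc, ← mul_assoc]
  exact hinvN y hy c hc

theorem exists_forall_norm_apply_mul_le (hinv : ∀ γ ∈ rationalPoints n F, ∀ g,
    φ (γ * g) = φ g) (hφ : Continuous φ) (g : Sp n (Adele F)) :
    ∃ M, ∀ s ∈ subgroupN n (Adele F), ‖φ (s * g)‖ ≤ M := by
  obtain ⟨C, hC, hCN⟩ := exists_isCompact_forall_apply_mul_eq hinv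
  obtain ⟨M, hM⟩ := hC.exists_bound_of_continuousOn
    (hφ.comp (continuous_mul_const g)).continuousOn
  refine ⟨M, fun s hs => ?_⟩
  obtain ⟨c, hc, hsc⟩ := hCN s hs
  rw [hsc]
  exact hM c hc

open scoped Classical in
theorem exists_forall_norm_fwdDiff_iter_le (hij : i₀ < j₀) (hinv : ∀ γ ∈ rationalPoints n F,
    ∀ g, φ (γ * g) = φ g) (hφ : IsSmooth φ) (k : ℕ) (g : Sp n (Adele F)) :
    ∃ B, ∀ h : mixedSpace F, ∀ s ∈ subgroupN n (Adele F),
      ‖(fwdDiff (archAdele h))^[k] (fun t => φ (s * rootHom hij.ne t * g)) 0‖ ≤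
        B * ‖h‖ ^ k := by
  obtain ⟨C, hC, hCN⟩ := exists_isCompact_forall_apply_mul_eq hinv
  obtain ⟨B, hB⟩ := exists_eventually_forall_le_mul (w := fun h => ‖h‖ ^ k)
    (f := fun s h => ‖(fwdDiff (archAdele h))^[k] (fun t => φ (s * rootHom hij.ne t * g)) 0‖)
    hC (fun h => by positivity) fun s₀ _ => exists_eventually_norm_fwdDiff_iter_le hij.ne hφ k s₀ g
  obtain ⟨M, hM⟩ := exists_forall_norm_apply_mul_le hinv (continuous_of_isSmooth hφ) g
  obtain ⟨δ, hδ, hnear⟩ := Metric.eventually_nhds_iff.1 hB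
  refine ⟨max B (2 ^ k * M / δ ^ k), fun h s hs => ?_⟩
  rw [max_mul_of_nonneg _ _ (by positivity)]
  rcases lt_or_ge ‖h‖ δ with hh | hh
  · obtain ⟨c, hc, hsc⟩ := hCN s hs
    simp only [mul_assoc s, hsc]
    simpa only [mul_assoc] using
      le_max_of_le_left (hnear (y := h) (by rwa [dist_zero_right]) c hc)
  · have hM0 : 0 ≤ M := (norm_nonneg _).trans (hM s hs)
    refine le_max_of_le_right ((norm_fwdDiff_iter_le (fun t => hM _ (mul_mem hs
      (rootFiltration_le _ _ (rootHom_mem (isRootOrder_heightOrder n) hij t)))) _ k 0).trans ?_)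
    rw [div_mul_comm, ← div_pow]
    exact le_mul_of_one_le_left (by positivity) (one_le_pow₀ ((one_le_div hδ).2 hh))

end UniformSmoothness

/-! ### Generic characters of the unipotent group -/

section Alpha

variable {n : ℕ} {R : Type*} [CommRing R]

theorem alpha_inv (t : Rˣ) : (alpha n t)⁻¹ = alpha n t⁻¹ :=
  Sp.ext_entry fun _ _ => rfl

theorem entry_alpha_inv_mul_mul_alpha (t : Rˣ) (s : Sp n R) (i j : Fin (2 * n)) :
    ((alpha n t)⁻¹ * s * alpha n t).entry i j =
      alphaDiag n t⁻¹ i * s.entry i j * alphaDiag n t j := by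
  change (Matrix.diagonal (alphaDiag n t⁻¹) * (s : GL (Fin (2 * n)) R).val *
    Matrix.diagonal (alphaDiag n t)) i j = _
  rw [Matrix.mul_diagonal, Matrix.diagonal_mul]
  rfl

theorem alpha_inv_mul_mul_alpha_mem (t : Rˣ) {s : Sp n R} (hs : s ∈ subgroupN n R) :
    (alpha n t)⁻¹ * s * alpha n t ∈ subgroupN n R := by
  intro i j hij
  rw [entry_alpha_inv_mul_mul_alpha, hs i j hij]
  rcases eq_or_ne i j with rfl | hne
  · rw [Matrix.one_apply_eq, mul_one]
    simp only [alphaDiag]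
    split_ifs <;> simp
  · rw [Matrix.one_apply_ne hne, mul_zero, zero_mul]

/-- Conjugation by `α(t)⁻¹` as an endomorphism of `N`. -/
def alphaConj (t : Rˣ) : subgroupN n R →* subgroupN n R where
  toFun s := ⟨(alpha n t)⁻¹ * s * alpha n t, alpha_inv_mul_mul_alpha_mem t s.2⟩
  map_one' := Subtype.ext (by simp)
  map_mul' s s' := Subtype.ext (by simp only [Subgroup.coe_mul]; group)

theorem coe_alphaConj (t : Rˣ) (s : subgroupN n R) :
    (alphaConj t s : Sp n R) = (alpha n t)⁻¹ * s * alpha n t := rfl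

theorem alphaConj_surjective (t : Rˣ) : Function.Surjective (alphaConj (n := n) t) := fun s =>
  ⟨alphaConj t⁻¹ s, Subtype.ext (by simp only [coe_alphaConj, ← alpha_inv]; group)⟩

theorem map_alpha {R' : Type*} [CommRing R'] (f : R →+* R') (t : Rˣ) :
    Sp.map f (alpha n t) = alpha n (Units.map f.toMonoidHom t) := by
  refine Sp.ext_entry fun i j => ?_
  rw [Sp.entry_map]
  change f (Matrix.diagonal (alphaDiag n t) i j) = Matrix.diagonal (alphaDiag n _) i j
  rcases eq_or_ne i j with rfl | hne
  · rw [Matrix.diagonal_apply_eq, Matrix.diagonal_apply_eq]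
    simp only [alphaDiag]
    split_ifs
    exacts [rfl, rfl, map_one f]
  · rw [Matrix.diagonal_apply_ne _ hne, Matrix.diagonal_apply_ne _ hne, map_zero]

end Alpha

section Characters

variable {n : ℕ} {F : Type*} [Field F] [NumberField F]

/-- The diagonal embedding of `Fˣ` in the group of ideles. -/
abbrev principalIdele : Fˣ →* (Adele F)ˣ :=
  Units.map (algebraMap F (Adele F)).toMonoidHom

theorem alpha_mem_rationalPoints (ξ : Fˣ) : alpha n (principalIdele ξ) ∈ rationalPoints n F :=
  ⟨alpha n ξ, map_alpha _ ξ⟩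

/-- The linear form `ξ u₁₂ + u₂₃ + ⋯ + u_{n,n+1}` (numbered from `1`) on `N`. -/
def simpleRootSum (ξ : F) (s : Sp n (Adele F)) : Adele F :=
  ∑ i : Fin n, algebraMap F (Adele F) (if (i : ℕ) = 0 then ξ else 1) *
    s.entry ⟨i, by omega⟩ ⟨i + 1, by omega⟩

theorem psiN_eq (ψ : AddChar (Adele F) ℂ) (s : Sp n (Adele F)) :
    psiN ψ s = ψ (simpleRootSum 1 s) := by
  simp [psiN, simpleRootSum]

theorem continuous_simpleRootSum (ξ : F) : Continuous (simpleRootSum (n := n) ξ) :=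
  continuous_finsetSum _ fun _ _ => continuous_const.mul (continuous_entry _ _)

theorem simpleRootSum_mul (ξ : F) {s t : Sp n (Adele F)} (hs : s ∈ subgroupN n (Adele F))
    (ht : t ∈ subgroupN n (Adele F)) :
    simpleRootSum ξ (s * t) = simpleRootSum ξ s + simpleRootSum ξ t := by
  rw [simpleRootSum, simpleRootSum, simpleRootSum, ← Finset.sum_add_distrib]
  refine Finset.sum_congr rfl fun i _ => ?_
  rw [entry_mul_of_succ hs ht rfl, mul_add]

theorem exists_simpleRootSum_eq_algebraMap (ξ : F) {γ : Sp n (Adele F)}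
    (hγ : γ ∈ rationalPoints n F) : ∃ η : F, simpleRootSum ξ γ = algebraMap F (Adele F) η := by
  obtain ⟨γ, rfl⟩ := hγ
  refine ⟨∑ i : Fin n, (if (i : ℕ) = 0 then ξ else 1) *
    γ.entry ⟨i, by omega⟩ ⟨i + 1, by omega⟩, ?_⟩
  rw [map_sum, simpleRootSum]
  refine Finset.sum_congr rfl fun i _ => ?_
  rw [map_mul, Sp.entry_map]

theorem simpleRootSum_zero_eq_zero {s : Sp n (Adele F)}
    (hs : ∀ i j : Fin (2 * n), 0 < (i : ℕ) → (i : ℕ) < n → (j : ℕ) = i + 1 → s.entry i j = 0) :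
    simpleRootSum 0 s = 0 := by
  refine Finset.sum_eq_zero fun i _ => ?_
  rcases Nat.eq_zero_or_pos i with hi | hi
  · rw [if_pos hi, map_zero, zero_mul]
  · rw [hs _ _ hi i.isLt rfl, mul_zero]

theorem simpleRootSum_zero_radical {r : Sp n (Adele F)}
    (hr : r ∈ parabolicRadical n (Adele F) 1) : simpleRootSum 0 r = 0 := by
  refine simpleRootSum_zero_eq_zero fun i j hi hin hij => ?_
  rw [hr i j (by dsimp only; split_ifs <;> omega), Matrix.one_apply_ne (by rintro rfl; omega)]

variable (hn : 2 ≤ n)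

theorem simpleRootSum_eq_add (ξ : F) (s : Sp n (Adele F)) : simpleRootSum ξ s =
    simpleRootSum 0 s + algebraMap F (Adele F) ξ * s.entry ⟨0, by omega⟩ ⟨1, by omega⟩ := by
  have hsingle : algebraMap F (Adele F) ξ * s.entry ⟨0, by omega⟩ ⟨1, by omega⟩ =
      ∑ i : Fin n, if i = ⟨0, by omega⟩ then
        algebraMap F (Adele F) ξ * s.entry ⟨i, by omega⟩ ⟨i + 1, by omega⟩ else 0 := by
    rw [Finset.sum_ite_eq' Finset.univ]
    simp
  rw [hsingle, simpleRootSum, simpleRootSum, ← Finset.sum_add_distrib]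
  refine Finset.sum_congr rfl fun i _ => ?_
  by_cases hi : (i : ℕ) = 0 <;> simp [hi, Fin.ext_iff]

theorem simpleRootSum_zero_rootHom (t : Adele F)
    (hne : (⟨0, by omega⟩ : Fin (2 * n)) ≠ ⟨1, by omega⟩) :
    simpleRootSum 0 (rootHom hne t) = 0 := by
  refine simpleRootSum_zero_eq_zero fun i j hi hin hij => ?_
  rw [entry_rootHom, Matrix.one_apply_ne (by rintro rfl; omega), rootMatrix_eq_zero, mul_zero,
    add_zero]
  all_goals simp only [Fin.ext_iff, Fin.val_rev]; omega

include hn in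
theorem simpleRootSum_alpha_conj (ξ : Fˣ) (s : Sp n (Adele F)) :
    simpleRootSum (ξ : F) ((alpha n (principalIdele ξ))⁻¹ * s * alpha n (principalIdele ξ)) =
      simpleRootSum 1 s := by
  refine Finset.sum_congr rfl fun i _ => ?_
  have hi_lt := i.isLt
  rw [entry_alpha_inv_mul_mul_alpha]
  have hlast : ¬ ((i : ℕ) + 1 + 1 = 2 * n) := by omega
  by_cases hi : (i : ℕ) = 0
  · have hunit : algebraMap F (Adele F) ξ * ((principalIdele ξ)⁻¹ : (Adele F)ˣ) = 1 :=
      (principalIdele ξ).mul_inv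
    simp only [hi, zero_add] at hlast
    simp only [alphaDiag, hi, if_true, zero_add, one_ne_zero, if_false, hlast, mul_one, map_one,
      one_mul, ← mul_assoc, hunit]
  · have hlast' : ¬ ((i : ℕ) + 1 = 2 * n) := by omega
    simp [alphaDiag, hi, hlast, hlast']

theorem entry_zero_one_rootHom (t : Adele F)
    (hne : (⟨0, by omega⟩ : Fin (2 * n)) ≠ ⟨1, by omega⟩) :
    (rootHom hne t).entry ⟨0, by omega⟩ ⟨1, by omega⟩ = t := by
  rw [entry_rootHom, Matrix.one_apply_ne hne, zero_add, rootMatrix_self, mul_one]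

theorem entry_zero_one_mul {u s : Sp n (Adele F)} (hu : u ∈ subgroupU n (Adele F))
    (hs : s ∈ subgroupN n (Adele F)) :
    (u * s).entry ⟨0, by omega⟩ ⟨1, by omega⟩ = s.entry ⟨0, by omega⟩ ⟨1, by omega⟩ := by
  rw [entry_mul_of_succ hu.1 hs rfl, hu.2 _ _ rfl (.inl rfl), zero_add]

include hn in
theorem zero_lt_one_index : (⟨0, by omega⟩ : Fin (2 * n)) < ⟨1, by omega⟩ := Nat.zero_lt_one

theorem isCentralStep_subgroupU_subgroupN :
    IsCentralStep (subgroupN n (Adele F)) (subgroupU n (Adele F)) (subgroupN n (Adele F))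
      (rootHom (zero_lt_one_index hn).ne) := by
  have hstep := isCentralStep_rootHom (F := F) le_rfl (isRootOrder_heightOrder n)
    (zero_lt_one_index hn)
  have horder : heightOrder n ⟨0, by omega⟩ ⟨1, by omega⟩ = 2 * n := by simp [heightOrder]
  have hN : rootFiltration (Adele F) (isRootOrder_heightOrder n) (2 * n) =
      subgroupN n (Adele F) := by
    refine le_antisymm (rootFiltration_le _ _) fun s hs => ⟨hs, fun a b hab hr => ?_⟩
    have hab' : (a : ℕ) < b := hab
    have := Nat.mul_le_mul_right (2 * n) (show 1 ≤ (b : ℕ) - a by omega)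
    rw [heightOrder] at hr
    omega
  rwa [horder, ← subgroupU_eq_rootFiltration, hN] at hstep

end Characters

/-! ### Fourier expansion along the first simple root -/

section Maps

variable {n : ℕ} {F : Type*} [Field F] [NumberField F] {H K S : Subgroup (Sp n (Adele F))}

/-- The map `(H ∩ Sp_{2n}(F)) \ H → (K ∩ Sp_{2n}(F)) \ K` induced by a homomorphism `H → K` which
preserves rational points. -/
def AdelicQuotient.map (e : H →* K)
    (he : ∀ s : H, (s : Sp n (Adele F)) ∈ rationalPoints n F →
      (e s : Sp n (Adele F)) ∈ rationalPoints n F) : AdelicQuotient H → AdelicQuotient K :=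
  Quotient.map e fun s t hst => by
    rw [← Quotient.eq_iff_equiv] at hst ⊢
    have hmem := he _ (AdelicQuotient.mk_eq_mk.1 hst)
    rw [map_mul, map_inv] at hmem
    exact AdelicQuotient.mk_eq_mk.2 hmem

variable {e : H →* K} (he : ∀ s : H, (s : Sp n (Adele F)) ∈ rationalPoints n F →
  (e s : Sp n (Adele F)) ∈ rationalPoints n F) (hcont : Continuous e)

theorem AdelicQuotient.map_mk (s : H) :
    AdelicQuotient.map e he (AdelicQuotient.mk s) = AdelicQuotient.mk (e s) := rfl

include hcont in
theorem AdelicQuotient.continuous_map : Continuous (AdelicQuotient.map e he) :=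
  AdelicQuotient.isOpenQuotientMap_mk.isQuotientMap.continuous_iff.2
    (AdelicQuotient.isOpenQuotientMap_mk.continuous.comp hcont)

include hcont in
theorem IsInvariantProbability.map {μ : Measure (AdelicQuotient H)}
    (hμ : IsInvariantProbability μ) (hsurj : Function.Surjective e) :
    IsInvariantProbability (μ.map (AdelicQuotient.map e he)) := by
  have := hμ.isProbabilityMeasure
  have hmeas := (AdelicQuotient.continuous_map he hcont).measurable
  refine ⟨Measure.isProbabilityMeasure_map hmeas.aemeasurable, fun m => ?_⟩
  obtain ⟨m, rfl⟩ := hsurj m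
  have hcomm : AdelicQuotient.rightTranslate (e m) ∘ AdelicQuotient.map e he =
      AdelicQuotient.map e he ∘ AdelicQuotient.rightTranslate m := by
    funext q
    rw [← q.mk_rep, Function.comp_apply, Function.comp_apply, AdelicQuotient.map_mk,
      AdelicQuotient.rightTranslate_mk, AdelicQuotient.rightTranslate_mk, AdelicQuotient.map_mk,
      map_mul]
  rw [Measure.map_map (AdelicQuotient.continuous_rightTranslate _).measurable hmeas, hcomm,
    ← Measure.map_map hmeas (AdelicQuotient.continuous_rightTranslate m).measurable,
    hμ.map_rightTranslate]

include hcont in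
theorem IsAutomorphic.average_map {V : Type*} [NormedAddCommGroup V] [NormedSpace ℝ V]
    [SecondCountableTopology V] {h : S → V} (hh : IsAutomorphic h) (hK : K ≤ S)
    (μ : Measure (AdelicQuotient H)) (s : S) :
    average hK (μ.map (AdelicQuotient.map e he)) h s =
      ∫ q, h (Subgroup.inclusion hK (e q.rep) * s) ∂μ := by
  rw [average, integral_map (AdelicQuotient.continuous_map he hcont).aemeasurable
    (hh.continuous_rep hK s).aestronglyMeasurable]
  congr 1 with q
  rw [← hh.left_inv.apply_rep hK (e q.rep) s, ← AdelicQuotient.map_mk he, q.mk_rep]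

end Maps

section Twist

variable {n : ℕ} {F : Type*} [Field F] [NumberField F] {ψ : AddChar (Adele F) ℂ}
  (hψ_cont : Continuous ψ) (hψ_F : ∀ x : F, ψ (algebraMap F (Adele F) x) = 1)
  {φ : Sp n (Adele F) → ℂ} (hinv : ∀ γ ∈ rationalPoints n F, ∀ g, φ (γ * g) = φ g)
  (hφ : Continuous φ) (g : Sp n (Adele F))

/-- The function `s ↦ φ(s g) ψ(ξ s₁₂ + s₂₃ + ⋯ + s_{n,n+1})⁻¹` on `N`. -/
def twist (ψ : AddChar (Adele F) ℂ) (φ : Sp n (Adele F) → ℂ) (g : Sp n (Adele F)) (ξ : F)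
    (s : subgroupN n (Adele F)) : ℂ :=
  φ (s * g) * (ψ (simpleRootSum ξ (s : Sp n (Adele F))))⁻¹

include hψ_cont hψ_F hinv hφ in
theorem isAutomorphic_twist (ξ : F) : IsAutomorphic (twist ψ φ g ξ) where
  continuous := by
    refine (hφ.comp (continuous_subtype_val.mul continuous_const)).mul
      (Continuous.inv₀ (hψ_cont.comp ((continuous_simpleRootSum ξ).comp continuous_subtype_val))
        fun s => ?_)
    rw [← norm_ne_zero_iff, norm_addChar_adele hψ_cont hψ_F]
    exact one_ne_zero
  left_inv := fun γ hγ s => by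
    obtain ⟨η, hη⟩ := exists_simpleRootSum_eq_algebraMap ξ hγ
    rw [twist, Subgroup.coe_mul, mul_assoc, hinv γ hγ, simpleRootSum_mul ξ γ.2 s.2, hη,
      AddChar.map_add_eq_mul, hψ_F, one_mul, twist]

theorem twist_eq_mul (hn : 2 ≤ n) (ξ : F) (s : subgroupN n (Adele F)) : twist ψ φ g ξ s =
    (ψ (algebraMap F (Adele F) ξ * (s : Sp n (Adele F)).entry ⟨0, by omega⟩ ⟨1, by omega⟩))⁻¹ *
      twist ψ φ g 0 s := by
  rw [twist, simpleRootSum_eq_add hn, AddChar.map_add_eq_mul, mul_inv, twist]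
  ring

theorem fourierIntegrand_eq_twist {H : Subgroup (Sp n (Adele F))}
    (hH : H ≤ subgroupN n (Adele F)) (q : AdelicQuotient H) :
    fourierIntegrand H ψ φ g q = twist ψ φ g 1 (Subgroup.inclusion hH q.rep * 1) := by
  rw [mul_one, fourierIntegrand, psiN_eq, twist, Subgroup.coe_inclusion]

include hψ_cont hψ_F hinv hφ in
theorem integrable_fourierIntegrand {H : Subgroup (Sp n (Adele F))}
    (hH : H ≤ subgroupN n (Adele F)) [CompactSpace (AdelicQuotient H)]
    {μ : Measure (AdelicQuotient H)} (hμ : IsInvariantProbability μ) :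
    Integrable (fourierIntegrand H ψ φ g) μ := by
  have := hμ.isProbabilityMeasure
  exact ((isAutomorphic_twist hψ_cont hψ_F hinv hφ g 1).integrable_rep hH μ 1).congr
    (ae_of_all _ fun q => (fourierIntegrand_eq_twist g hH q).symm)

theorem integral_fourierIntegrand_subgroupU (hn : 2 ≤ n)
    (μ : Measure (AdelicQuotient (subgroupU n (Adele F)))) :
    ∫ q, fourierIntegrand (subgroupU n (Adele F)) ψ φ g q ∂μ =
      average (subgroupU_le_subgroupN n F) μ (twist ψ φ g 0) 1 := by
  refine integral_congr_ae (ae_of_all _ fun q => ?_)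
  dsimp only
  rw [fourierIntegrand_eq_twist g (subgroupU_le_subgroupN n F), twist_eq_mul g hn, mul_one,
    Subgroup.coe_inclusion, q.rep.2.2 _ _ rfl (.inl rfl), mul_zero, AddChar.map_zero_eq_one,
    inv_one, one_mul]

include hinv in
theorem twist_one_alpha_mul (hn : 2 ≤ n) (ξ : Fˣ) (s : subgroupN n (Adele F)) :
    twist ψ φ (alpha n (principalIdele ξ) * g) 1 s =
      twist ψ φ g ξ (alphaConj (principalIdele ξ) s) := by
  rw [twist, twist, coe_alphaConj, simpleRootSum_alpha_conj hn,
    ← hinv _ (inv_mem (alpha_mem_rationalPoints ξ))]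
  simp only [mul_assoc]

include hψ_cont hψ_F hinv hφ in
/-- Conjugation by `α(ξ)⁻¹` turns the Whittaker function at `α(ξ) g` into a Fourier coefficient at
`g`. Uniqueness of the invariant measure is avoided by allowing that measure to change. -/
theorem exists_whittaker_alpha_mul_eq_average (hn : 2 ≤ n)
    {μ : Measure (AdelicQuotient (subgroupN n (Adele F)))} (hμ : IsInvariantProbability μ)
    (ξ : Fˣ) : ∃ ν : Measure (AdelicQuotient (subgroupN n (Adele F))), IsInvariantProbability ν ∧
      whittaker μ ψ φ (alpha n (principalIdele ξ) * g) = average le_rfl ν (twist ψ φ g ξ) 1 := by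
  have hrat (s : subgroupN n (Adele F)) (hs : (s : Sp n (Adele F)) ∈ rationalPoints n F) :
      (alphaConj (principalIdele ξ) s : Sp n (Adele F)) ∈ rationalPoints n F :=
    mul_mem (mul_mem (inv_mem (alpha_mem_rationalPoints ξ)) hs) (alpha_mem_rationalPoints ξ)
  have hcont : Continuous (alphaConj (n := n) (principalIdele ξ)) :=
    ((continuous_const.mul continuous_subtype_val).mul continuous_const).subtype_mk _
  refine ⟨_, hμ.map hrat hcont (alphaConj_surjective _), ?_⟩
  rw [(isAutomorphic_twist hψ_cont hψ_F hinv hφ g ξ).average_map hrat hcont]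
  refine integral_congr_ae (ae_of_all _ fun q => ?_)
  dsimp only
  rw [fourierIntegrand_eq_twist _ le_rfl, mul_one, mul_one, twist_one_alpha_mul hinv g hn]
  rfl

include hψ_cont hψ_F hinv hφ in
theorem average_twist_zero_eq_zero
    (hcusp : ∀ μ : Measure (AdelicQuotient (parabolicRadical n (Adele F) 1)),
      IsInvariantProbability μ → ∀ g, ∫ q, φ ((q.rep : Sp n (Adele F)) * g) ∂μ = 0)
    {ν : Measure (AdelicQuotient (subgroupN n (Adele F)))} (hν : IsInvariantProbability ν)
    (s : subgroupN n (Adele F)) : average le_rfl ν (twist ψ φ g 0) s = 0 := by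
  have hR := parabolicRadical_one_le_subgroupN n F
  obtain ⟨μ, hμ⟩ := (centralTower_parabolicRadical_one hR).exists_isInvariantProbability
  have hvanish : average hR μ (twist ψ φ g 0) = 0 := by
    funext s
    rw [Pi.zero_apply, ← zero_mul (ψ (simpleRootSum 0 (s : Sp n (Adele F))))⁻¹,
      ← hcusp μ hμ (s * g), ← integral_mul_const]
    refine integral_congr_ae (ae_of_all _ fun q => ?_)
    dsimp only
    rw [twist, Subgroup.coe_mul, Subgroup.coe_inclusion, simpleRootSum_mul 0 (hR q.rep.2) s.2,
      simpleRootSum_zero_radical q.rep.2, zero_add, mul_assoc]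
  rw [← (centralTower_parabolicRadical_one le_rfl).average_average hR hμ
    (isAutomorphic_twist hψ_cont hψ_F hinv hφ g 0) hR le_rfl hν, hvanish]
  exact integral_zero _ _

end Twist

section Expansion

open NumberField

variable {n : ℕ} {F : Type*} [Field F] [NumberField F] {ψ : AddChar (Adele F) ℂ}
  (hψ_cont : Continuous ψ) (hψ_F : ∀ x : F, ψ (algebraMap F (Adele F) x) = 1)
  {φ : Sp n (Adele F) → ℂ} (hinv : ∀ γ ∈ rationalPoints n F, ∀ g, φ (γ * g) = φ g)
  (g : Sp n (Adele F)) (hn : 2 ≤ n)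
  {μ : Measure (AdelicQuotient (subgroupU n (Adele F)))} (hμ : IsInvariantProbability μ)

/-- The function `t ↦ ∫_{U(F) \ U(𝔸)} φ(u x₁₂(t) g) ψ_N(u)⁻¹ du` on `𝔸 / F`, whose Fourier series
is to be computed. -/
def averageOnRoot (ψ : AddChar (Adele F) ℂ) (φ : Sp n (Adele F) → ℂ) (g : Sp n (Adele F))
    (μ : Measure (AdelicQuotient (subgroupU n (Adele F)))) (t : AdeleClass F) : ℂ :=
  average (subgroupU_le_subgroupN n F) μ (twist ψ φ g 0)
    ((isCentralStep_subgroupU_subgroupN hn).lift le_rfl t.out * 1)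

theorem twist_zero_mul_rootHom (u : subgroupU n (Adele F)) (a : Adele F) :
    twist ψ φ g 0 (Subgroup.inclusion (subgroupU_le_subgroupN n F) u *
      (isCentralStep_subgroupU_subgroupN hn).lift le_rfl a) =
        (ψ (simpleRootSum 0 (u : Sp n (Adele F))))⁻¹ *
          φ ((u : Sp n (Adele F)) * rootHom (zero_lt_one_index hn).ne a * g) := by
  change φ ((u : Sp n (Adele F)) * rootHom (zero_lt_one_index hn).ne a * g) *
    (ψ (simpleRootSum 0 ((u : Sp n (Adele F)) * rootHom (zero_lt_one_index hn).ne a)))⁻¹ = _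
  rw [simpleRootSum_mul 0 u.2.1 ((isCentralStep_subgroupU_subgroupN hn).apply_mem a),
    simpleRootSum_zero_rootHom hn a (zero_lt_one_index hn).ne, add_zero, mul_comm]

section Continuous

variable (hφ : Continuous φ)

include hψ_cont hψ_F hinv hμ hφ

theorem isAutomorphic_average_twist :
    IsAutomorphic (average (subgroupU_le_subgroupN n F) μ (twist ψ φ g 0)) :=
  (centralTower_subgroupU le_rfl).isAutomorphic_average _ hμ
    (isAutomorphic_twist hψ_cont hψ_F hinv hφ g 0)

theorem continuous_averageOnRoot : Continuous (averageOnRoot hn ψ φ g μ) :=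
  (isCentralStep_subgroupU_subgroupN hn).continuous_out_mul le_rfl
    (isAutomorphic_average_twist hψ_cont hψ_F hinv g hμ hφ) 1

theorem averageOnRoot_coe (a : Adele F) : averageOnRoot hn ψ φ g μ (a : AdeleClass F) =
    ∫ q, (ψ (simpleRootSum 0 (q.rep : Sp n (Adele F))))⁻¹ *
      φ ((q.rep : Sp n (Adele F)) * rootHom (zero_lt_one_index hn).ne a * g) ∂μ := by
  rw [averageOnRoot, (isCentralStep_subgroupU_subgroupN hn).apply_out le_rfl
    (isAutomorphic_average_twist hψ_cont hψ_F hinv g hμ hφ).left_inv, mul_one]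
  exact integral_congr_ae (ae_of_all _ fun q => twist_zero_mul_rootHom g hn q.rep a)

theorem averageOnRoot_zero : averageOnRoot hn ψ φ g μ 0 =
    average (subgroupU_le_subgroupN n F) μ (twist ψ φ g 0) 1 := by
  rw [← QuotientAddGroup.mk_zero, averageOnRoot,
    (isCentralStep_subgroupU_subgroupN hn).apply_out le_rfl
      (isAutomorphic_average_twist hψ_cont hψ_F hinv g hμ hφ).left_inv,
    AddChar.map_zero_eq_one, mul_one]

omit hψ_cont hψ_F hinv hμ hφ in
theorem average_twist (ξ : F) (s : subgroupN n (Adele F)) :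
    average (subgroupU_le_subgroupN n F) μ (twist ψ φ g ξ) s =
      (ψ (algebraMap F (Adele F) ξ * (s : Sp n (Adele F)).entry ⟨0, by omega⟩ ⟨1, by omega⟩))⁻¹ *
        average (subgroupU_le_subgroupN n F) μ (twist ψ φ g 0) s := by
  rw [average, average, ← integral_const_mul]
  refine integral_congr_ae (ae_of_all _ fun q => ?_)
  dsimp only
  rw [twist_eq_mul g hn, Subgroup.coe_mul, Subgroup.coe_inclusion,
    entry_zero_one_mul hn q.rep.2 s.2]

theorem average_twist_eq_charCoeff {ν : Measure (AdelicQuotient (subgroupN n (Adele F)))}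
    (hν : IsInvariantProbability ν) (ξ : F) : average le_rfl ν (twist ψ φ g ξ) 1 =
      charCoeff (adeleClassMeasure F) (classChar ψ hψ_F ξ) (averageOnRoot hn ψ φ g μ) := by
  have hx := isCentralStep_subgroupU_subgroupN (F := F) hn
  rw [(centralTower_subgroupU le_rfl).average_eq_oneParamAverage hx hμ
    (isAutomorphic_twist hψ_cont hψ_F hinv hφ g ξ) le_rfl hν]
  refine integral_congr_ae (ae_of_all _ fun t => ?_)
  dsimp only
  rw [average_twist g hn, averageOnRoot, mul_comm]
  congr 2
  conv_rhs => rw [← QuotientAddGroup.out_eq' t, classChar_coe]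
  rw [mul_one]
  congr 2
  exact entry_zero_one_rootHom hn _ _

end Continuous

variable (hφ : IsSmooth φ)

include hψ_cont hψ_F hinv hμ hφ

theorem exists_forall_averageOnRoot_add_eq : ∃ N : ℕ, N ≠ 0 ∧ ∀ t : AdeleClass F,
    ∀ y ∈ integralFiniteAdeles (𝓞 F) F,
      averageOnRoot hn ψ φ g μ (t + (finiteAdele (N • y) : Adele F)) =
        averageOnRoot hn ψ φ g μ t := by
  have hφc := continuous_of_isSmooth hφ
  obtain ⟨N, hN, hinvN⟩ :=
    exists_forall_apply_mul_finiteAdele_mul (zero_lt_one_index hn).ne hinv hφ g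
  refine ⟨N, hN, fun t y hy => ?_⟩
  obtain ⟨a, rfl⟩ := QuotientAddGroup.mk_surjective t
  rw [← QuotientAddGroup.mk_add, averageOnRoot_coe hψ_cont hψ_F hinv g hn hμ hφc,
    averageOnRoot_coe hψ_cont hψ_F hinv g hn hμ hφc]
  congr 1 with q
  rw [AddChar.map_add_eq_mul, ← mul_assoc, hinvN _ (mul_mem q.rep.2.1
    ((isCentralStep_subgroupU_subgroupN hn).apply_mem a)) y hy]

open scoped Classical in
theorem exists_forall_norm_fwdDiff_iter_averageOnRoot_le (k : ℕ) :
    ∃ B, ∀ (h : mixedEmbedding.mixedSpace F) (t : AdeleClass F),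
      ‖(fwdDiff ((archAdele h : Adele F) : AdeleClass F))^[k] (averageOnRoot hn ψ φ g μ) t‖ ≤
        B * ‖h‖ ^ k := by
  have := hμ.isProbabilityMeasure
  have hφc := continuous_of_isSmooth hφ
  have hx := isCentralStep_subgroupU_subgroupN (F := F) hn
  obtain ⟨B, hB⟩ := exists_forall_norm_fwdDiff_iter_le (zero_lt_one_index hn) hinv hφ k g
  refine ⟨B, fun h t => ?_⟩
  obtain ⟨a, rfl⟩ := QuotientAddGroup.mk_surjective t
  let f : AdelicQuotient (subgroupU n (Adele F)) → Adele F → ℂ := fun q b =>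
    (ψ (simpleRootSum 0 (q.rep : Sp n (Adele F))))⁻¹ *
      φ ((q.rep : Sp n (Adele F)) * rootHom (zero_lt_one_index hn).ne (a + b) * g)
  have hdiff : (fwdDiff ((archAdele h : Adele F) : AdeleClass F))^[k]
      (averageOnRoot hn ψ φ g μ) (a : AdeleClass F) =
        (fwdDiff (archAdele h))^[k] (fun b => ∫ q, f q b ∂μ) 0 :=
    fwdDiff_iter_congr fun j _ => by
      rw [← QuotientAddGroup.mk_nsmul, ← QuotientAddGroup.mk_add, zero_add,
        averageOnRoot_coe hψ_cont hψ_F hinv g hn hμ hφc]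
  have hint (b : Adele F) : Integrable (fun q => f q b) μ :=
    ((isAutomorphic_twist hψ_cont hψ_F hinv hφc g 0).integrable_rep
      (subgroupU_le_subgroupN n F) μ (hx.lift le_rfl (a + b))).congr
        (ae_of_all _ fun q => twist_zero_mul_rootHom g hn q.rep (a + b))
  have hbound (q : AdelicQuotient (subgroupU n (Adele F))) :
      ‖(fwdDiff (archAdele h))^[k] (f q) 0‖ ≤ B * ‖h‖ ^ k := by
    have hf : f q = (ψ (simpleRootSum 0 (q.rep : Sp n (Adele F))))⁻¹ • fun b =>
        φ ((q.rep : Sp n (Adele F)) * rootHom (zero_lt_one_index hn).ne a *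
          rootHom (zero_lt_one_index hn).ne b * g) := by
      funext b
      simp only [f, AddChar.map_add_eq_mul, mul_assoc, Pi.smul_apply, smul_eq_mul]
    rw [hf, fwdDiff_iter_const_smul, Pi.smul_apply, norm_smul, norm_inv,
      norm_addChar_adele hψ_cont hψ_F, inv_one, one_mul]
    exact hB h _ (mul_mem q.rep.2.1 (hx.apply_mem a))
  rw [hdiff, fwdDiff_iter_integral hint]
  simpa using norm_integral_le_of_norm_le_const (ae_of_all μ hbound)

theorem hasSum_charCoeff_averageOnRoot (hψ_ne : ψ ≠ 1) :
    HasSum (fun ξ => charCoeff (adeleClassMeasure F) (classChar ψ hψ_F ξ)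
      (averageOnRoot hn ψ φ g μ)) (average (subgroupU_le_subgroupN n F) μ (twist ψ φ g 0) 1) := by
  have hφc := continuous_of_isSmooth hφ
  obtain ⟨N, hN, hinvN⟩ := exists_forall_averageOnRoot_add_eq hψ_cont hψ_F hinv g hn hμ hφ
  rw [← averageOnRoot_zero hψ_cont hψ_F hinv g hn hμ hφc]
  exact hasSum_charCoeff_classChar hψ_cont hψ_ne hψ_F
    (continuous_averageOnRoot hψ_cont hψ_F hinv g hn hμ hφc) hN hinvN
    (exists_forall_norm_fwdDiff_iter_averageOnRoot_le hψ_cont hψ_F hinv g hn hμ hφ)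

end Expansion

end SpUnfolding

end

open SpUnfolding in
theorem proposition2p2_general {F : Type*} [Field F] [NumberField F] (n : ℕ) (hn : 2 ≤ n)
    (ψ : AddChar (Adele F) ℂ) (hψ_cont : Continuous ψ) (hψ_ne : ψ ≠ 1)
    (hψ_F : ∀ x : F, ψ (algebraMap F (Adele F) x) = 1)
    (φ : Sp n (Adele F) → ℂ) (hinv : ∀ γ ∈ rationalPoints n F, ∀ g, φ (γ * g) = φ g)
    (hφ : IsSmooth φ)
    (hcusp : ∀ μ : Measure (AdelicQuotient (parabolicRadical n (Adele F) 1)),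
      IsInvariantProbability μ → ∀ g, ∫ q, φ ((q.rep : Sp n (Adele F)) * g) ∂μ = 0)
    (μU : Measure (AdelicQuotient (subgroupU n (Adele F)))) (hμU : IsInvariantProbability μU)
    (μN : Measure (AdelicQuotient (subgroupN n (Adele F)))) (hμN : IsInvariantProbability μN)
    (g : Sp n (Adele F)) :
    Integrable (fourierIntegrand (subgroupU n (Adele F)) ψ φ g) μU ∧
    (∀ ξ : Fˣ, Integrable (fourierIntegrand (subgroupN n (Adele F)) ψ φ
      (alpha n (Units.map (algebraMap F (Adele F)).toMonoidHom ξ) * g)) μN) ∧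
    HasSum
      (fun ξ : Fˣ =>
        whittaker μN ψ φ (alpha n (Units.map (algebraMap F (Adele F)).toMonoidHom ξ) * g))
      (∫ q, fourierIntegrand (subgroupU n (Adele F)) ψ φ g q ∂μU) := by
  have hφc := continuous_of_isSmooth hφ
  refine ⟨integrable_fourierIntegrand hψ_cont hψ_F hinv hφc g (subgroupU_le_subgroupN n F) hμU,
    fun ξ => integrable_fourierIntegrand hψ_cont hψ_F hinv hφc _ le_rfl hμN, ?_⟩
  set c : F → ℂ := fun ξ =>
    charCoeff (adeleClassMeasure F) (classChar ψ hψ_F ξ) (averageOnRoot hn ψ φ g μU)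
  have hwhittaker (ξ : Fˣ) :
      whittaker μN ψ φ (alpha n (Units.map (algebraMap F (Adele F)).toMonoidHom ξ) * g) = c ξ := by
    obtain ⟨ν, hν, heq⟩ :=
      exists_whittaker_alpha_mul_eq_average hψ_cont hψ_F hinv hφc g hn hμN ξ
    exact heq.trans (average_twist_eq_charCoeff hψ_cont hψ_F hinv g hn hμU hφc hν ξ)
  have hzero : c 0 = 0 :=
    (average_twist_eq_charCoeff hψ_cont hψ_F hinv g hn hμU hφc hμN 0).symm.trans
      (average_twist_zero_eq_zero hψ_cont hψ_F hinv hφc g hcusp hμN 1)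
  have hsupport (ξ : F) (hξ : ξ ∉ Set.range ((↑) : Fˣ → F)) : c ξ = 0 := by
    obtain rfl : ξ = 0 := by_contra fun hne => hξ ⟨Units.mk0 ξ hne, rfl⟩
    exact hzero
  rw [integral_fourierIntegrand_subgroupU g hn, funext hwhittaker]
  exact (Units.val_injective.hasSum_iff hsupport).2
    (hasSum_charCoeff_averageOnRoot hψ_cont hψ_F hinv g hn hμU hφ hψ_ne)

open SpUnfolding in
theorem proposition2p2 {F : Type*} [Field F] [NumberField F] (n : ℕ) (hn : 2 ≤ n)
    (ψ : AddChar (Adele F) ℂ) (hψ_cont : Continuous ψ) (hψ_ne : ψ ≠ 1)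
    (hψ_F : ∀ x : F, ψ (algebraMap F (Adele F) x) = 1)
    (φ : Sp n (Adele F) → ℂ) (hφ : IsSmoothCuspForm φ)
    (μU : Measure (AdelicQuotient (subgroupU n (Adele F)))) (hμU : IsInvariantProbability μU)
    (μN : Measure (AdelicQuotient (subgroupN n (Adele F)))) (hμN : IsInvariantProbability μN)
    (g : Sp n (Adele F)) :
    Integrable (fourierIntegrand (subgroupU n (Adele F)) ψ φ g) μU ∧
    (∀ ξ : Fˣ, Integrable (fourierIntegrand (subgroupN n (Adele F)) ψ φ
      (alpha n (Units.map (algebraMap F (Adele F)).toMonoidHom ξ) * g)) μN) ∧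
    HasSum
      (fun ξ : Fˣ =>
        whittaker μN ψ φ (alpha n (Units.map (algebraMap F (Adele F)).toMonoidHom ξ) * g))
      (∫ q, fourierIntegrand (subgroupU n (Adele F)) ψ φ g q ∂μU) :=
  proposition2p2_general n hn ψ hψ_cont hψ_ne hψ_F φ hφ.left_invariant hφ.smooth
    (hφ.cuspidal 1 le_rfl (by omega)) μU hμU μN hμN g
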